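/- **Conventions.** Let $\mathrm{Ur}$ be a set of urelements (objects without elements). Let $\mathrm{Fin}^+$ be the family of all non-empty finite sets built from urelements by iterating the formation of non-empty finite sets: the least family that contains every non-empty finite set each of whose elements is an urelement or a member of $\mathrm{Fin}^+$. A *sequence* $\vec q=s_0\cdots s_m$ is a finite, possibly empty, sequence of sets in $\mathrm{Fin}^+$. *Faces and vertices* (by recursion on the length). The faces of the empty sequence are the non-empty finite subsets of $\mathrm{Ur}$. A set $t\in\mathrm{Fin}^+$ is a face of $s\,\vec q$ if and only if it is not the case that $s$ is a face of $\vec q$ with $s\subseteq t$, and, moreover, either $t$ is a face of $\vec q$, or $s\in t$ and $(t\setminus\{s\})\cup s$ is a face of $\vec q$. Put $\mathrm{vr}(\vec q)=\bigcup\{t: t\text{ is a face of }\vec q\}$; its elements are the vertices of $\vec q$. *Combinatorial equivalence* $\equiv$ is the smallest equivalence relation on sequences such that (a) $t\,\vec t\equiv\vec t$ if $t$ is not a face of $\vec t$; (b) $s\,t\,\vec t\equiv t\,s\,\vec t$ if $s\notin t$, $t\notin s$, and either $s\cup t$ is not a face of $\vec t$ or $s\cap t=\emptyset$; (c) $\vec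 t\equiv\vec t'$ implies $s\,\vec t\equiv s\,\vec t'$. Maps $f\colon\vec t\to\vec s$ are functions $\mathrm{vr}(\vec t)\to\mathrm{vr}(\vec s)$, where domain and codomain are taken up to $\equiv$. A map "given by an assignment $x\to y$" sends $x$ to $y$ if $x$ is a vertex of the domain and fixes all other vertices. *Additive families and division.* A finite family $S$ of faces of $\vec q$ is *additive* if $s_1\cup s_2\in S$ whenever $s_1,s_2\in S$ and $s_1\cup s_2$ is a face of $\vec q$. A *non-decreasing enumeration* of $S$ is an injective list $s_0,\dots,s_l$ of its elements such that $s_i\subseteq s_j$ implies $i\le j$; $S\,\vec q$ is the sequence $s_0\cdots s_l\,\vec q$ (its class under $\equiv$ does not depend on the enumeration). For a map $f\colon\vec t\to\vec s$ and $s\in\mathrm{Fin}^+$, let $f^{-1}(s)$ be the family of all faces $t$ of $\vec t$ with $f[t]=s$. The *division* $sf\colon f^{-1}(s)\,\vec t\to s\,\vec s$ sends each vertex $t\in f^{-1}(s)$ to $s$ and every other vertex $x$ to $f(x)$. For an additive family $S$ of faces of $\vec s$ with non-decreasing enumeration $s_0,\dots,s_l$, put $Sf=s_0(s_1(\cdots(s_lf)\cdots))$.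 Let $\mathrm u(f)$ be the set of those vertices of $\vec s$ that are the image under $f$ of exactly one vertex of $\vec t$; the division $sf$ is *pure* if $s\subseteq\mathrm u(f)$. *Weld maps.* For $x\in t\in\mathrm{Fin}^+$ with $t\notin\mathrm{vr}(\vec q)$, the weld map $\pi^{\vec q}_{x,t}\colon t\,\vec q\to\vec q$ is given by $t\to x$. If $T$ is an additive family of faces of $\vec q$ and $p$ belongs to every face in $T$, then $\pi^{\vec q}_{p,T}\colon T\,\vec q\to\vec q$ sends each $t\in T$ to $p$ and fixes all other vertices. *Combinatorial isomorphisms* form the smallest class of maps that is closed under composition and division and contains, for all sequences $\vec q$, the following maps; here $\mathrm{tc}(\mathrm{vr}(\vec q))$ is the collection of all vertices of $\vec q$, their elements, the elements of those, and so on: 1. $(r\cup\{t\})\,(r\cup s)\,t\,\vec q\to(s\cup\{t\})\,(r\cup s)\,t\,\vec q$ given by $t\to s\cup\{t\}$, $r\cup\{t\}\to t$, where $t\in\mathrm{Fin}^+$, $r,s\subseteq t$, $r\cup s\neq\emptyset$, $r\cap s=\emptyset$ and $t\notin\mathrm{tc}(\mathrm{vr}(\vec q))$; 2. $((s\setminus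 t)\cup\{t\})\,s\,t\,\vec q\to((t\setminus s)\cup\{s\})\,t\,s\,\vec q$ given by $(s\setminus t)\cup\{t\}\to(t\setminus s)\cup\{s\}$, where $s,t\in\mathrm{Fin}^+$, $s\notin t$, $t\notin s$ and $s,t\notin\mathrm{tc}(\mathrm{vr}(\vec q))$; 3. $\vec q\to\{x\}\,\vec q$ given by $x\to\{x\}$, and $\{x\}\,\vec q\to\vec q$ given by $\{x\}\to x$, where $x\in\mathrm{Ur}\cup\mathrm{Fin}^+$ and $\{x\}\notin\mathrm{vr}(\vec q)$. *Pure weld-division maps* form the smallest class of maps that contains all weld maps and all combinatorial isomorphisms and is closed under composition and pure division. **Main Lemma.** Let $S$ and $T$ be finite additive families of faces of a sequence $\vec q$ such that, for all $s\in S$ and $t\in T$, if $s\cup t$ is a face of $\vec q$, then $s\cup t\in T$. Let $p$ be a vertex of $\vec q$ contained in every face from $T$. Then the map $S\,\pi^{\vec q}_{p,T}$ is a pure weld-division map. -/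

import Mathlib

universe u

namespace WeldCalculus

/-- The functor whose least fixed point is `Elem`: an element is either an urelement or a
non-empty finite set of previously constructed elements. -/
def ElemF (Ur : Type u) (α : Type u) : Type u :=
  Ur ⊕ {F : Finset α // F.Nonempty}

open Classical in
/-- `ElemF Ur` is a quotient of the polynomial functor whose shapes are an urelement (no children)
or a natural number `n` (a list of `n + 1` children, read as the set of its entries). -/
noncomputable instance ElemF.instQPF (Ur : Type u) : QPF (ElemF Ur) where
  map f := Sum.map id (fun F => ⟨F.1.image f, F.2.image f⟩)
  P := ⟨Ur ⊕ ℕ, fun a => Sum.elim (fun _ => PEmpty) (fun n => ULift (Fin (n + 1))) a⟩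
  abs := fun {α} x => match x with
    | ⟨Sum.inl a, _⟩ => Sum.inl a
    | ⟨Sum.inr n, f⟩ => Sum.inr ⟨Finset.univ.image (fun i : Fin (n + 1) => (f (ULift.up i) : α)),
        Finset.univ_nonempty.image _⟩
  repr := fun {α} x => match x with
    | Sum.inl a => ⟨Sum.inl a, fun e => PEmpty.elim e⟩
    | Sum.inr F => ⟨Sum.inr (F.1.card - 1), fun i =>
        (F.1.equivFin.symm (Fin.cast
          (Nat.sub_add_cancel (Finset.card_pos.mpr F.2)) (ULift.down i)) : α)⟩
  abs_repr := by
    intro α x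
    rcases x with a | F
    · rfl
    · refine congrArg Sum.inr (Subtype.ext ?_)
      ext y
      simp only [Finset.mem_image, Finset.mem_univ, true_and]
      constructor
      · rintro ⟨i, rfl⟩
        exact Subtype.property _
      · intro hy
        refine ⟨Fin.cast (Nat.sub_add_cancel (Finset.card_pos.mpr F.2)).symm
          (F.1.equivFin ⟨y, hy⟩), ?_⟩
        simp
  abs_map := by
    intro α β f x
    rcases x with ⟨a | n, g⟩
    · rfl
    · refine congrArg Sum.inr (Subtype.ext ?_)
      ext y
      simp only [Finset.mem_image, Finset.mem_univ, true_and]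
      constructor
      · rintro ⟨i, rfl⟩
        exact ⟨_, ⟨i, rfl⟩, rfl⟩
      · rintro ⟨_, ⟨i, rfl⟩, rfl⟩
        exact ⟨i, rfl⟩

/-- All objects built from the urelements `Ur` by iterating the formation of non-empty finite sets,
the urelements included. -/
def Elem (Ur : Type u) : Type u := QPF.Fix (ElemF Ur)

/-- `Fin⁺`: the non-empty finite sets of elements. -/
abbrev FinPlus (Ur : Type u) : Type u := {F : Finset (Elem Ur) // F.Nonempty}

variable {Ur : Type u}

namespace Elem

/-- An urelement as an element. -/
noncomputable def ofUr (a : Ur) : Elem Ur := QPF.Fix.mk (F := ElemF Ur) (Sum.inl a)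

/-- A set in `Fin⁺` as an element (of further sets). -/
noncomputable def ofSet (F : FinPlus Ur) : Elem Ur := QPF.Fix.mk (F := ElemF Ur) (Sum.inr F)

/-- Every element is, in exactly one way, an urelement or a non-empty finite set of elements. -/
noncomputable def equivSum : Elem Ur ≃ Ur ⊕ FinPlus Ur where
  toFun x := QPF.Fix.dest (F := ElemF Ur) x
  invFun x := QPF.Fix.mk (F := ElemF Ur) x
  left_inv x := QPF.Fix.mk_dest (F := ElemF Ur) x
  right_inv x := QPF.Fix.dest_mk (F := ElemF Ur) x

theorem equivSum_ofUr (a : Ur) : equivSum (ofUr a) = Sum.inl a :=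
  QPF.Fix.dest_mk (F := ElemF Ur) (Sum.inl a)

theorem equivSum_ofSet (F : FinPlus Ur) : equivSum (ofSet F) = Sum.inr F :=
  QPF.Fix.dest_mk (F := ElemF Ur) (Sum.inr F)

theorem ofUr_injective : Function.Injective (ofUr : Ur → Elem Ur) := fun a b h => by
  have := congrArg equivSum h
  rw [equivSum_ofUr, equivSum_ofUr] at this
  exact Sum.inl_injective this

theorem ofSet_injective : Function.Injective (ofSet : FinPlus Ur → Elem Ur) := fun a b h => by
  have := congrArg equivSum h
  rw [equivSum_ofSet, equivSum_ofSet] at this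
  exact Sum.inr_injective this

theorem ofUr_ne_ofSet (a : Ur) (F : FinPlus Ur) : ofUr a ≠ ofSet F := fun h => by
  have := congrArg equivSum h
  rw [equivSum_ofUr, equivSum_ofSet] at this
  cases this

open Classical in
/-- Well-foundedness of membership, as an induction principle. -/
theorem induction {C : Elem Ur → Prop} (hUr : ∀ a, C (ofUr a))
    (hSet : ∀ F : FinPlus Ur, (∀ x ∈ F.1, C x) → C (ofSet F)) (x : Elem Ur) : C x := by
  refine QPF.Fix.ind (F := ElemF Ur) C ?_ x
  rintro (a | F) hF
  · exact hUr a
  · refine hSet F ?_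
    obtain ⟨a | n, f, h1, h2⟩ := (QPF.liftp_iff (F := ElemF Ur) C _).mp hF
    · cases h1
    · intro y hy
      have h3 : F.1 = Finset.univ.image (fun i : Fin (n + 1) => f (ULift.up.{u} i)) :=
        congrArg Subtype.val (Sum.inr_injective h1)
      rw [h3] at hy
      simp only [Finset.mem_image, Finset.mem_univ, true_and] at hy
      obtain ⟨i, rfl⟩ := hy
      exact h2 _

/-- `x ∈ y`, where urelements have no elements. -/
def IsMem (x y : Elem Ur) : Prop := ∃ F : FinPlus Ur, y = ofSet F ∧ x ∈ F.1

end Elem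

open Elem

/-- The transitive closure of a set `V` of elements: the elements of `V`, their elements, the
elements of those, and so on. -/
def tc (V : Set (Elem Ur)) : Set (Elem Ur) :=
  {x | ∃ v ∈ V, Relation.ReflTransGen IsMem x v}

namespace FinPlus

open Classical in
/-- The union `s ∪ t`. -/
noncomputable def union (s t : FinPlus Ur) : FinPlus Ur :=
  ⟨s.1 ∪ t.1, s.2.mono Finset.subset_union_left⟩

open Classical in
/-- The set `r ∪ {t}`, where `r` may be empty. -/
noncomputable def adjoin (r : Finset (Elem Ur)) (t : FinPlus Ur) : FinPlus Ur :=
  ⟨insert (ofSet t) r, Finset.insert_nonempty _ _⟩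

open Classical in
/-- The set `(t \ {s}) ∪ s`. -/
noncomputable def unfold (t s : FinPlus Ur) : FinPlus Ur :=
  ⟨t.1.erase (ofSet s) ∪ s.1, s.2.mono Finset.subset_union_right⟩

open Classical in
/-- The pointwise image of a set. -/
noncomputable def image (f : Elem Ur → Elem Ur) (t : FinPlus Ur) : FinPlus Ur :=
  ⟨t.1.image f, t.2.image f⟩

/-- The singleton `{x}`. -/
def sing (x : Elem Ur) : FinPlus Ur := ⟨{x}, Finset.singleton_nonempty x⟩

end FinPlus

/-- Finite sequences `s₀ s₁ ⋯ sₘ` of sets in `Fin⁺`. The head `s₀` is the division that is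
performed last. -/
abbrev SetSeq (Ur : Type u) : Type u := List (FinPlus Ur)

/-- `IsFace q t`: the set `t` is a face of the sequence `q`, by recursion on `q`. -/
def IsFace : SetSeq Ur → FinPlus Ur → Prop
  | [], t => ∀ x ∈ t.1, ∃ a, x = ofUr a
  | s :: q, t => ¬ (IsFace q s ∧ s.1 ⊆ t.1) ∧
      (IsFace q t ∨ (ofSet s ∈ t.1 ∧ IsFace q (t.unfold s)))

/-- The recursion for faces, unwound along the whole sequence `s₀ ⋯ sₘ`: either `t` consists of
urelements and includes no `sⱼ` that is a face of `sⱼ₊₁ ⋯ sₘ`, or, for some `i`, `sᵢ ∈ t`,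
`(t \ {sᵢ}) ∪ sᵢ` is a face of `sᵢ₊₁ ⋯ sₘ`, and `t` includes no such `sⱼ` with `j ≤ i`. -/
theorem isFace_iff (q : SetSeq Ur) (t : FinPlus Ur) :
    IsFace q t ↔
      ((∀ x ∈ t.1, ∃ a, x = ofUr a) ∧
        ∀ j : Fin q.length, IsFace (q.drop (j + 1)) q[j] → ¬ q[j].1 ⊆ t.1) ∨
      ∃ i : Fin q.length, ofSet q[i] ∈ t.1 ∧ IsFace (q.drop (i + 1)) (t.unfold q[i]) ∧
        ∀ j : Fin q.length, j ≤ i → IsFace (q.drop (j + 1)) q[j] → ¬ q[j].1 ⊆ t.1 := by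
  induction q with
  | nil => simp [IsFace]
  | cons s q ih =>
    rw [IsFace, ih]
    constructor
    · rintro ⟨h, (⟨h1, h2⟩ | ⟨i, h1, h2, h3⟩) | ⟨h1, h2⟩⟩
      · refine Or.inl ⟨h1, fun j => ?_⟩
        refine Fin.cases ?_ (fun k => ?_) j
        · simpa using h
        · simpa using h2 k
      · refine Or.inr ⟨i.succ, by simpa using h1, by simpa using h2, fun j => ?_⟩
        refine Fin.cases ?_ (fun k => ?_) j
        · intro _; simpa using h
        · intro hk; simpa using h3 k (Fin.succ_le_succ_iff.mp hk)
      · refine Or.inr ⟨0, by simpa using h1, by simpa using h2, fun j hj => ?_⟩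
        obtain rfl : j = 0 := Fin.le_zero_iff.mp hj
        simpa using h
    · rintro (⟨h1, h2⟩ | ⟨i, h1, h2, h3⟩)
      · exact ⟨by simpa using h2 0, Or.inl (Or.inl ⟨h1, fun j => by simpa using h2 j.succ⟩)⟩
      · revert h1 h2 h3
        refine Fin.cases ?_ (fun k => ?_) i
        · intro h1 h2 h3
          exact ⟨by simpa using h3 0 le_rfl, Or.inr ⟨by simpa using h1, by simpa using h2⟩⟩
        · intro h1 h2 h3
          exact ⟨by simpa using h3 0 (Fin.zero_le _),
            Or.inl (Or.inr ⟨k, by simpa using h1, by simpa using h2, fun j hj => by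
              simpa using h3 j.succ (Fin.succ_le_succ_iff.mpr hj)⟩)⟩

/-- The set of vertices of a sequence: the union of its faces. -/
def vr (q : SetSeq Ur) : Set (Elem Ur) := {x | ∃ t, IsFace q t ∧ x ∈ t.1}

/-- Combinatorial equivalence of sequences: the smallest equivalence relation with the three
properties `drop`, `swap` and `cons`. -/
inductive CombEquiv : SetSeq Ur → SetSeq Ur → Prop
  | refl (q : SetSeq Ur) : CombEquiv q q
  | symm {q q' : SetSeq Ur} : CombEquiv q q' → CombEquiv q' q
  | trans {q q' q'' : SetSeq Ur} : CombEquiv q q' → CombEquiv q' q'' → CombEquiv q q''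
  | drop (t : FinPlus Ur) (q : SetSeq Ur) : ¬ IsFace q t → CombEquiv (t :: q) q
  | swap (s t : FinPlus Ur) (q : SetSeq Ur) : ofSet s ∉ t.1 → ofSet t ∉ s.1 →
      (¬ IsFace q (s.union t) ∨ Disjoint s.1 t.1) → CombEquiv (s :: t :: q) (t :: s :: q)
  | cons (s : FinPlus Ur) {q q' : SetSeq Ur} : CombEquiv q q' → CombEquiv (s :: q) (s :: q')

/-- `S` is an additive family of faces of `q`. -/
def IsAdditive (q : SetSeq Ur) (S : Set (FinPlus Ur)) : Prop :=
  (∀ s ∈ S, IsFace q s) ∧ ∀ s₁ ∈ S, ∀ s₂ ∈ S, IsFace q (s₁.union s₂) → s₁.union s₂ ∈ S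

/-- The list `E` is a non-decreasing enumeration of the family `S`. -/
def IsNonDecEnum (E : SetSeq Ur) (S : Set (FinPlus Ur)) : Prop :=
  E.Nodup ∧ (∀ s, s ∈ E ↔ s ∈ S) ∧ ∀ i j : Fin E.length, E[i].1 ⊆ E[j].1 → i ≤ j

/-- Every finite family has a non-decreasing enumeration. -/
theorem exists_isNonDecEnum (S : Finset (FinPlus Ur)) :
    ∃ E : SetSeq Ur, IsNonDecEnum E (S : Set (FinPlus Ur)) := by
  classical
  let r : FinPlus Ur → FinPlus Ur → Prop := fun a b => a.1.card ≤ b.1.card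
  have : Std.Total r := ⟨fun a b => le_total a.1.card b.1.card⟩
  have : IsTrans (FinPlus Ur) r := ⟨fun _ _ _ h h' => le_trans h h'⟩
  have hs : (S.toList.insertionSort r).Pairwise r := List.pairwise_insertionSort r _
  have hn : (S.toList.insertionSort r).Nodup :=
    (List.perm_insertionSort r _).nodup_iff.mpr S.nodup_toList
  refine ⟨S.toList.insertionSort r, hn, fun s => ?_, fun i j hij => ?_⟩
  · rw [(List.perm_insertionSort r S.toList).mem_iff]; simp
  · by_contra hlt
    have hlt : j < i := not_le.mp hlt
    have h1 : r _ _ := List.pairwise_iff_get.mp hs j i hlt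
    have h2 := Finset.eq_of_subset_of_card_le hij h1
    have h3 := hn.injective_get (a₁ := i) (a₂ := j) (Subtype.ext h2)
    exact absurd h3 (ne_of_gt hlt)

/-- A map from the sequence `dom` to the sequence `cod`. Only the values of `toFun` on `vr dom`
matter, and `dom` and `cod` matter only up to combinatorial equivalence; see `Same`. -/
structure SeqMap (Ur : Type u) where
  dom : SetSeq Ur
  cod : SetSeq Ur
  toFun : Elem Ur → Elem Ur

namespace SeqMap

/-- `f` and `g` are the same map: their domains and codomains are combinatorially equivalent and
they agree on the vertices of the domain. -/
def Same (f g : SeqMap Ur) : Prop :=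
  CombEquiv f.dom g.dom ∧ CombEquiv f.cod g.cod ∧ ∀ x ∈ vr f.dom, f.toFun x = g.toFun x

/-- The composition `f ∘ g`. -/
def comp (f g : SeqMap Ur) : SeqMap Ur := ⟨g.dom, f.cod, f.toFun ∘ g.toFun⟩

/-- `f⁻¹(s)`: the faces of the domain whose pointwise image is `s`. -/
def fiber (f : SeqMap Ur) (s : FinPlus Ur) : Set (FinPlus Ur) :=
  {t | IsFace f.dom t ∧ t.image f.toFun = s}

open Classical in
/-- The division `s f` of `f` based on `s`, where `E` is an enumeration of `f⁻¹(s)`: a map from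
`f⁻¹(s) dom` to `s cod` that sends each vertex `t ∈ f⁻¹(s)` to `s` and every other vertex `x`
to `f(x)`. -/
noncomputable def divide (f : SeqMap Ur) (s : FinPlus Ur) (E : SetSeq Ur) : SeqMap Ur :=
  ⟨E ++ f.dom, s :: f.cod, fun x => if ∃ t ∈ f.fiber s, x = ofSet t then ofSet s else f.toFun x⟩

/-- `u(f)`: the vertices of the codomain that are the image of exactly one vertex of the
domain. -/
def uniq (f : SeqMap Ur) : Set (Elem Ur) :=
  {v | v ∈ vr f.cod ∧ ∃! w, w ∈ vr f.dom ∧ f.toFun w = v}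

/-- `IsIterDivision f S g`: the map `g` is `s₀(s₁(⋯(sₗ f)))`, where `S = s₀ s₁ ⋯ sₗ`. -/
inductive IsIterDivision (f : SeqMap Ur) : SetSeq Ur → SeqMap Ur → Prop
  | nil : IsIterDivision f [] f
  | cons {S E : SetSeq Ur} {g : SeqMap Ur} (s : FinPlus Ur) : IsIterDivision f S g →
      IsNonDecEnum E (g.fiber s) → IsIterDivision f (s :: S) (g.divide s E)

end SeqMap

open SeqMap

open Classical in
/-- The map from `t q` to `q` given by the assignment `t → x`. For `x ∈ t` and `t` not a vertex
of `q` this is the weld map `π_{x,t}`. -/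
noncomputable def weldMap (q : SetSeq Ur) (x : Elem Ur) (t : FinPlus Ur) : SeqMap Ur :=
  ⟨t :: q, q, Function.update id (ofSet t) x⟩

open Classical in
/-- The map `π_{p,T}` from `T q` to `q` that sends each `t ∈ T` to `p` and fixes every other vertex,
where the list `T` enumerates the family. -/
noncomputable def weldFamily (q : SetSeq Ur) (p : Elem Ur) (T : SetSeq Ur) : SeqMap Ur :=
  ⟨T ++ q, q, fun x => if ∃ t ∈ T, x = ofSet t then p else x⟩

open Classical in
/-- The map from `(r ∪ {t}) (r ∪ s) t q` to `(s ∪ {t}) (r ∪ s) t q` given by the assignment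
`t → s ∪ {t}`, `r ∪ {t} → t`. -/
noncomputable def typeOneMap (q : SetSeq Ur) (r s : Finset (Elem Ur)) (t : FinPlus Ur)
    (h : (r ∪ s).Nonempty) : SeqMap Ur :=
  ⟨FinPlus.adjoin r t :: ⟨r ∪ s, h⟩ :: t :: q, FinPlus.adjoin s t :: ⟨r ∪ s, h⟩ :: t :: q,
    fun x => if x = ofSet t then ofSet (FinPlus.adjoin s t)
      else if x = ofSet (FinPlus.adjoin r t) then ofSet t else x⟩

open Classical in
/-- The map from `((s \ t) ∪ {t}) s t q` to `((t \ s) ∪ {s}) t s q` given by the assignment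
`(s \ t) ∪ {t} → (t \ s) ∪ {s}`. -/
noncomputable def typeTwoMap (q : SetSeq Ur) (s t : FinPlus Ur) : SeqMap Ur :=
  ⟨FinPlus.adjoin (s.1 \ t.1) t :: s :: t :: q, FinPlus.adjoin (t.1 \ s.1) s :: t :: s :: q,
    Function.update id (ofSet (FinPlus.adjoin (s.1 \ t.1) t))
      (ofSet (FinPlus.adjoin (t.1 \ s.1) s))⟩

open Classical in
/-- The map from `q` to `{x} q` given by the assignment `x → {x}`. -/
noncomputable def typeThreeMap (q : SetSeq Ur) (x : Elem Ur) : SeqMap Ur :=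
  ⟨q, FinPlus.sing x :: q, Function.update id x (ofSet (FinPlus.sing x))⟩

open Classical in
/-- Combinatorial isomorphisms: the smallest class of maps that contains the maps of types 1, 2,
3a, 3b and is closed under composition and division. -/
inductive IsCombIso : SeqMap Ur → Prop
  | type1 (q : SetSeq Ur) (r s : Finset (Elem Ur)) (t : FinPlus Ur) (h : (r ∪ s).Nonempty) :
      r ⊆ t.1 → s ⊆ t.1 → Disjoint r s → ofSet t ∉ tc (vr q) → IsCombIso (typeOneMap q r s t h)
  | type2 (q : SetSeq Ur) (s t : FinPlus Ur) : ofSet s ∉ t.1 → ofSet t ∉ s.1 →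
      ofSet s ∉ tc (vr q) → ofSet t ∉ tc (vr q) → IsCombIso (typeTwoMap q s t)
  | type3a (q : SetSeq Ur) (x : Elem Ur) : ofSet (FinPlus.sing x) ∉ vr q →
      IsCombIso (typeThreeMap q x)
  | type3b (q : SetSeq Ur) (x : Elem Ur) : ofSet (FinPlus.sing x) ∉ vr q →
      IsCombIso (weldMap q x (FinPlus.sing x))
  | comp {f g : SeqMap Ur} : IsCombIso f → IsCombIso g → CombEquiv g.cod f.dom →
      IsCombIso (f.comp g)
  | division {f : SeqMap Ur} (s : FinPlus Ur) {E : SetSeq Ur} : IsCombIso f →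
      IsNonDecEnum E (f.fiber s) → IsCombIso (f.divide s E)
  | same {f g : SeqMap Ur} : IsCombIso f → Same f g → IsCombIso g

/-- Pure weld-division maps: the smallest class of maps that contains all weld maps and all
combinatorial isomorphisms and is closed under composition and pure division, that is, division
of `f` based on a set `s ⊆ u(f)`. -/
inductive IsPureWeldDivision : SeqMap Ur → Prop
  | weld (q : SetSeq Ur) (x : Elem Ur) (t : FinPlus Ur) : x ∈ t.1 → ofSet t ∉ vr q →
      IsPureWeldDivision (weldMap q x t)
  | combIso {f : SeqMap Ur} : IsCombIso f → IsPureWeldDivision f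
  | comp {f g : SeqMap Ur} : IsPureWeldDivision f → IsPureWeldDivision g →
      CombEquiv g.cod f.dom → IsPureWeldDivision (f.comp g)
  | pureDivision {f : SeqMap Ur} (s : FinPlus Ur) {E : SetSeq Ur} : IsPureWeldDivision f →
      (∀ x ∈ s.1, x ∈ f.uniq) → IsNonDecEnum E (f.fiber s) → IsPureWeldDivision (f.divide s E)
  | same {f g : SeqMap Ur} : IsPureWeldDivision f → Same f g → IsPureWeldDivision g

end WeldCalculus

open WeldCalculus

namespace WeldCalculus

section

open Elem SeqMap
open scoped Classical

/-! Write `π` for the weld map of `T` onto `p`. Dividing `π` by a set `s` that contains `p` is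
usually not pure, since every `t ∈ T` is a further preimage of `p`. The remedy is to move the weld
to the other side of the division. For `s ≠ {p}` let `T'` be `T` with each `t ⊇ s` replaced by `(t \
s) ∪ {p, s}`. There is a pure weld-division map `h` from `π⁻¹(s) T q` to `T' s q` that sends the
whole fiber to the vertex `s` and each `t` to its replacement, and the division of `π` by `s` is the
weld of `T'` onto `p` composed with `h` (`pw_column`).

The map `h` has two stages. All members of the fiber include `B = s \ {p}`, and the fiber is closed
under those unions that are faces; it can therefore be collapsed onto its members of the form `B ∪
{d}`, where `d` is `p` or a vertex `t ∈ T` (`pw_star`). Then `s` is carried across the members of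
`T` one by one (`pw_columns`). Crossing `t` uses up `B ∪ {t}`: a type 2 isomorphism does this if `s
∩ t = {p}`, type 1 is needed if `s ⊆ t`, and the auxiliary vertex that may be left over is welded to
`s`.

For a whole family the argument is an induction on its size (`exists_good_of_colHyp`). A set `s` of
largest cardinality is divided first. The other divisions are known over `s q` with `T'` in place of
`T`, and they pull back along `h` as pure divisions, because the only vertex with several preimages
that `h` can create is `s`, which no relevant face contains (`PW.transfer`). The hypothesis of the
induction has to survive this step. Initially, `s ∪ t ∈ T` forces `s ⊆ t` whenever `s ∪ t` is still
a face at the moment when `t` is divided (`tri_of_union_mem`); later the alternative `s ∩ t = {p}`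
appears as well, so `ColHyp` allows both (`ColHyp.divide`).

Members of `S` without `p` have vertices with unique preimages and cause no difficulty
(`Good.union_left`). The set `{p}`, in `S` or in `T`, only renames or welds vertices
(`Good.insert_sing`, `Good.cons_sing`). Two facts are used throughout: pure weld-division maps send
faces to faces (`IsPureWeldDivision.isSimplicial`), and the order in which an additive family is
divided is immaterial (`CombEquiv.of_mem_iff`). -/

/-! ### Faces, vertices and their transitive closure. -/

open Classical in
/-- The empty set or a face of `q`. -/
def Fa (q : SetSeq Ur) (A : Finset (Elem Ur)) : Prop := ∀ h : A.Nonempty, IsFace q ⟨A, h⟩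

theorem isFace_iff_fa {q : SetSeq Ur} {t : FinPlus Ur} : IsFace q t ↔ Fa q t.1 :=
  ⟨fun h _ => h, fun h => h t.2⟩

theorem IsFace.fa {q : SetSeq Ur} {t : FinPlus Ur} (h : IsFace q t) : Fa q t.1 := fun _ => h

theorem Fa.isFace {q : SetSeq Ur} {t : FinPlus Ur} (h : Fa q t.1) : IsFace q t := h t.2

theorem fa_empty (q : SetSeq Ur) : Fa q ∅ := fun h => absurd h (by simp)

/-- If the larger set is a face through the vertex `a` and the smaller set does not contain `a`,
then the smaller set lies inside the unfolded face, so the first alternative of the recursion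
applies. -/
theorem IsFace.mono {q : SetSeq Ur} : ∀ {s t : FinPlus Ur}, IsFace q t → s.1 ⊆ t.1 → IsFace q s := by
  classical
  induction q with
  | nil => intro s t h hst x hx; exact h x (hst hx)
  | cons a q ih =>
    intro s t h hst
    refine ⟨fun h' => h.1 ⟨h'.1, h'.2.trans hst⟩, ?_⟩
    rcases h.2 with h2 | ⟨h2, h3⟩
    · exact Or.inl (ih h2 hst)
    · by_cases ha : ofSet a ∈ s.1
      · refine Or.inr ⟨ha, ih h3 ?_⟩
        exact Finset.union_subset_union (Finset.erase_subset_erase _ hst) subset_rfl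
      · refine Or.inl (ih h3 ?_)
        intro x hx
        refine Finset.mem_union_left _ (Finset.mem_erase.mpr ⟨?_, hst hx⟩)
        rintro rfl
        exact ha hx

theorem Fa.mono {q : SetSeq Ur} {A B : Finset (Elem Ur)} (h : Fa q B) (hAB : A ⊆ B) : Fa q A :=
  fun hA => (h (hA.mono hAB)).mono hAB

theorem mem_vr_iff {q : SetSeq Ur} {x : Elem Ur} : x ∈ vr q ↔ Fa q {x} := by
  constructor
  · rintro ⟨t, ht, hx⟩
    exact ht.fa.mono (by simpa using hx)
  · intro h
    exact ⟨FinPlus.sing x, h _, by simp [FinPlus.sing]⟩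

theorem Fa.mem_vr {q : SetSeq Ur} {A : Finset (Elem Ur)} (h : Fa q A) {x : Elem Ur} (hx : x ∈ A) :
    x ∈ vr q := mem_vr_iff.mpr (h.mono (by simpa using hx))

theorem IsFace.mem_vr {q : SetSeq Ur} {t : FinPlus Ur} (h : IsFace q t) {x : Elem Ur}
    (hx : x ∈ t.1) : x ∈ vr q := h.fa.mem_vr hx

theorem subset_unfold (t s : FinPlus Ur) : s.1 ⊆ (t.unfold s).1 := by
  classical
  exact Finset.subset_union_right

/-- The unfolded set always includes `a`, so a face through the new vertex would make `a` a face. -/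
theorem isFace_cons_of_not {q : SetSeq Ur} {a : FinPlus Ur} (ha : ¬ IsFace q a) {t : FinPlus Ur} :
    IsFace (a :: q) t ↔ IsFace q t := by
  constructor
  · rintro ⟨-, h | ⟨-, h⟩⟩
    · exact h
    · exact absurd (h.mono (subset_unfold t a)) ha
  · intro h
    exact ⟨fun h' => ha h'.1, Or.inl h⟩

theorem fa_cons_of_not {q : SetSeq Ur} {a : FinPlus Ur} (ha : ¬ IsFace q a)
    {A : Finset (Elem Ur)} : Fa (a :: q) A ↔ Fa q A :=
  forall_congr' fun _ => isFace_cons_of_not ha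

theorem mem_vr_cons {q : SetSeq Ur} {a : FinPlus Ur} {x : Elem Ur} (h : x ∈ vr (a :: q)) :
    x ∈ vr q ∨ (x = ofSet a ∧ IsFace q a) := by
  classical
  obtain ⟨t, ⟨-, h | ⟨h1, h2⟩⟩, hx⟩ := h
  · exact Or.inl ⟨t, h, hx⟩
  · by_cases hxa : x = ofSet a
    · exact Or.inr ⟨hxa, h2.mono (subset_unfold t a)⟩
    · refine Or.inl ⟨_, h2, ?_⟩
      exact Finset.mem_union_left _ (Finset.mem_erase.mpr ⟨hxa, hx⟩)

theorem isMem_ofSet {x : Elem Ur} {F : FinPlus Ur} : IsMem x (ofSet F) ↔ x ∈ F.1 := by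
  constructor
  · rintro ⟨G, h, hx⟩
    rw [ofSet_injective h]; exact hx
  · intro h; exact ⟨F, rfl, h⟩

theorem not_isMem_ofUr {x : Elem Ur} {a : Ur} : ¬ IsMem x (ofUr a) := by
  rintro ⟨G, h, -⟩
  exact ofUr_ne_ofSet a G h

theorem subset_tc (V : Set (Elem Ur)) : V ⊆ tc V := fun x hx => ⟨x, hx, Relation.ReflTransGen.refl⟩

theorem tc_of_isMem {V : Set (Elem Ur)} {x y : Elem Ur} (hy : y ∈ tc V) (h : IsMem x y) :
    x ∈ tc V := by
  obtain ⟨v, hv, hr⟩ := hy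
  exact ⟨v, hv, Relation.ReflTransGen.head h hr⟩

theorem mem_tc_cons {q : SetSeq Ur} {a : FinPlus Ur} {x : Elem Ur} (h : x ∈ tc (vr (a :: q))) :
    x ∈ tc (vr q) ∨ (x = ofSet a ∧ IsFace q a) := by
  obtain ⟨v, hv, hr⟩ := h
  rcases mem_vr_cons hv with hv | ⟨rfl, ha⟩
  · exact Or.inl ⟨v, hv, hr⟩
  · rcases Relation.ReflTransGen.cases_tail hr with h | ⟨y, hxy, hy⟩
    · exact Or.inr ⟨h.symm, ha⟩
    · exact Or.inl ⟨y, ha.mem_vr (isMem_ofSet.mp hy), hxy⟩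

/-- A division enlarges the transitive closure by at most the dividing set, which is not a face
afterwards. This supplies the freshness conditions of the isomorphisms of types 1 and 2 whenever
their sets are faces. -/
theorem IsFace.notMem_tc {q : SetSeq Ur} : ∀ {t : FinPlus Ur}, IsFace q t → ofSet t ∉ tc (vr q) := by
  induction q with
  | nil =>
    rintro t - ⟨v, ⟨t', ht', hv⟩, hr⟩
    obtain ⟨a, rfl⟩ := ht' v hv
    rcases Relation.ReflTransGen.cases_tail hr with h | ⟨y, -, hy⟩
    · exact ofUr_ne_ofSet a t h
    · exact not_isMem_ofUr hy
  | cons a q ih =>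
    intro t ht htc
    rcases mem_tc_cons htc with h | ⟨h, ha⟩
    · rcases ht.2 with h2 | ⟨h1, h2⟩
      · exact ih h2 h
      · exact ih (h2.mono (subset_unfold t a)) (tc_of_isMem h (isMem_ofSet.mpr h1))
    · rw [ofSet_injective h] at ht
      exact ht.1 ⟨ha, subset_rfl⟩

theorem IsFace.notMem_vr {q : SetSeq Ur} {t : FinPlus Ur} (h : IsFace q t) : ofSet t ∉ vr q :=
  fun h' => h.notMem_tc (subset_tc _ h')

theorem IsFace.notMem {q : SetSeq Ur} {s t : FinPlus Ur} (hs : IsFace q s) (ht : IsFace q t) :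
    ofSet s ∉ t.1 := fun h => hs.notMem_vr (ht.mem_vr h)

theorem notMem_self (t : FinPlus Ur) : ofSet t ∉ t.1 := by
  suffices H : ∀ x : Elem Ur, ¬ IsMem x x from fun h => H _ (isMem_ofSet.mpr h)
  have key : ∀ x : Elem Ur, Acc IsMem x := by
    intro x
    induction x using Elem.induction with
    | hUr a => exact ⟨_, fun y hy => absurd hy not_isMem_ofUr⟩
    | hSet F ih => exact ⟨_, fun y hy => ih y (isMem_ofSet.mp hy)⟩
  intro x hx
  have := (key x)
  induction this with
  | intro y _ ih => exact ih y hx hx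

open Classical in
/-- The face recursion for a fresh set. -/
theorem fa_cons {q : SetSeq Ur} {a : FinPlus Ur} (ha : ofSet a ∉ vr q) {A : Finset (Elem Ur)} :
    Fa (a :: q) A ↔ ¬ a.1 ⊆ A ∧
      ((ofSet a ∉ A ∧ Fa q A) ∨ (ofSet a ∈ A ∧ Fa q (A.erase (ofSet a) ∪ a.1))) := by
  rcases A.eq_empty_or_nonempty with rfl | hA
  · simp [fa_empty, Finset.subset_empty, a.2.ne_empty]
  constructor
  · intro h
    obtain ⟨h1, h2⟩ := h hA
    rcases h2 with h2 | ⟨h2, h3⟩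
    · refine ⟨fun hs => h1 ⟨h2.mono hs, hs⟩, Or.inl ⟨fun h3 => ha (h2.mem_vr h3), h2.fa⟩⟩
    · refine ⟨fun hs => h1 ⟨h3.mono (subset_unfold _ _), hs⟩, Or.inr ⟨h2, h3.fa⟩⟩
  · rintro ⟨h1, h2⟩ hA
    refine ⟨fun h => h1 h.2, ?_⟩
    rcases h2 with ⟨-, h2⟩ | ⟨h2, h3⟩
    · exact Or.inl (h2 hA)
    · exact Or.inr ⟨h2, h3 _⟩

/-- A set that does not contain the dividing sets is a face iff it was one and includes none of
them. -/
theorem fa_append {q : SetSeq Ur} {A : Finset (Elem Ur)} (R : SetSeq Ur)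
    (h : ∀ r ∈ R, ofSet r ∉ A) : Fa (R ++ q) A ↔ Fa q A ∧ ∀ r ∈ R, ¬ r.1 ⊆ A := by
  induction R with
  | nil => simp
  | cons a R ih =>
    have ih := ih fun r hr => h r (List.mem_cons_of_mem _ hr)
    have ha : ofSet a ∉ A := h a List.mem_cons_self
    simp only [List.cons_append, List.forall_mem_cons]
    constructor
    · intro hA
      rcases A.eq_empty_or_nonempty with rfl | hne
      · exact ⟨fa_empty q, by simp [Finset.subset_empty, a.2.ne_empty],
          fun r _ => by simp [Finset.subset_empty, r.2.ne_empty]⟩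
      obtain ⟨h1, h2 | ⟨h2, -⟩⟩ := hA hne
      · obtain ⟨h3, h4⟩ := ih.mp h2.fa
        exact ⟨h3, fun hs => h1 ⟨h2.mono hs, hs⟩, h4⟩
      · exact absurd h2 ha
    · rintro ⟨h1, h2, h3⟩ hne
      exact ⟨fun h' => h2 h'.2, Or.inl ((ih.mpr ⟨h1, h3⟩) hne)⟩

/-- Either alternative of the recursion would make `a` a face of `q`, and then the first clause
excludes every set that includes `a`. So no assumption on `a` is needed. -/
theorem not_fa_cons_of_subset {q : SetSeq Ur} {a : FinPlus Ur} {A : Finset (Elem Ur)}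
    (h : a.1 ⊆ A) : ¬ Fa (a :: q) A := by
  classical
  intro hA
  obtain ⟨h1, h2⟩ := hA (a.2.mono h)
  rcases h2 with h2 | ⟨-, h2⟩
  · exact h1 ⟨h2.mono h, h⟩
  · exact h1 ⟨h2.mono (subset_unfold _ _), h⟩

/-! ### Combinatorial equivalence preserves faces. -/

theorem isFace_cons_congr {q q' : SetSeq Ur} (h : ∀ t, IsFace q t ↔ IsFace q' t) (a t : FinPlus Ur) :
    IsFace (a :: q) t ↔ IsFace (a :: q') t := by
  simp only [IsFace, h]

/-- Only the interchange of `s` and `t` has content. If one of them is not a face it drops out on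
both sides; otherwise both are fresh, and unfolding in either order gives the same set. -/
theorem CombEquiv.isFace_iff {q q' : SetSeq Ur} (h : CombEquiv q q') :
    ∀ t, IsFace q t ↔ IsFace q' t := by
  classical
  induction h with
  | refl q => exact fun _ => Iff.rfl
  | symm _ ih => exact fun t => (ih t).symm
  | trans _ _ ih1 ih2 => exact fun t => (ih1 t).trans (ih2 t)
  | drop t q h => exact fun z => isFace_cons_of_not h
  | cons s _ ih => exact fun t => isFace_cons_congr ih s t
  | swap s t q hst hts hd =>
    intro z
    by_cases hs : IsFace q s
    swap
    · have : ¬ IsFace (t :: q) s := by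
        rintro ⟨-, h | ⟨h, -⟩⟩
        · exact hs h
        · exact hts h
      rw [isFace_cons_of_not this]
      exact isFace_cons_congr (fun _ => (isFace_cons_of_not hs).symm) t z
    by_cases ht : IsFace q t
    swap
    · have : ¬ IsFace (s :: q) t := by
        rintro ⟨-, h | ⟨h, -⟩⟩
        · exact ht h
        · exact hst h
      rw [isFace_cons_of_not this]
      exact isFace_cons_congr (fun _ => isFace_cons_of_not ht) s z
    by_cases hne : s = t
    · rw [hne]
    have hs' : ofSet s ∉ vr (t :: q) := fun h => by
      rcases mem_vr_cons h with h | ⟨h, -⟩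
      · exact hs.notMem_vr h
      · exact hne (ofSet_injective h)
    have ht' : ofSet t ∉ vr (s :: q) := fun h => by
      rcases mem_vr_cons h with h | ⟨h, -⟩
      · exact ht.notMem_vr h
      · exact hne (ofSet_injective h).symm
    have hne' : ofSet s ≠ ofSet t := fun h => hne (ofSet_injective h)
    have key : ∀ (s t : FinPlus Ur), ofSet s ∉ t.1 → ofSet t ∉ s.1 →
        (¬ IsFace q (s.union t) ∨ Disjoint s.1 t.1) → ofSet s ∉ vr q → ofSet t ∉ vr q →
        ofSet s ∉ vr (t :: q) → ofSet t ∉ vr (s :: q) → ofSet s ≠ ofSet t →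
        ∀ A, Fa (s :: t :: q) A → Fa (t :: s :: q) A := by
      intro s t hst hts hd hs ht hs' ht' hne A
      -- A face that includes both sets makes their union a face, so only the disjoint case is left;
      -- then unfolding one set adds no element of the other.
      have hd' : ∀ C, Fa q C → s.1 ⊆ C → t.1 ⊆ C → Disjoint s.1 t.1 := by
        intro C hC h1 h2
        rcases hd with hd | hd
        · exact absurd (hC.mono (Finset.union_subset h1 h2)) fun h => hd h.isFace
        · exact hd
      rw [fa_cons hs', fa_cons ht, fa_cons ht, fa_cons ht', fa_cons hs, fa_cons hs]
      rintro ⟨h1, ⟨h2, h3, ⟨h4, h5⟩ | ⟨h4, h5⟩⟩ | ⟨h2, h3, ⟨h4, h5⟩ | ⟨h4, h5⟩⟩⟩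
      · exact ⟨h3, Or.inl ⟨h4, h1, Or.inl ⟨h2, h5⟩⟩⟩
      · refine ⟨h3, Or.inr ⟨h4, fun hs1 => ?_, Or.inl ⟨by simp [h2, hst], h5⟩⟩⟩
        have := hd' _ h5 hs1 Finset.subset_union_right
        apply h1
        intro x hx
        have hx2 := Finset.mem_union.mp (hs1 hx)
        rcases hx2 with hx2 | hx2
        · exact Finset.mem_of_mem_erase hx2
        · exact absurd hx2 (Finset.disjoint_left.mp this hx)
      · have h4' : ofSet t ∉ A := fun h => h4 (by simp [h, hne.symm])
        refine ⟨fun h => h3 fun x hx => ?_, Or.inl ⟨h4', h1, Or.inr ⟨h2, h5⟩⟩⟩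
        refine Finset.mem_union_left _ (Finset.mem_erase.mpr ⟨?_, h hx⟩)
        rintro rfl
        exact hst hx
      · have h4' : ofSet t ∈ A := by
          simpa [hne.symm, hts] using h4
        have e : (A.erase (ofSet t) ∪ t.1).erase (ofSet s) ∪ s.1
            = (A.erase (ofSet s) ∪ s.1).erase (ofSet t) ∪ t.1 := by
          ext x
          simp only [Finset.mem_union, Finset.mem_erase]
          by_cases h1 : x = ofSet s
          · subst h1; simp [hst, hne, notMem_self]
          · by_cases h2 : x = ofSet t
            · subst h2; simp [hts, notMem_self]
            · simp [h1, h2]; tauto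
        have hdj := hd' _ h5 (by
          intro x hx
          rw [← e]; exact Finset.mem_union_right _ hx) Finset.subset_union_right
        refine ⟨fun h => h3 ?_, Or.inr ⟨h4', fun h => h1 ?_, Or.inr ⟨by simp [h2, hne], e ▸ h5⟩⟩⟩
        · intro x hx
          have : x ≠ ofSet s := by rintro rfl; exact hst hx
          simp [this, h hx]
        · intro x hx
          have hx2 := Finset.mem_union.mp (h hx)
          rcases hx2 with hx2 | hx2
          · exact Finset.mem_of_mem_erase hx2
          · exact absurd hx2 (Finset.disjoint_left.mp hdj hx)
    rw [isFace_iff_fa, isFace_iff_fa]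
    refine ⟨key s t hst hts hd hs.notMem_vr ht.notMem_vr hs' ht' hne' _,
      key t s hts hst ?_ ht.notMem_vr hs.notMem_vr ht' hs' hne'.symm _⟩
    rcases hd with hd | hd
    · left
      have : t.union s = s.union t := Subtype.ext (Finset.union_comm _ _)
      rwa [this]
    · exact Or.inr hd.symm

theorem CombEquiv.fa_iff {q q' : SetSeq Ur} (h : CombEquiv q q') (A : Finset (Elem Ur)) :
    Fa q A ↔ Fa q' A := forall_congr' fun _ => h.isFace_iff _

theorem CombEquiv.vr_eq {q q' : SetSeq Ur} (h : CombEquiv q q') : vr q = vr q' := by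
  ext x
  rw [mem_vr_iff, mem_vr_iff, h.fa_iff]

theorem CombEquiv.append_left (L : SetSeq Ur) {q q' : SetSeq Ur} (h : CombEquiv q q') :
    CombEquiv (L ++ q) (L ++ q') := by
  induction L with
  | nil => exact h
  | cons a L ih => exact CombEquiv.cons a ih

theorem fa_cons_intro {q : SetSeq Ur} {a : FinPlus Ur} {A : Finset (Elem Ur)} (h1 : ¬ a.1 ⊆ A)
    (h2 : Fa q A ∨ (ofSet a ∈ A ∧ Fa q (A.erase (ofSet a) ∪ a.1))) : Fa (a :: q) A := by
  intro hA
  refine ⟨fun h => h1 h.2, ?_⟩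
  rcases h2 with h2 | ⟨h2, h3⟩
  · exact Or.inl (h2 hA)
  · exact Or.inr ⟨h2, h3 _⟩

/-! ### Pure weld-division maps are simplicial. -/

/-- Faces are mapped to faces. -/
def IsSimplicial (f : SeqMap Ur) : Prop := ∀ A, Fa f.dom A → Fa f.cod (A.image f.toFun)

theorem image_congr_vr {q : SetSeq Ur} {A : Finset (Elem Ur)} (hA : Fa q A) {f g : Elem Ur → Elem Ur}
    (h : ∀ x ∈ vr q, f x = g x) : A.image f = A.image g :=
  Finset.image_congr fun _ hx => h _ (hA.mem_vr hx)

theorem IsSimplicial.same {f g : SeqMap Ur} (hf : IsSimplicial f) (h : Same f g) :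
    IsSimplicial g := by
  intro A hA
  rw [← h.1.fa_iff] at hA
  rw [← h.2.1.fa_iff, ← image_congr_vr hA h.2.2]
  exact hf A hA

theorem IsSimplicial.comp {f g : SeqMap Ur} (hf : IsSimplicial f) (hg : IsSimplicial g)
    (h : CombEquiv g.cod f.dom) : IsSimplicial (f.comp g) := by
  intro A hA
  have := hf _ ((h.fa_iff _).mp (hg A hA))
  rwa [Finset.image_image] at this

/-- Replacing each dividing set in a face by its elements yields a face of the original sequence.
The dividing sets are faces of `d`, hence do not contain one another, and one replacement does not
disturb the others. -/
theorem exists_unwind {d : SetSeq Ur} {E : SetSeq Ur} (hE : ∀ t ∈ E, IsFace d t) :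
    ∀ {A : Finset (Elem Ur)}, Fa (E ++ d) A → ∃ B, Fa d B ∧
      (∀ x ∈ A, (∀ t ∈ E, x ≠ ofSet t) → x ∈ B) ∧ ∀ t ∈ E, ofSet t ∈ A → t.1 ⊆ B := by
  induction E with
  | nil => exact fun {A} h => ⟨A, h, fun x hx _ => hx, by simp⟩
  | cons a E ih =>
    intro A hA
    have ih := @ih fun t ht => hE t (List.mem_cons_of_mem _ ht)
    have ha := hE a List.mem_cons_self
    rcases A.eq_empty_or_nonempty with rfl | hne
    · exact ⟨∅, fa_empty _, by simp, by simp⟩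
    obtain ⟨-, h | ⟨h1, h2⟩⟩ := hA hne
    · obtain ⟨B, hB, hB1, hB2⟩ := ih h.fa
      refine ⟨B, hB, fun x hx hxE => hB1 x hx fun t ht => hxE t (List.mem_cons_of_mem _ ht), ?_⟩
      intro t ht htA
      by_cases htE : t ∈ E
      · exact hB2 t htE htA
      · have : ofSet t ∈ B := hB1 _ htA fun t' ht' h => htE (ofSet_injective h ▸ ht')
        exact absurd (hB.mem_vr this) (hE t ht).notMem_vr
    · obtain ⟨B, hB, hB1, hB2⟩ := ih h2.fa
      have haB : a.1 ⊆ B := fun x hx => hB1 x (Finset.mem_union_right _ hx) fun t ht h =>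
        (hE t (List.mem_cons_of_mem _ ht)).notMem ha (h ▸ hx)
      refine ⟨B, hB, fun x hx hxE => hB1 x ?_ fun t ht => hxE t (List.mem_cons_of_mem _ ht), ?_⟩
      · exact Finset.mem_union_left _ (Finset.mem_erase.mpr ⟨hxE a List.mem_cons_self, hx⟩)
      · intro t ht htA
        by_cases hta : t = a
        · exact hta ▸ haB
        · refine hB2 t ((List.mem_cons.mp ht).resolve_left hta) ?_
          exact Finset.mem_union_left _ (Finset.mem_erase.mpr
            ⟨fun h => hta (ofSet_injective h), htA⟩)

/-- After unwinding, the image lies in a face of the old codomain together with `s`. What remains to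
be excluded is that the image of a face includes `s`. -/
theorem IsSimplicial.divide {f : SeqMap Ur} (hf : IsSimplicial f) (s : FinPlus Ur) {E : SetSeq Ur}
    (hE : ∀ t, t ∈ E ↔ t ∈ f.fiber s) : IsSimplicial (f.divide s E) := by
  intro A hA
  obtain ⟨B, hB, hB1, hB2⟩ := exists_unwind (fun t ht => ((hE t).mp ht).1) hA
  have hfr : ∀ t ∈ E, ofSet t ∉ vr f.dom := fun t ht => ((hE t).mp ht).1.notMem_vr
  have hfB := hf B hB
  have hs : ∀ x ∈ s.1, x ≠ ofSet s := fun x hx h => notMem_self s (h ▸ hx)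
  have hval : ∀ x, (∀ t ∈ E, x ≠ ofSet t) → (f.divide s E).toFun x = f.toFun x := fun x hx =>
    if_neg fun ⟨t, ht, h⟩ => hx t ((hE t).mpr ht) h
  have hval' : ∀ t ∈ E, (f.divide s E).toFun (ofSet t) = ofSet s := fun t ht =>
    if_pos ⟨t, (hE t).mp ht, rfl⟩
  have hsub : ∀ x ∈ A, (f.divide s E).toFun x ∈ B.image f.toFun ∨
      (f.divide s E).toFun x = ofSet s := by
    intro x hx
    by_cases h : ∀ t ∈ E, x ≠ ofSet t
    · rw [hval x h]
      exact Or.inl (Finset.mem_image_of_mem _ (hB1 x hx h))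
    · push Not at h
      obtain ⟨t, ht, rfl⟩ := h
      exact Or.inr (hval' t ht)
  have hno : ¬ s.1 ⊆ A.image (f.divide s E).toFun := by
    intro hsA
    have hlift : ∀ x ∈ s.1, ∃ y ∈ A, (∀ t ∈ E, y ≠ ofSet t) ∧ f.toFun y = x := by
      intro x hx
      obtain ⟨y, hy, hyx⟩ := Finset.mem_image.mp (hsA hx)
      have h : ∀ t ∈ E, y ≠ ofSet t := by
        rintro t ht rfl
        rw [hval' t ht] at hyx
        exact hs x hx hyx.symm
      exact ⟨y, hy, h, by rw [← hval y h, hyx]⟩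
    -- If the image includes `s`, the old vertices of `A` lying over `s` form a member of the fiber.
    -- This member has been divided, yet it is included in the face `A`, a contradiction.
    set C := A.filter fun y => (∀ t ∈ E, y ≠ ofSet t) ∧ f.toFun y ∈ s.1 with hC
    have hCB : Fa f.dom C := hB.mono fun y hy => by
      rw [hC, Finset.mem_filter] at hy
      exact hB1 y hy.1 hy.2.1
    have himg : C.image f.toFun = s.1 := by
      ext x
      rw [Finset.mem_image]
      constructor
      · rintro ⟨y, hy, rfl⟩
        exact (Finset.mem_filter.mp hy).2.2
      · intro hx
        obtain ⟨y, h1, h2, rfl⟩ := hlift x hx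
        exact ⟨y, Finset.mem_filter.mpr ⟨h1, h2, hx⟩, rfl⟩
    have hne : C.Nonempty := by
      rw [← Finset.image_nonempty (f := f.toFun), himg]; exact s.2
    have hCE : (⟨C, hne⟩ : FinPlus Ur) ∈ E := (hE _).mpr ⟨hCB hne, Subtype.ext himg⟩
    have hCA : Fa (E ++ f.dom) C := Fa.mono hA (Finset.filter_subset _ _)
    exact ((fa_append E fun r hr h => ((Finset.mem_filter.mp h).2.1 r hr rfl)).mp hCA).2 _ hCE
      subset_rfl
  refine fa_cons_intro hno ?_
  by_cases h : ∃ t ∈ E, ofSet t ∈ A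
  · obtain ⟨t, ht, htA⟩ := h
    refine Or.inr ⟨?_, hfB.mono ?_⟩
    · exact Finset.mem_image.mpr ⟨_, htA, hval' t ht⟩
    · refine Finset.union_subset (fun x hx => ?_) ?_
      · obtain ⟨hx1, hx2⟩ := Finset.mem_erase.mp hx
        obtain ⟨y, hy, rfl⟩ := Finset.mem_image.mp hx2
        exact (hsub y hy).resolve_right hx1
      · have := ((hE t).mp ht).2
        rw [← this]
        exact Finset.image_subset_image (hB2 t ht htA)
  · refine Or.inl (hfB.mono fun x hx => ?_)
    obtain ⟨y, hy, rfl⟩ := Finset.mem_image.mp hx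
    push Not at h
    have h' : ∀ t ∈ E, y ≠ ofSet t := by rintro t ht rfl; exact h t ht hy
    rw [hval y h']
    exact Finset.mem_image_of_mem _ (hB1 y hy h')

theorem isSimplicial_weldMap {q : SetSeq Ur} {x : Elem Ur} {t : FinPlus Ur} (hx : x ∈ t.1)
    (ht : ofSet t ∉ vr q) : IsSimplicial (weldMap q x t) := by
  intro A hA
  obtain ⟨-, ⟨h1, h2⟩ | ⟨-, h2⟩⟩ := (fa_cons ht).mp hA
  · refine h2.mono fun y hy => ?_
    obtain ⟨z, hz, rfl⟩ := Finset.mem_image.mp hy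
    have : z ≠ ofSet t := by rintro rfl; exact h1 hz
    simpa [weldMap, Function.update_of_ne this] using hz
  · refine h2.mono fun y hy => ?_
    obtain ⟨z, hz, rfl⟩ := Finset.mem_image.mp hy
    by_cases hzt : z = ofSet t
    · subst hzt
      simp [weldMap, hx]
    · simp [weldMap, hzt, hz]

theorem isSimplicial_typeThreeMap {q : SetSeq Ur} {x : Elem Ur} :
    IsSimplicial (typeThreeMap q x) := by
  intro A hA
  have hx : x ≠ ofSet (FinPlus.sing x) := fun h => notMem_self (FinPlus.sing x) (by
    simpa [FinPlus.sing] using h.symm)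
  have hA : Fa q A := hA
  refine fa_cons_intro ?_ ?_
  · intro h
    have h : x ∈ A.image _ := h (by simp [FinPlus.sing])
    obtain ⟨y, -, hy⟩ := Finset.mem_image.mp h
    by_cases hyx : y = x
    · subst hyx
      simp only [typeThreeMap, Function.update_self] at hy
      exact hx hy.symm
    · simp only [typeThreeMap, Function.update_of_ne hyx, id] at hy
      exact hyx hy
  · by_cases hxA : x ∈ A
    · refine Or.inr ⟨Finset.mem_image.mpr ⟨x, hxA, by simp [typeThreeMap]⟩, ?_⟩
      refine Fa.mono hA (Finset.union_subset (fun y hy => ?_) (by simpa [FinPlus.sing] using hxA))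
      obtain ⟨hy1, hy2⟩ := Finset.mem_erase.mp hy
      obtain ⟨z, hz, rfl⟩ := Finset.mem_image.mp hy2
      by_cases hzx : z = x
      · subst hzx
        simp [typeThreeMap] at hy1
      · simpa [typeThreeMap, Function.update_of_ne hzx] using hz
    · refine Or.inl (Fa.mono hA fun y hy => ?_)
      obtain ⟨z, hz, rfl⟩ := Finset.mem_image.mp hy
      have : z ≠ x := by rintro rfl; exact hxA hz
      simpa [typeThreeMap, Function.update_of_ne this] using hz

theorem adjoin_val (r : Finset (Elem Ur)) (t : FinPlus Ur) :
    (FinPlus.adjoin r t).1 = insert (ofSet t) r := rfl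

theorem ofSet_ne_of_mem {s t : FinPlus Ur} (h : ofSet s ∈ t.1) : ofSet s ≠ ofSet t := fun h' =>
  notMem_self t (h' ▸ h)

theorem ofSet_mem_ne {s t : FinPlus Ur} (h : ofSet s ∉ t.1) : ∀ x ∈ t.1, x ≠ ofSet s :=
  fun _ hx h' => h (h' ▸ hx)

theorem notMem_vr_cons {q : SetSeq Ur} {a : FinPlus Ur} {x : Elem Ur} (h : x ∉ vr q)
    (h' : x ≠ ofSet a) : x ∉ vr (a :: q) := fun hx => by
  rcases mem_vr_cons hx with hx | ⟨hx, -⟩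
  · exact h hx
  · exact h' hx

theorem notMem_vr_of_mem {q : SetSeq Ur} {t : FinPlus Ur} {x : Elem Ur} (hx : x ∈ t.1)
    (h : x ∉ tc (vr q)) : ofSet t ∉ vr q := fun ht =>
  h (tc_of_isMem (subset_tc _ ht) (isMem_ofSet.mpr hx))

theorem CombEquiv.isSimplicial {q q' : SetSeq Ur} (h : CombEquiv q q') {f : Elem Ur → Elem Ur}
    (hf : ∀ x ∈ vr q, f x = x) : IsSimplicial ⟨q, q', f⟩ := by
  intro A hA
  have : A.image f = A.image id := image_congr_vr hA hf
  rw [this, Finset.image_id]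
  exact (h.fa_iff A).mp hA

theorem not_isFace_cons {q : SetSeq Ur} {s t : FinPlus Ur} (hs : ¬ IsFace q s) (h : ofSet t ∉ s.1) :
    ¬ IsFace (t :: q) s := by
  rintro ⟨-, h' | ⟨h', -⟩⟩
  · exact hs h'
  · exact h h'

theorem not_isFace_adjoin {q : SetSeq Ur} {s t : FinPlus Ur}
    (hts : ofSet t ∉ s.1) (ht : ofSet t ∉ vr q) (hne : s ≠ t)
    (h : ¬ (IsFace q s ∧ IsFace q t)) :
    ¬ IsFace (s :: t :: q) (FinPlus.adjoin (s.1 \ t.1) t) := by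
  intro hX
  by_cases h1 : IsFace q t
  · have hsq : ¬ IsFace q s := fun h2 => h ⟨h2, h1⟩
    have hX' := (isFace_cons_of_not (not_isFace_cons hsq hts)).mp hX
    obtain ⟨-, ⟨h3, -⟩ | ⟨-, h3⟩⟩ := (fa_cons ht).mp hX'.fa
    · exact h3 (by simp [adjoin_val])
    · refine hsq (h3.mono fun x hx => ?_).isFace
      have := ofSet_mem_ne hts x hx
      simp only [adjoin_val, Finset.mem_union, Finset.mem_erase, Finset.mem_insert,
        Finset.mem_sdiff]
      tauto
  · rcases mem_vr_cons (hX.mem_vr (x := ofSet t) (by simp [adjoin_val])) with h2 | h2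
    · rcases mem_vr_cons h2 with h2 | h2
      · exact ht h2
      · exact h1 h2.2
    · exact hne (ofSet_injective h2.1).symm

/-- The adjoined set unfolds to one that includes both `s` and `t`. If they are not both faces it
drops out, and `s` and `t` may be interchanged because their union is not a face. -/
theorem CombEquiv.typeTwo {q : SetSeq Ur} {s t : FinPlus Ur} (hst : ofSet s ∉ t.1)
    (hts : ofSet t ∉ s.1) (hs : ofSet s ∉ vr q) (ht : ofSet t ∉ vr q) (hne : s ≠ t)
    (h : ¬ (IsFace q s ∧ IsFace q t)) :
    CombEquiv (FinPlus.adjoin (s.1 \ t.1) t :: s :: t :: q)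
      (FinPlus.adjoin (t.1 \ s.1) s :: t :: s :: q) := by
  refine (CombEquiv.drop _ _ (not_isFace_adjoin hts ht hne h)).trans (CombEquiv.trans ?_
    (CombEquiv.drop _ _ (not_isFace_adjoin hst hs (Ne.symm hne) fun h' => h h'.symm)).symm)
  exact CombEquiv.swap _ _ _ hst hts (Or.inl fun h' => h
    ⟨h'.mono Finset.subset_union_left, h'.mono Finset.subset_union_right⟩)

/-- The face is unwound completely to a face `B` of `q`, and each non-inclusion met on the way is
kept as a missing element. The same elements then witness the non-inclusions needed to build the
face up again in the other order. -/
theorem typeTwo_aux {q : SetSeq Ur} {s t X Y : FinPlus Ur} (hne' : ofSet s ≠ ofSet t)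
    (hXt : ofSet X ≠ ofSet t) (hXs : ofSet X ≠ ofSet s) (hYs : ofSet Y ≠ ofSet s)
    (htq : ofSet t ∉ vr q)
    (hs1 : ofSet s ∉ vr (t :: q)) (hX1 : ofSet X ∉ vr (s :: t :: q))
    (hsn : ∀ x ∈ s.1, x ≠ ofSet s ∧ x ≠ ofSet t ∧ x ≠ ofSet X ∧ x ≠ ofSet Y)
    (htn : ∀ x ∈ t.1, x ≠ ofSet s ∧ x ≠ ofSet t ∧ x ≠ ofSet X ∧ x ≠ ofSet Y)
    (hmX : ∀ x, x ∈ X.1 ↔ x = ofSet t ∨ (x ∈ s.1 ∧ x ∉ t.1))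
    (hmY : ∀ x, x ∈ Y.1 ↔ x = ofSet s ∨ (x ∈ t.1 ∧ x ∉ s.1))
    {A : Finset (Elem Ur)} (hYA : ofSet Y ∉ A) (hXA : ofSet X ∈ A)
    (hA : Fa (X :: s :: t :: q) A) :
    Fa (Y :: t :: s :: q) (insert (ofSet Y) (A.erase (ofSet X))) := by
  obtain ⟨h0, ⟨h1, h2⟩ | ⟨-, h2⟩⟩ := (fa_cons hX1).mp hA
  · exact absurd hXA h1
  clear hA hX1
  rw [fa_cons hs1] at h2
  clear hs1
  obtain ⟨w0, hw0, hw0'⟩ := Finset.not_subset.mp h0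
  obtain ⟨h3, h2⟩ := h2
  obtain ⟨w3, hw3, hw3'⟩ := Finset.not_subset.mp h3
  clear h0 h3
  have ht1 : ofSet t ∈ A.erase (ofSet X) ∪ X.1 := by grind
  have ht2 : ofSet t ∈ (A.erase (ofSet X) ∪ X.1).erase (ofSet s) ∪ s.1 := by grind
  obtain ⟨B, hB, hB1, hB2, hB3, hB4⟩ : ∃ B, Fa q B ∧ s.1 ⊆ B ∧ t.1 ⊆ B ∧
      (∀ x ∈ A, x ≠ ofSet s → x ≠ ofSet t → x ≠ ofSet X → x ∈ B) ∧
      ∃ w ∈ t.1, w ∉ A ∧ (ofSet s ∈ A → w ∉ s.1) := by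
    rcases h2 with ⟨h4, h5⟩ | ⟨h4, h5⟩
    all_goals
      rw [fa_cons htq] at h5
      obtain ⟨h6, ⟨h7, -⟩ | ⟨-, h8⟩⟩ := h5
      · exact absurd (by assumption) h7
      obtain ⟨w6, hw6, hw6'⟩ := Finset.not_subset.mp h6
      clear h6 htq
      refine ⟨_, h8, fun x hx => ?_, fun x hx => ?_, fun x hx h1 h2 h3 => ?_, w6, hw6, ?_, ?_⟩
      all_goals clear h8; grind
  clear h2 htq
  refine fa_cons_intro ?_ (Or.inr ⟨by simp, ?_⟩)
  · rw [Finset.not_subset]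
    by_cases hsA : ofSet s ∈ A
    · obtain ⟨w, hw⟩ := hB4
      exact ⟨w, by grind, by grind⟩
    · exact ⟨ofSet s, by grind, by grind⟩
  · obtain ⟨w, hw, hwA, hwA'⟩ := hB4
    have hins : (insert (ofSet Y) (A.erase (ofSet X))).erase (ofSet Y) = A.erase (ofSet X) := by
      rw [Finset.erase_insert (by simp [hYA])]
    rw [hins]
    -- As `X` includes `s \ t`, the element of `s` that is missing lies in `t`; being in `s`, it is
    -- missing from `Y` too.
    have hw3A : w3 ∉ A ∧ w3 ∈ t.1 ∧ w3 ∉ Y.1 := by clear hB3; grind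
    have hsY : ofSet s ∈ Y.1 := by simp [hmY]
    refine fa_cons_intro (Finset.not_subset.mpr ⟨w3, hw3A.2.1, by clear hB3; grind⟩) ?_
    by_cases htA : ofSet t ∈ A
    · refine Or.inr ⟨by clear hB3; grind, ?_⟩
      have hw0t : w0 ∈ s.1 ∧ w0 ∉ t.1 := by clear hB3; grind
      refine fa_cons_intro (Finset.not_subset.mpr ⟨w0, hw0t.1, by clear hB3; grind⟩) ?_
      exact Or.inr ⟨by clear hB3; grind, hB.mono fun x hx => by clear hB; grind⟩
    · refine Or.inl (fa_cons_intro (Finset.not_subset.mpr ⟨w3, hw3, by clear hB3; grind⟩) ?_)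
      exact Or.inr ⟨by clear hB3; grind, hB.mono fun x hx => by clear hB; grind⟩

theorem typeTwo_aux' {q : SetSeq Ur} {s t X Y : FinPlus Ur} (htq : ofSet t ∉ vr q)
    (hs1 : ofSet s ∉ vr (t :: q)) (hX1 : ofSet X ∉ vr (s :: t :: q))
    (hsn : ∀ x ∈ s.1, x ≠ ofSet s ∧ x ≠ ofSet t ∧ x ≠ ofSet X ∧ x ≠ ofSet Y)
    (htn : ∀ x ∈ t.1, x ≠ ofSet s ∧ x ≠ ofSet t ∧ x ≠ ofSet X ∧ x ≠ ofSet Y)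
    (hmX : ∀ x, x ∈ X.1 ↔ x = ofSet t ∨ (x ∈ s.1 ∧ x ∉ t.1))
    (hmY : ∀ x, x ∈ Y.1 ↔ x = ofSet s ∨ (x ∈ t.1 ∧ x ∉ s.1))
    {A : Finset (Elem Ur)} (hXA : ofSet X ∉ A) (hA : Fa (X :: s :: t :: q) A) :
    Fa (Y :: t :: s :: q) A := by
  obtain ⟨h0, ⟨-, h2⟩ | ⟨h1, h2⟩⟩ := (fa_cons hX1).mp hA
  swap
  · exact absurd h1 hXA
  clear hA hX1
  rw [fa_cons hs1] at h2
  clear hs1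
  obtain ⟨h3, ⟨h4, h5⟩ | ⟨h4, h5⟩⟩ := h2
  all_goals
    rw [fa_cons htq] at h5
    clear htq
    refine fa_cons_intro (fun hY => ?_) (Or.inl ?_)
    · obtain ⟨h6, -⟩ := h5
      grind
    obtain ⟨h6, ⟨h7, h8⟩ | ⟨h7, h8⟩⟩ := h5
  · refine fa_cons_intro (by clear h8; grind) (Or.inl ?_)
    exact fa_cons_intro (by clear h8; grind) (Or.inl h8)
  · refine fa_cons_intro (by clear h8; grind) (Or.inr ⟨by grind, ?_⟩)
    exact fa_cons_intro (by clear h8; grind) (Or.inl (h8.mono (by clear h8; grind)))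
  · refine fa_cons_intro (by clear h8; grind) (Or.inl ?_)
    exact fa_cons_intro (by clear h8; grind) (Or.inr ⟨by grind, h8.mono (by clear h8; grind)⟩)
  · refine fa_cons_intro (by clear h8; grind) (Or.inr ⟨by grind, ?_⟩)
    exact fa_cons_intro (by clear h8; grind) (Or.inr ⟨by grind, h8.mono (by clear h8; grind)⟩)

theorem isSimplicial_typeTwoMap {q : SetSeq Ur} {s t : FinPlus Ur} (hst : ofSet s ∉ t.1)
    (hts : ofSet t ∉ s.1) (hs : ofSet s ∉ tc (vr q)) (ht : ofSet t ∉ tc (vr q)) :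
    IsSimplicial (typeTwoMap q s t) := by
  by_cases hne : s = t
  · subst hne
    exact (CombEquiv.refl _).isSimplicial fun x _ => by simp [Function.update_apply, eq_comm]
  have hsq : ofSet s ∉ vr q := fun h => hs (subset_tc _ h)
  have htq : ofSet t ∉ vr q := fun h => ht (subset_tc _ h)
  have hne' : ofSet s ≠ ofSet t := fun h => hne (ofSet_injective h)
  set X := FinPlus.adjoin (s.1 \ t.1) t with hX
  set Y := FinPlus.adjoin (t.1 \ s.1) s with hY
  have hXv : X.1 = insert (ofSet t) (s.1 \ t.1) := rfl
  have hYv : Y.1 = insert (ofSet s) (t.1 \ s.1) := rfl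
  have hXt : ofSet X ≠ ofSet t := (ofSet_ne_of_mem (by rw [hXv]; simp)).symm
  have hXs : ofSet X ≠ ofSet s := fun h => hts (ofSet_injective h ▸ (by rw [hXv]; simp))
  have hYs : ofSet Y ≠ ofSet s := (ofSet_ne_of_mem (by rw [hYv]; simp)).symm
  have hYt : ofSet Y ≠ ofSet t := fun h => hst (ofSet_injective h ▸ (by rw [hYv]; simp))
  have hXq : ofSet X ∉ vr q := notMem_vr_of_mem (x := ofSet t) (by rw [hXv]; simp) ht
  have hYq : ofSet Y ∉ vr q := notMem_vr_of_mem (x := ofSet s) (by rw [hYv]; simp) hs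
  have hs1 : ofSet s ∉ vr (t :: q) := notMem_vr_cons hsq hne'
  have hX1 : ofSet X ∉ vr (s :: t :: q) := notMem_vr_cons (notMem_vr_cons hXq hXt) hXs
  -- If not both sets are faces, domain and codomain are equivalent and the map is the identity on
  -- vertices.
  by_cases hf : IsFace q s ∧ IsFace q t
  swap
  · refine (CombEquiv.typeTwo hst hts hsq htq hne hf).isSimplicial fun x hx => ?_
    rw [(CombEquiv.drop _ _ (not_isFace_adjoin hts htq hne hf)).vr_eq] at hx
    have : x ≠ ofSet X := by rintro rfl; exact hX1 hx
    exact Function.update_of_ne this _ _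
  intro A hA
  have hXY : ofSet X ≠ ofSet Y := by
    intro h
    have h1 : ofSet t ∈ Y.1 := ofSet_injective h ▸ (by rw [hXv]; simp)
    rw [hYv] at h1
    simp only [Finset.mem_insert, Finset.mem_sdiff] at h1
    rcases h1 with h1 | h1
    · exact hne' h1.symm
    · exact notMem_self t h1.1
  have hY1 : ofSet Y ∉ vr (X :: s :: t :: q) :=
    notMem_vr_cons (notMem_vr_cons (notMem_vr_cons hYq hYt) hYs) hXY.symm
  have hYA : ofSet Y ∉ A := fun h => hY1 (Fa.mem_vr hA h)
  have hsn : ∀ x ∈ s.1, x ≠ ofSet s ∧ x ≠ ofSet t ∧ x ≠ ofSet X ∧ x ≠ ofSet Y := by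
    intro x hx
    have := hf.1.mem_vr hx
    refine ⟨?_, ?_, ?_, ?_⟩ <;> rintro rfl <;> contradiction
  have htn : ∀ x ∈ t.1, x ≠ ofSet s ∧ x ≠ ofSet t ∧ x ≠ ofSet X ∧ x ≠ ofSet Y := by
    intro x hx
    have := hf.2.mem_vr hx
    refine ⟨?_, ?_, ?_, ?_⟩ <;> rintro rfl <;> contradiction
  have hmX : ∀ x, x ∈ X.1 ↔ x = ofSet t ∨ (x ∈ s.1 ∧ x ∉ t.1) := by intro x; rw [hXv]; simp
  have hmY : ∀ x, x ∈ Y.1 ↔ x = ofSet s ∨ (x ∈ t.1 ∧ x ∉ s.1) := by intro x; rw [hYv]; simp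
  by_cases hXA : ofSet X ∈ A
  · have hi : A.image (typeTwoMap q s t).toFun = insert (ofSet Y) (A.erase (ofSet X)) := by
      ext x
      simp only [typeTwoMap, Finset.mem_image, Finset.mem_insert, Finset.mem_erase, ← hX, ← hY,
        Function.update_apply, id]
      grind
    rw [hi]
    exact typeTwo_aux hne' hXt hXs hYs htq hs1 hX1 hsn htn hmX hmY hYA hXA hA
  · have hi : A.image (typeTwoMap q s t).toFun = A := by
      ext x
      simp only [typeTwoMap, Finset.mem_image, ← hX, ← hY, Function.update_apply, id]
      grind
    rw [hi]
    exact typeTwo_aux' htq hs1 hX1 hsn htn hmX hmY hXA hA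

theorem fa_cons_subset {q : SetSeq Ur} {u t : FinPlus Ur} (ht : ofSet t ∉ vr q) (hu : ofSet u ∉ vr q)
    {A : Finset (Elem Ur)} (h : Fa (u :: t :: q) A) : ¬ u.1 ⊆ A ∧
      (Fa (t :: q) A ∨ (u ≠ t ∧ ofSet u ∈ A ∧ Fa (t :: q) (A.erase (ofSet u) ∪ u.1))) := by
  refine ⟨fun h' => not_fa_cons_of_subset h' h, ?_⟩
  by_cases hut : u = t
  · subst hut
    exact Or.inl ((fa_cons_of_not fun h' => not_fa_cons_of_subset subset_rfl h'.fa).mp h)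
  · have : ofSet u ∉ vr (t :: q) := notMem_vr_cons hu fun h => hut (ofSet_injective h)
    obtain ⟨-, ⟨-, h⟩ | ⟨h1, h2⟩⟩ := (fa_cons this).mp h
    · exact Or.inl h
    · exact Or.inr ⟨hut, h1, h2⟩

/-- The four cases record which of the two moved vertices `t` and `R` lie in the face. In each, the
elements missing from the domain faces serve as witnesses of non-inclusion in the codomain. -/
theorem typeOne_aux {q : SetSeq Ur} {r s : Finset (Elem Ur)} {t u R Z : FinPlus Ur}
    (htq : ofSet t ∉ vr q) (huq : ofSet u ∉ vr q) (hR : ofSet R ∉ vr (u :: t :: q))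
    (htR : ofSet t ≠ ofSet R) (htZ : ofSet t ≠ ofSet Z)
    (huR : ofSet u ≠ ofSet R) (huZ : ofSet u ≠ ofSet Z)
    (hmR : ∀ x, x ∈ R.1 ↔ x = ofSet t ∨ x ∈ r) (hmZ : ∀ x, x ∈ Z.1 ↔ x = ofSet t ∨ x ∈ s)
    (hmu : ∀ x, x ∈ u.1 ↔ x ∈ r ∨ x ∈ s) (hrt : ∀ x ∈ r, x ∈ t.1 ∧ x ∉ s) (hst : ∀ x ∈ s, x ∈ t.1)
    (htn : ∀ x ∈ t.1, x ≠ ofSet u ∧ x ≠ ofSet t ∧ x ≠ ofSet R ∧ x ≠ ofSet Z)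
    {A : Finset (Elem Ur)} (hA : Fa (R :: u :: t :: q) A) :
    Fa (Z :: u :: t :: q) (A.image fun x => if x = ofSet t then ofSet Z
      else if x = ofSet R then ofSet t else x) := by
  set A' := A.image fun x => if x = ofSet t then ofSet Z
      else if x = ofSet R then ofSet t else x with hA'
  have hmA : ∀ x, x ∈ A' ↔ (x = ofSet Z ∧ ofSet t ∈ A) ∨ (x = ofSet t ∧ ofSet R ∈ A) ∨
      (x ∈ A ∧ x ≠ ofSet t ∧ x ≠ ofSet R) := by
    intro x
    rw [hA', Finset.mem_image]
    constructor
    · rintro ⟨y, hy, rfl⟩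
      split_ifs with h1 h2
      · subst h1; exact Or.inl ⟨rfl, hy⟩
      · subst h2; exact Or.inr (Or.inl ⟨rfl, hy⟩)
      · exact Or.inr (Or.inr ⟨hy, h1, h2⟩)
    · rintro (⟨rfl, h⟩ | ⟨rfl, h⟩ | ⟨h, h1, h2⟩)
      · exact ⟨_, h, by simp⟩
      · exact ⟨_, h, by simp [htR.symm]⟩
      · exact ⟨_, h, by simp [h1, h2]⟩
  clear_value A'
  clear hA'
  obtain ⟨h0, ⟨hRA, h2⟩ | ⟨hRA, h2⟩⟩ := (fa_cons hR).mp hA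
  all_goals
    clear hA hR
    obtain ⟨w0, hw0, hw0'⟩ := Finset.not_subset.mp h0
    clear h0
    by_cases htA : ofSet t ∈ A
  · obtain ⟨-, h3⟩ := fa_cons_subset htq huq h2
    clear h2 huq
    -- Since `t ∈ A`, what `A` misses of `R` lies in `r`. That element keeps both `u` and `t` from
    -- being included in the unfolded image.
    have hw0r : w0 ∈ r := by grind
    refine fa_cons_intro (Finset.not_subset.mpr ⟨ofSet t, by simp [hmZ], by
      simp [hmA, htZ, hRA]⟩) (Or.inr ⟨by simp [hmA, htA], ?_⟩)
    refine fa_cons_intro (Finset.not_subset.mpr ⟨w0, by simp [hmu, hw0r], by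
      clear h3 htq; grind⟩) ?_
    rcases h3 with h3 | ⟨hut, huA, h3⟩
    · refine Or.inl (fa_cons_intro (Finset.not_subset.mpr ⟨w0, (hrt _ hw0r).1, by
        clear h3 htq; grind⟩) (Or.inr ⟨by clear h3 htq; grind, ?_⟩))
      obtain ⟨-, ⟨h4, -⟩ | ⟨-, h4⟩⟩ := (fa_cons htq).mp h3
      · exact absurd htA h4
      · exact h4.mono fun x hx => by clear h3 h4 htq; grind
    · refine Or.inr ⟨by clear h3 htq; grind, ?_⟩
      have hut' : ofSet t ≠ ofSet u := fun h => hut (ofSet_injective h).symm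
      obtain ⟨h4, ⟨h5, -⟩ | ⟨-, h5⟩⟩ := (fa_cons htq).mp h3
      · exact absurd (Finset.mem_union_left _ (Finset.mem_erase.mpr ⟨hut', htA⟩)) h5
      obtain ⟨w, hw, hw'⟩ := Finset.not_subset.mp h4
      clear h3 htq h4
      refine fa_cons_intro (Finset.not_subset.mpr ⟨w, hw, by clear h5; grind⟩)
        (Or.inr ⟨by clear h5; grind, h5.mono fun x hx => by clear h5; grind⟩)
  · have : A' = A := by ext x; rw [hmA]; grind
    rw [this]
    exact fa_cons_intro (Finset.not_subset.mpr ⟨ofSet t, by simp [hmZ], htA⟩) (Or.inl h2)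
  · obtain ⟨h1, h3⟩ := fa_cons_subset htq huq h2
    obtain ⟨ws, hws, hws'⟩ := Finset.not_subset.mp h1
    clear h2 h1 huq
    have hw0r : w0 ∈ r := by grind
    have hwss : ws ∈ s ∧ ws ∉ A := by clear h3; grind
    refine fa_cons_intro (Finset.not_subset.mpr ⟨ws, by simp [hmZ, hwss], by
      clear h3 htq; grind⟩) (Or.inr ⟨by simp [hmA, htA], ?_⟩)
    refine fa_cons_intro (Finset.not_subset.mpr ⟨w0, by simp [hmu, hw0r], by
      clear h3 htq; grind⟩) ?_
    have htA1 : ofSet t ∈ A.erase (ofSet R) ∪ R.1 := by simp [hmR]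
    rcases h3 with h3 | ⟨hut, huA, h3⟩
    · refine Or.inl (fa_cons_intro (Finset.not_subset.mpr ⟨w0, (hrt _ hw0r).1, by
        clear h3 htq; grind⟩) (Or.inr ⟨by clear h3 htq; grind, ?_⟩))
      obtain ⟨-, ⟨h4, -⟩ | ⟨-, h4⟩⟩ := (fa_cons htq).mp h3
      · exact absurd htA1 h4
      · exact h4.mono fun x hx => by clear h3 h4 htq; grind
    · refine Or.inr ⟨by clear h3 htq; grind, ?_⟩
      have hut' : ofSet t ≠ ofSet u := fun h => hut (ofSet_injective h).symm
      obtain ⟨h4, ⟨h5, -⟩ | ⟨-, h5⟩⟩ := (fa_cons htq).mp h3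
      · exact absurd (Finset.mem_union_left _ (Finset.mem_erase.mpr ⟨hut', htA1⟩)) h5
      obtain ⟨w, hw, hw'⟩ := Finset.not_subset.mp h4
      clear h3 htq h4
      refine fa_cons_intro (Finset.not_subset.mpr ⟨w, hw, by clear h5; grind⟩)
        (Or.inr ⟨by clear h5; grind, h5.mono fun x hx => by clear h5; grind⟩)
  · obtain ⟨h1, h3⟩ := fa_cons_subset htq huq h2
    obtain ⟨ws, hws, hws'⟩ := Finset.not_subset.mp h1
    clear h2 h1 huq
    have hwss : ws ∈ s ∧ ws ∉ A := by clear h3; grind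
    refine fa_cons_intro (Finset.not_subset.mpr ⟨ws, by simp [hmZ, hwss], by
      clear h3 htq; grind⟩) (Or.inl ?_)
    refine fa_cons_intro (Finset.not_subset.mpr ⟨ws, hws, by
      clear h3 htq; grind⟩) ?_
    have htA1 : ofSet t ∈ A.erase (ofSet R) ∪ R.1 := by simp [hmR]
    rcases h3 with h3 | ⟨hut, huA, h3⟩
    · refine Or.inl (fa_cons_intro (Finset.not_subset.mpr ⟨ws, hst _ hwss.1, by
        clear h3 htq; grind⟩) (Or.inr ⟨by clear h3 htq; grind, ?_⟩))
      obtain ⟨-, ⟨h4, -⟩ | ⟨-, h4⟩⟩ := (fa_cons htq).mp h3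
      · exact absurd htA1 h4
      · exact h4.mono fun x hx => by clear h3 h4 htq; grind
    · refine Or.inr ⟨by clear h3 htq; grind, ?_⟩
      have hut' : ofSet t ≠ ofSet u := fun h => hut (ofSet_injective h).symm
      obtain ⟨h4, ⟨h5, -⟩ | ⟨-, h5⟩⟩ := (fa_cons htq).mp h3
      · exact absurd (Finset.mem_union_left _ (Finset.mem_erase.mpr ⟨hut', htA1⟩)) h5
      obtain ⟨w, hw, hw'⟩ := Finset.not_subset.mp h4
      clear h3 htq h4
      refine fa_cons_intro (Finset.not_subset.mpr ⟨w, hw, by clear h5; grind⟩)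
        (Or.inr ⟨by clear h5; grind, h5.mono fun x hx => by clear h5; grind⟩)

theorem isSimplicial_typeOneMap {q : SetSeq Ur} {r s : Finset (Elem Ur)} {t : FinPlus Ur}
    (h : (r ∪ s).Nonempty) (hr : r ⊆ t.1) (hs : s ⊆ t.1) (hd : Disjoint r s)
    (ht : ofSet t ∉ tc (vr q)) : IsSimplicial (typeOneMap q r s t h) := by
  have htq : ofSet t ∉ vr q := fun h => ht (subset_tc _ h)
  set u : FinPlus Ur := ⟨r ∪ s, h⟩ with hu
  set R := FinPlus.adjoin r t with hR
  set Z := FinPlus.adjoin s t with hZ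
  have hRv : R.1 = insert (ofSet t) r := rfl
  have hZv : Z.1 = insert (ofSet t) s := rfl
  have hut : u.1 ⊆ t.1 := Finset.union_subset hr hs
  have htu : ofSet t ∉ u.1 := fun h => notMem_self t (hut h)
  have htR : ofSet t ≠ ofSet R := ofSet_ne_of_mem (by rw [hRv]; simp)
  have htZ : ofSet t ≠ ofSet Z := ofSet_ne_of_mem (by rw [hZv]; simp)
  have huR : ofSet u ≠ ofSet R := fun h => htu (ofSet_injective h ▸ (by rw [hRv]; simp))
  have huZ : ofSet u ≠ ofSet Z := fun h => htu (ofSet_injective h ▸ (by rw [hZv]; simp))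
  have hRq : ofSet R ∉ vr q := notMem_vr_of_mem (x := ofSet t) (by rw [hRv]; simp) ht
  have hZq : ofSet Z ∉ vr q := notMem_vr_of_mem (x := ofSet t) (by rw [hZv]; simp) ht
  have hR1 : ofSet R ∉ vr (u :: t :: q) := notMem_vr_cons (notMem_vr_cons hRq htR.symm) huR.symm
  -- If `t` is not a face it gives no vertex, so both adjoined sets drop out and the map is the
  -- identity on vertices.
  by_cases hf : IsFace q t
  swap
  · have ht1 : ofSet t ∉ vr (u :: t :: q) := by
      intro h1
      rcases mem_vr_cons h1 with h1 | ⟨h1, h2⟩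
      · rcases mem_vr_cons h1 with h1 | ⟨-, h2⟩
        · exact htq h1
        · exact hf h2
      · rw [← ofSet_injective h1] at h2
        exact not_fa_cons_of_subset subset_rfl h2.fa
    have hRn : ¬ IsFace (u :: t :: q) R := fun h => ht1 (h.mem_vr (by rw [hRv]; simp))
    have hZn : ¬ IsFace (u :: t :: q) Z := fun h => ht1 (h.mem_vr (by rw [hZv]; simp))
    refine ((CombEquiv.drop _ _ hRn).trans (CombEquiv.drop _ _ hZn).symm).isSimplicial fun x hx => ?_
    rw [(CombEquiv.drop _ _ hRn).vr_eq] at hx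
    rw [if_neg (by rintro rfl; exact ht1 hx), if_neg (by rintro rfl; exact hR1 hx)]
  have huf : IsFace q u := hf.mono hut
  intro A hA
  have hA : Fa (R :: u :: t :: q) A := hA
  refine typeOne_aux (r := r) (s := s) htq huf.notMem_vr hR1 htR htZ huR huZ
    (by simp [hRv]) (by simp [hZv]) (by simp [hu])
    (fun x hx => ⟨hr hx, Finset.disjoint_left.mp hd hx⟩) (fun x hx => hs hx) ?_ hA
  intro x hx
  have := hf.mem_vr hx
  have hu' := huf.notMem_vr
  refine ⟨?_, ?_, ?_, ?_⟩ <;> rintro rfl <;> contradiction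

theorem IsCombIso.isSimplicial {f : SeqMap Ur} (h : IsCombIso f) : IsSimplicial f := by
  induction h with
  | type1 q r s t h hr hs hd ht => exact isSimplicial_typeOneMap h hr hs hd ht
  | type2 q s t h1 h2 h3 h4 => exact isSimplicial_typeTwoMap h1 h2 h3 h4
  | type3a q x _ => exact isSimplicial_typeThreeMap
  | type3b q x h => exact isSimplicial_weldMap (by simp [FinPlus.sing]) h
  | comp _ _ h ih1 ih2 => exact ih1.comp ih2 h
  | division s _ hE ih => exact ih.divide s hE.2.1
  | same _ h ih => exact ih.same h

/-- Needed to compute fibers: a face of the domain is sent to a face of the codomain, so the set on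
which a new vertex is based has an image that is not itself a vertex. -/
theorem IsPureWeldDivision.isSimplicial {f : SeqMap Ur} (h : IsPureWeldDivision f) :
    IsSimplicial f := by
  induction h with
  | weld q x t hx ht => exact isSimplicial_weldMap hx ht
  | combIso h => exact h.isSimplicial
  | comp _ _ h ih1 ih2 => exact ih1.comp ih2 h
  | pureDivision s _ _ hE ih => exact ih.divide s hE.2.1
  | same _ h ih => exact ih.same h

/-! ### Pure weld-division maps as functions between sequences; lifting by pure division. -/

/-- The function `f` gives a pure weld-division map from `d` to `c`. -/
def PW (d c : SetSeq Ur) (f : Elem Ur → Elem Ur) : Prop := IsPureWeldDivision ⟨d, c, f⟩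

theorem PW.fa {d c : SetSeq Ur} {f : Elem Ur → Elem Ur} (h : PW d c f) {A : Finset (Elem Ur)}
    (hA : Fa d A) : Fa c (A.image f) := IsPureWeldDivision.isSimplicial h A hA

theorem PW.isFace {d c : SetSeq Ur} {f : Elem Ur → Elem Ur} (h : PW d c f) {t : FinPlus Ur}
    (ht : IsFace d t) : IsFace c (t.image f) := (h.fa ht.fa).isFace

theorem PW.mem_vr {d c : SetSeq Ur} {f : Elem Ur → Elem Ur} (h : PW d c f) {x : Elem Ur}
    (hx : x ∈ vr d) : f x ∈ vr c := by
  rw [mem_vr_iff] at hx ⊢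
  simpa using h.fa hx

theorem PW.congr {d c d' c' : SetSeq Ur} {f f' : Elem Ur → Elem Ur} (h : PW d c f)
    (hd : CombEquiv d d') (hc : CombEquiv c c') (hf : ∀ x ∈ vr d, f x = f' x) : PW d' c' f' :=
  IsPureWeldDivision.same h ⟨hd, hc, hf⟩

theorem PW.congr_fun {d c : SetSeq Ur} {f f' : Elem Ur → Elem Ur} (h : PW d c f)
    (hf : ∀ x ∈ vr d, f x = f' x) : PW d c f' := h.congr (.refl _) (.refl _) hf

theorem PW.comp {d c e : SetSeq Ur} {f g : Elem Ur → Elem Ur} (hg : PW c e g) (hf : PW d c f) :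
    PW d e (g ∘ f) := IsPureWeldDivision.comp hg hf (.refl _)

theorem pw_weld {q : SetSeq Ur} {t : FinPlus Ur} {f : Elem Ur → Elem Ur} (ht : ofSet t ∉ vr q)
    (hft : f (ofSet t) ∈ t.1) (hf : ∀ x ∈ vr q, f x = x) : PW (t :: q) q f := by
  refine IsPureWeldDivision.same (.weld q _ t hft ht) ⟨.refl _, .refl _, fun x hx => ?_⟩
  rcases mem_vr_cons hx with h | ⟨rfl, -⟩
  · have : x ≠ ofSet t := by rintro rfl; exact ht h
    simp [weldMap, Function.update_of_ne this, hf x h]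
  · simp [weldMap]

theorem pw_toSing {q : SetSeq Ur} {x : Elem Ur} {f : Elem Ur → Elem Ur}
    (hx : ofSet (FinPlus.sing x) ∉ vr q) (hfx : f x = ofSet (FinPlus.sing x))
    (hf : ∀ y ∈ vr q, y ≠ x → f y = y) : PW q (FinPlus.sing x :: q) f := by
  refine IsPureWeldDivision.same (.combIso (.type3a q x hx)) ⟨.refl _, .refl _, fun y hy => ?_⟩
  by_cases h : y = x
  · subst h; simp [typeThreeMap, hfx]
  · simp [typeThreeMap, Function.update_of_ne h, hf y hy h]

/-- The identity is not a generator. It arises by renaming a vertex `x` to `{x}` and welding it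
back, which is why some vertex is required. -/
theorem pw_id {q : SetSeq Ur} {x : Elem Ur} (hx : x ∈ vr q) : PW q q id := by
  have hF : IsFace q (FinPlus.sing x) := (mem_vr_iff.mp hx).isFace
  have h1 : PW q (FinPlus.sing x :: q) (Function.update id x (ofSet (FinPlus.sing x))) :=
    pw_toSing hF.notMem_vr (by simp) fun y _ h => by simp [Function.update_of_ne h]
  have h2 : PW (FinPlus.sing x :: q) q (Function.update id (ofSet (FinPlus.sing x)) x) := by
    refine pw_weld hF.notMem_vr (by simp [FinPlus.sing]) fun y hy => ?_
    have : y ≠ ofSet (FinPlus.sing x) := by rintro rfl; exact hF.notMem_vr hy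
    simp [Function.update_of_ne this]
  refine (h2.comp h1).congr_fun fun y hy => ?_
  by_cases h : y = x
  · subst h; simp
  · have : y ≠ ofSet (FinPlus.sing x) := by rintro rfl; exact hF.notMem_vr hy
    simp [Function.update_of_ne h, Function.update_of_ne this]

theorem image_val (f : Elem Ur → Elem Ur) (t : FinPlus Ur) : (t.image f).1 = t.1.image f := rfl

theorem isNonDecEnum_singleton {t : FinPlus Ur} {S : Set (FinPlus Ur)} (h : ∀ s, s ∈ S ↔ s = t) :
    IsNonDecEnum [t] S :=
  ⟨by simp, by simp [h], fun i j _ => by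
    have hi := i.2; have hj := j.2
    simp only [List.length_singleton] at hi hj
    exact Fin.le_def.mpr (by omega)⟩

theorem isNonDecEnum_nil {S : Set (FinPlus Ur)} (h : ∀ s, s ∉ S) : IsNonDecEnum [] S :=
  ⟨by simp, by simpa using h, fun i => i.elim0⟩

/-- Pure division based on a set with unique preimages. -/
theorem PW.cons {d c : SetSeq Ur} {h h' : Elem Ur → Elem Ur} {z : FinPlus Ur} (H : PW d c h)
    (hz : ∀ v ∈ z.1, v ∈ vr d) (hu : ∀ v ∈ z.1, ∀ x ∈ vr d, h x = h v → x = v)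
    (hh : ∀ x ∈ vr d, h' x = h x) (hz' : h' (ofSet z) = ofSet (z.image h)) :
    PW (z :: d) (z.image h :: c) h' := by
  -- Unique preimages force every member of the fiber to equal `z`.
  have key : ∀ t, t ∈ fiber ⟨d, c, h⟩ (z.image h) ↔ IsFace d z ∧ t = z := by
    intro t
    constructor
    · rintro ⟨h1, h2⟩
      have : t = z := by
        have h2 : t.1.image h = z.1.image h := congrArg Subtype.val h2
        refine Subtype.ext (Finset.Subset.antisymm (fun x hx => ?_) fun v hv => ?_)
        · have := Finset.mem_image_of_mem h hx
          rw [h2] at this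
          obtain ⟨v, hv, hvx⟩ := Finset.mem_image.mp this
          rwa [hu v hv x (h1.mem_vr hx) hvx.symm]
        · have := Finset.mem_image_of_mem h hv
          rw [← h2] at this
          obtain ⟨x, hx, hvx⟩ := Finset.mem_image.mp this
          rwa [← hu v hv x (h1.mem_vr hx) hvx]
      exact ⟨this ▸ h1, this⟩
    · rintro ⟨h1, rfl⟩
      exact ⟨h1, rfl⟩
  have hpure : ∀ x ∈ (z.image h).1, x ∈ uniq ⟨d, c, h⟩ := by
    intro x hx
    obtain ⟨v, hv, rfl⟩ := Finset.mem_image.mp hx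
    exact ⟨H.mem_vr (hz v hv), v, ⟨hz v hv, rfl⟩, fun w hw => hu v hv w hw.1 hw.2⟩
  by_cases hf : IsFace d z
  · refine IsPureWeldDivision.same (.pureDivision (z.image h) H hpure
      (isNonDecEnum_singleton (t := z) fun t => by simp [key, hf])) ⟨.refl _, .refl _, fun x hx => ?_⟩
    rcases mem_vr_cons hx with hx | ⟨rfl, -⟩
    · have hne : x ≠ ofSet z := by rintro rfl; exact hf.notMem_vr hx
      refine Eq.trans (if_neg ?_) (hh x hx).symm
      rintro ⟨t, ht, rfl⟩
      exact hne (by rw [((key t).mp ht).2])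
    · exact Eq.trans (if_pos ⟨z, (key z).mpr ⟨hf, rfl⟩, rfl⟩) hz'.symm
  -- The fiber is empty, but the codomain is divided all the same; in the domain `z` may be added
  -- freely since it is not a face.
  · refine IsPureWeldDivision.same (.pureDivision (z.image h) H hpure
      (isNonDecEnum_nil fun t => by simp [key, hf]))
      ⟨(CombEquiv.drop _ _ hf).symm, .refl _, fun x hx => ?_⟩
    have hx : x ∈ vr d := hx
    refine Eq.trans (if_neg ?_) (hh x hx).symm
    rintro ⟨t, ht, -⟩
    exact hf ((key t).mp ht).1

theorem mem_vr_append {q : SetSeq Ur} {x : Elem Ur} (L : SetSeq Ur) (hx : x ∈ vr q)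
    (h1 : ∀ z ∈ L, x ≠ ofSet z) (h2 : ∀ z ∈ L, z.1 ≠ {x}) : x ∈ vr (L ++ q) := by
  rw [mem_vr_iff] at hx ⊢
  rw [fa_append L fun r hr => by simpa using (h1 r hr).symm]
  exact ⟨hx, fun r hr h => h2 r hr ((Finset.subset_singleton_iff.mp h).resolve_left r.2.ne_empty)⟩

theorem notMem_vr_append {q : SetSeq Ur} {x : Elem Ur} {L : SetSeq Ur} (hx : x ∉ vr q)
    (h1 : ∀ z ∈ L, x ≠ ofSet z) : x ∉ vr (L ++ q) := by
  induction L with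
  | nil => exact hx
  | cons a L ih =>
    exact notMem_vr_cons (ih fun z hz => h1 z (List.mem_cons_of_mem _ hz)) (h1 a List.mem_cons_self)

theorem mem_vr_of_append {q : SetSeq Ur} {x : Elem Ur} {L : SetSeq Ur} (hx : x ∈ vr (L ++ q)) :
    x ∈ vr q ∨ ∃ z ∈ L, x = ofSet z := by
  by_contra h
  push Not at h
  exact notMem_vr_append h.1 h.2 hx

theorem image_congr_fun {f g : Elem Ur → Elem Ur} {t : FinPlus Ur} (h : ∀ x ∈ t.1, f x = g x) :
    t.image f = t.image g := Subtype.ext (Finset.image_congr h)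

/-- Pure division based on a list of sets with unique preimages. -/
theorem PW.append {d c : SetSeq Ur} {h h' : Elem Ur → Elem Ur} (H : PW d c h) (L : SetSeq Ur)
    (hz : ∀ z ∈ L, ∀ v ∈ z.1, v ∈ vr d) (hfr : ∀ z ∈ L, ofSet z ∉ vr d)
    (hu : ∀ z ∈ L, ∀ v ∈ z.1, ∀ x ∈ vr d, h x = h v → x = v)
    (hP : L.Pairwise fun a b => ∀ v ∈ a.1, b.1 ≠ {v})
    (hh : ∀ x ∈ vr d, h' x = h x) (hz' : ∀ z ∈ L, h' (ofSet z) = ofSet (z.image h)) :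
    PW (L ++ d) (L.map (FinPlus.image h) ++ c) h' := by
  -- The induction must also carry that unique preimages survive the divisions made so far.
  -- Surviving vertices are needed too: only division by `{v}` removes a vertex `v`, which is what
  -- `hP` rules out.
  have key : PW (L ++ d) (L.map (FinPlus.image h) ++ c) h' ∧
      ∀ v ∈ vr d, v ∈ vr (L ++ d) → (∀ x ∈ vr d, h x = h v → x = v) →
        ∀ x ∈ vr (L ++ d), h' x = h' v → x = v := by
    induction L with
    | nil =>
      refine ⟨H.congr_fun fun x hx => (hh x hx).symm, fun v hv _ hvu x hx hxv => ?_⟩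
      rw [hh x hx, hh v hv] at hxv
      exact hvu x hx hxv
    | cons a L ih =>
      simp only [List.forall_mem_cons] at hz hfr hu hz'
      rw [List.pairwise_cons] at hP
      obtain ⟨ih1, ih2⟩ := ih hz.2 hfr.2 hu.2 hP.2 hz'.2
      have himg : a.image h = a.image h' := image_congr_fun fun x hx => (hh x (hz.1 x hx)).symm
      have hper : ∀ v ∈ a.1, v ∈ vr (L ++ d) := fun v hv => mem_vr_append L (hz.1 v hv)
        (fun z hz' hv' => hfr.2 z hz' (hv' ▸ hz.1 v hv)) fun z hz' => hP.1 z hz' v hv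
      have H' : PW (a :: (L ++ d)) (a.image h' :: (L.map (FinPlus.image h) ++ c)) h' := by
        refine ih1.cons hper (fun v hv => ih2 v (hz.1 v hv) (hper v hv) (hu.1 v hv))
          (fun _ _ => rfl) ?_
        rw [hz'.1, himg]
      refine ⟨?_, fun v hv hv' hvu x hx hxv => ?_⟩
      · rw [List.map_cons, himg]; exact H'
      · have hvL : v ∈ vr (L ++ d) := by
          rcases mem_vr_cons hv' with h1 | ⟨h1, -⟩
          · exact h1
          · exact absurd (h1 ▸ hv) hfr.1
        rcases mem_vr_cons hx with h1 | ⟨rfl, hF⟩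
        · exact ih2 v hv hvL hvu x h1 hxv
        · exfalso
          -- The new vertex is sent to the image of the face `a`, which is a face and so not an old
          -- vertex; it cannot share its image with `v`.
          refine (ih1.isFace hF).notMem_vr ?_
          rw [← himg, ← hz'.1, hxv]
          exact ih1.mem_vr hvL
  exact key.1

theorem IsFace.ofSet_mem_vr_cons {q : SetSeq Ur} {t : FinPlus Ur} (h : IsFace q t) :
    ofSet t ∈ vr (t :: q) := by
  rw [mem_vr_iff]
  refine fa_cons_intro (fun hs => ?_) (Or.inr ⟨by simp, by simpa using h.fa⟩)
  obtain ⟨x, hx⟩ := t.2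
  have := Finset.mem_singleton.mp (hs hx)
  exact notMem_self t (this ▸ hx)

theorem IsFace.mem_vr_ne {q : SetSeq Ur} {t : FinPlus Ur} (h : IsFace q t) {x : Elem Ur}
    (hx : x ∈ vr q) : x ≠ ofSet t := by
  rintro rfl
  exact h.notMem_vr hx

/-! ### The basic isomorphisms on faces and the exchange of nested divisions. -/

/-- The type 2 isomorphism for faces. -/
theorem pw_typeTwo {q : SetSeq Ur} {s t : FinPlus Ur} {f : Elem Ur → Elem Ur} (hs : IsFace q s)
    (ht : IsFace q t) (hX : f (ofSet (FinPlus.adjoin (s.1 \ t.1) t)) =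
      ofSet (FinPlus.adjoin (t.1 \ s.1) s)) (hfs : f (ofSet s) = ofSet s)
    (hft : f (ofSet t) = ofSet t) (hf : ∀ x ∈ vr q, f x = x) :
    PW (FinPlus.adjoin (s.1 \ t.1) t :: s :: t :: q) (FinPlus.adjoin (t.1 \ s.1) s :: t :: s :: q)
      f := by
  refine IsPureWeldDivision.same (.combIso (.type2 q s t (hs.notMem ht) (ht.notMem hs)
    hs.notMem_tc ht.notMem_tc)) ⟨.refl _, .refl _, fun x hx => ?_⟩
  by_cases h : x = ofSet (FinPlus.adjoin (s.1 \ t.1) t)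
  · subst h
    simp [typeTwoMap, hX]
  · simp only [typeTwoMap, Function.update_of_ne h, id]
    rcases mem_vr_of_append (L := [FinPlus.adjoin (s.1 \ t.1) t, s, t]) hx with h1 | ⟨z, hz, rfl⟩
    · exact (hf x h1).symm
    · simp only [List.mem_cons, List.not_mem_nil, or_false] at hz
      rcases hz with rfl | rfl | rfl
      · exact absurd rfl h
      · exact hfs.symm
      · exact hft.symm

/-- The type 1 isomorphism for `s = r ∪ {p}`. -/
theorem pw_typeOne {q : SetSeq Ur} {s t : FinPlus Ur} {p : Elem Ur} {f : Elem Ur → Elem Ur}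
    (ht : IsFace q t) (hp : p ∈ s.1) (hst : s.1 ⊆ t.1)
    (hft : f (ofSet t) = ofSet (FinPlus.adjoin {p} t))
    (hfR : f (ofSet (FinPlus.adjoin (s.1.erase p) t)) = ofSet t)
    (hfs : s ≠ t → f (ofSet s) = ofSet s) (hf : ∀ x ∈ vr q, f x = x) :
    PW (FinPlus.adjoin (s.1.erase p) t :: s :: t :: q) (FinPlus.adjoin {p} t :: s :: t :: q) f := by
  have hu : (s.1.erase p ∪ {p}).Nonempty := ⟨p, by simp⟩
  have hsu : (⟨s.1.erase p ∪ {p}, hu⟩ : FinPlus Ur) = s := by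
    refine Subtype.ext ?_
    ext x
    by_cases hx : x = p
    · subst hx; simp [hp]
    · simp [hx]
  have h1 := IsCombIso.type1 q (s.1.erase p) {p} t hu ((Finset.erase_subset _ _).trans hst)
    (by simpa using hst hp) (by simp) ht.notMem_tc
  have h2 : typeOneMap q (s.1.erase p) {p} t hu = ⟨FinPlus.adjoin (s.1.erase p) t :: s :: t :: q,
    FinPlus.adjoin {p} t :: s :: t :: q, fun x => if x = ofSet t then ofSet (FinPlus.adjoin {p} t)
      else if x = ofSet (FinPlus.adjoin (s.1.erase p) t) then ofSet t else x⟩ := by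
    simp only [typeOneMap, hsu]
  rw [h2] at h1
  refine IsPureWeldDivision.same (.combIso h1) ⟨.refl _, .refl _, fun x hx => ?_⟩
  by_cases h : x = ofSet t
  · subst h
    simp [hft]
  by_cases h' : x = ofSet (FinPlus.adjoin (s.1.erase p) t)
  · subst h'
    simp [hfR, h]
  simp only [h, h', if_false]
  rcases mem_vr_of_append (L := [FinPlus.adjoin (s.1.erase p) t, s, t]) hx with h1 | ⟨z, hz, rfl⟩
  · exact (hf x h1).symm
  · simp only [List.mem_cons, List.not_mem_nil, or_false] at hz
    rcases hz with rfl | rfl | rfl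
    · exact absurd rfl h'
    · exact (hfs fun h1 => h (congrArg ofSet h1)).symm
    · exact absurd rfl h

theorem adjoin_empty (r : Finset (Elem Ur)) (t : FinPlus Ur) (h : r = ∅) :
    FinPlus.adjoin r t = FinPlus.sing (ofSet t) := by
  subst h; exact Subtype.ext (by simp [adjoin_val, FinPlus.sing])

theorem IsFace.sing_notMem {q : SetSeq Ur} {w : FinPlus Ur} (hw : IsFace q w) :
    ofSet (FinPlus.sing (ofSet w)) ∉ vr q :=
  notMem_vr_of_mem (x := ofSet w) (by simp [FinPlus.sing]) hw.notMem_tc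

/-- Because `y \ w` is empty, the set that type 2 asks for is the singleton `{w}`; renaming `w` to
`{w}` provides it. In the result `w` drops out, since after division by `y` no face includes `y`. -/
theorem pw_exchange {q : SetSeq Ur} {y w : FinPlus Ur} {f : Elem Ur → Elem Ur} (hw : IsFace q w)
    (hyw : y.1 ⊆ w.1) (hne : y ≠ w) (hfw : f (ofSet w) = ofSet (FinPlus.adjoin (w.1 \ y.1) y))
    (hfy : f (ofSet y) = ofSet y) (hf : ∀ x ∈ vr q, f x = x) :
    PW (y :: w :: q) (FinPlus.adjoin (w.1 \ y.1) y :: y :: q) f := by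
  have hy := hw.mono hyw
  have e := adjoin_empty (y.1 \ w.1) w (Finset.sdiff_eq_empty_iff_subset.mpr hyw)
  set S := FinPlus.sing (ofSet w) with hS
  have hSw : ofSet S ≠ ofSet w := (ofSet_ne_of_mem (by simp [hS, FinPlus.sing])).symm
  have hSy : ofSet S ≠ ofSet y := fun h => hw.notMem hy (ofSet_injective h ▸ by
    simp [hS, FinPlus.sing])
  have hwy : ofSet y ≠ ofSet w := fun h => hne (ofSet_injective h)
  have hS0 : ofSet S ∉ vr q := hw.sing_notMem
  have hS1 : ofSet S ∉ vr (y :: w :: q) := notMem_vr_cons (notMem_vr_cons hS0 hSw) hSy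
  have h1 : PW (y :: w :: q) (S :: y :: w :: q) (Function.update id (ofSet w) (ofSet S)) :=
    pw_toSing hS1 (by simp [hS]) fun x _ h => by simp [Function.update_of_ne h]
  have h2 : PW (S :: y :: w :: q) (FinPlus.adjoin (w.1 \ y.1) y :: w :: y :: q)
      (Function.update id (ofSet S) (ofSet (FinPlus.adjoin (w.1 \ y.1) y))) := by
    rw [← e]
    refine pw_typeTwo hy hw (by simp) ?_ ?_ fun x hx => ?_
    · rw [e, Function.update_of_ne hSy.symm]; rfl
    · rw [e, Function.update_of_ne hSw.symm]; rfl
    · rw [e, Function.update_of_ne (by rintro rfl; exact hS0 hx)]; rfl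
  refine (h2.comp h1).congr (.refl _) (.cons _ (.drop _ _ fun h =>
    not_fa_cons_of_subset hyw h.fa)) fun x hx => ?_
  rcases mem_vr_of_append (L := [y, w]) hx with h1 | ⟨z, hz, rfl⟩
  · rw [hf x h1, Function.comp_apply, Function.update_of_ne (hw.mem_vr_ne h1), id,
      Function.update_of_ne (by rintro rfl; exact hS0 h1), id]
  · simp only [List.mem_cons, List.not_mem_nil, or_false] at hz
    rcases hz with rfl | rfl
    · rw [hfy, Function.comp_apply, Function.update_of_ne hwy, id, Function.update_of_ne hSy.symm, id]
    · simp [hfw]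

/-- The reverse passage: `w` is first added for free below the adjoined set, type 2 is applied with
the two sets in the other roles, and the singleton `{w}` is welded to `w`. -/
theorem pw_exchange' {q : SetSeq Ur} {y w : FinPlus Ur} {f : Elem Ur → Elem Ur} (hw : IsFace q w)
    (hyw : y.1 ⊆ w.1) (hne : y ≠ w) (hfw : f (ofSet (FinPlus.adjoin (w.1 \ y.1) y)) = ofSet w)
    (hfy : f (ofSet y) = ofSet y) (hf : ∀ x ∈ vr q, f x = x) :
    PW (FinPlus.adjoin (w.1 \ y.1) y :: y :: q) (y :: w :: q) f := by
  have hy := hw.mono hyw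
  have e := adjoin_empty (y.1 \ w.1) w (Finset.sdiff_eq_empty_iff_subset.mpr hyw)
  set S := FinPlus.sing (ofSet w) with hS
  set X := FinPlus.adjoin (w.1 \ y.1) y with hX
  have hXm : ofSet y ∈ X.1 := by simp [hX, adjoin_val]
  have hXy : ofSet X ≠ ofSet y := (ofSet_ne_of_mem hXm).symm
  have hXw : ofSet X ≠ ofSet w := fun h => hy.notMem hw (ofSet_injective h ▸ hXm)
  have hXq : ofSet X ∉ vr q := notMem_vr_of_mem hXm hy.notMem_tc
  have hSw : ofSet S ≠ ofSet w := (ofSet_ne_of_mem (by simp [hS, FinPlus.sing])).symm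
  have hSy : ofSet S ≠ ofSet y := fun h => hw.notMem hy (ofSet_injective h ▸ by
    simp [hS, FinPlus.sing])
  have hS0 : ofSet S ∉ vr q := hw.sing_notMem
  have hS1 : ofSet S ∉ vr (y :: w :: q) := notMem_vr_cons (notMem_vr_cons hS0 hSw) hSy
  have h2 : PW (S :: y :: w :: q) (y :: w :: q) (Function.update id (ofSet S) (ofSet w)) :=
    pw_weld hS1 (by simp [hS, FinPlus.sing]) fun x hx => by
      rw [Function.update_of_ne (by rintro rfl; exact hS1 hx)]; rfl
  have h1 : PW (X :: w :: y :: q) (S :: y :: w :: q) (Function.update id (ofSet X) (ofSet S)) := by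
    rw [← e]
    refine pw_typeTwo hw hy (by simp [hX]) ?_ ?_ fun x hx => ?_
    · rw [Function.update_of_ne hXw.symm]; rfl
    · rw [Function.update_of_ne hXy.symm]; rfl
    · rw [Function.update_of_ne (by rintro rfl; exact hXq hx)]; rfl
  refine (h2.comp h1).congr (.cons _ (.drop _ _ fun h =>
    not_fa_cons_of_subset hyw h.fa)) (.refl _) fun x hx => ?_
  rcases mem_vr_of_append (L := [X, w, y]) hx with h1 | ⟨z, hz, rfl⟩
  · have hX' : x ≠ ofSet X := by rintro rfl; exact hXq h1
    have hS' : x ≠ ofSet S := by rintro rfl; exact hS0 h1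
    rw [hf x h1, Function.comp_apply, Function.update_of_ne hX', id, Function.update_of_ne hS', id]
  · simp only [List.mem_cons, List.not_mem_nil, or_false] at hz
    rcases hz with rfl | rfl | rfl
    · simp [hfw]
    · exfalso
      rcases mem_vr_cons hx with h | ⟨h, -⟩
      · rcases mem_vr_cons h with h | ⟨-, h⟩
        · rcases mem_vr_cons h with h | ⟨h, -⟩
          · exact hw.notMem_vr h
          · exact hne (ofSet_injective h).symm
        · exact not_fa_cons_of_subset hyw h.fa
      · exact hXw h.symm
    · rw [hfy, Function.comp_apply, Function.update_of_ne hXy.symm, id,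
        Function.update_of_ne hSy.symm, id]

/-! ### Reordering divisions. -/

/-- The condition for interchanging two neighbours `a`, `b` over `q`. -/
def Commute (q : SetSeq Ur) (a b : FinPlus Ur) : Prop :=
  ofSet a ∉ b.1 ∧ ofSet b ∉ a.1 ∧ (¬ IsFace q (a.union b) ∨ Disjoint a.1 b.1)

theorem CombEquiv.move {P : SetSeq Ur} {a : FinPlus Ur} {q : SetSeq Ur}
    (h : ∀ P₁ b P₂, P = P₁ ++ b :: P₂ → Commute (P₂ ++ q) b a) :
    CombEquiv (P ++ a :: q) (a :: (P ++ q)) := by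
  induction P with
  | nil => exact .refl _
  | cons b P ih =>
    have h1 := ih fun P₁ c P₂ e => h (b :: P₁) c P₂ (by simp [e])
    obtain ⟨h2, h3, h4⟩ := h [] b P rfl
    exact (CombEquiv.cons b h1).trans (.swap b a _ h2 h3 h4)

theorem nodup_of_pairwise {L : SetSeq Ur} (h : L.Pairwise fun a b => ¬ b.1 ⊆ a.1) : L.Nodup :=
  h.imp fun {a b} h (e : a = b) => h (e ▸ subset_rfl)

theorem union_val (s t : FinPlus Ur) : (s.union t).1 = s.1 ∪ t.1 := rfl

/-- The division by an additive family does not depend on the enumeration. -/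
theorem CombEquiv.of_mem_iff {q : SetSeq Ur} {L₂ : SetSeq Ur} : ∀ {L₁ : SetSeq Ur},
    (∀ a, a ∈ L₁ ↔ a ∈ L₂) → (∀ a ∈ L₁, IsFace q a) →
    (∀ a ∈ L₁, ∀ b ∈ L₁, IsFace q (a.union b) → a.union b ∈ L₁) →
    (L₁.Pairwise fun a b => ¬ b.1 ⊆ a.1) → (L₂.Pairwise fun a b => ¬ b.1 ⊆ a.1) →
    CombEquiv (L₁ ++ q) (L₂ ++ q) := by
  induction L₂ with
  | nil =>
    intro L₁ h _ _ _ _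
    have : L₁ = [] := List.eq_nil_iff_forall_not_mem.mpr fun a ha => by simpa using (h a).mp ha
    subst this
    exact .refl _
  | cons a L₂ ih =>
    intro L₁ h hF hA hP₁ hP₂
    have ha : a ∈ L₁ := (h a).mpr List.mem_cons_self
    obtain ⟨P, R, rfl⟩ := List.append_of_mem ha
    have hnd := nodup_of_pairwise hP₁
    rw [List.pairwise_cons] at hP₂
    have hnd' : a ∉ P ++ R := by
      have := List.nodup_middle.mp hnd
      exact (List.nodup_cons.mp this).1
    have hmem : ∀ b, b ∈ P ++ R ↔ b ∈ L₂ := by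
      intro b
      have h1 := h b
      simp only [List.mem_append, List.mem_cons] at h1 hnd' ⊢
      constructor
      · intro hb
        refine (h1.mp (by tauto)).resolve_left ?_
        rintro rfl
        exact hnd' hb
      · intro hb
        have : b ≠ a := by rintro rfl; exact hP₂.1 b hb subset_rfl
        tauto
    have hmem' : ∀ b ∈ P ++ R, b ∈ P ++ a :: R := fun b hb => by
      simp only [List.mem_append, List.mem_cons] at hb ⊢; tauto
    have h1 : CombEquiv (P ++ R ++ q) (L₂ ++ q) := by
      refine ih hmem (fun b hb => hF b (hmem' b hb)) (fun b hb c hc hbc => ?_) ?_ hP₂.2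
      · have := hA b (hmem' b hb) c (hmem' c hc) hbc
        have hne : b.union c ≠ a := by
          intro e
          refine hP₂.1 b ((hmem b).mp hb) ?_
          rw [← e]; exact Finset.subset_union_left
        simp only [List.mem_append, List.mem_cons] at this ⊢
        tauto
      · exact hP₁.sublist (by simp)
    -- To bring `a` to the front, suppose its union with some earlier `b` were a face at that stage.
    -- By additivity the union is in the list. If it stands before `a`, at `b` or ahead of `b`,
    -- monotonicity of `L₁` fails; if it equals `a`, monotonicity of `L₂` fails; anywhere else it is
    -- already divided and is no longer a face.
    have h2 : CombEquiv (P ++ a :: (R ++ q)) (a :: (P ++ (R ++ q))) := by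
      refine CombEquiv.move fun P₁ b P₂ e => ?_
      subst e
      have hb : b ∈ P₁ ++ b :: P₂ ++ a :: R := by simp
      have hFa := hF a ha
      have hFb := hF b hb
      refine ⟨hFb.notMem hFa, hFa.notMem hFb, Or.inl fun hU => ?_⟩
      have hU' : Fa ((P₂ ++ R) ++ q) (b.1 ∪ a.1) := by
        rw [List.append_assoc]; exact hU.fa
      rw [fa_append _ fun r hr hr' => by
        have hr'' : r ∈ P₁ ++ b :: P₂ ++ a :: R := by
          simp only [List.mem_append, List.mem_cons] at hr ⊢; tauto
        rcases Finset.mem_union.mp hr' with h' | h'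
        · exact (hF r hr'').notMem hFb h'
        · exact (hF r hr'').notMem hFa h'] at hU'
      have hmemU := hA b hb a ha (isFace_iff_fa.mpr hU'.1)
      rw [List.append_assoc, List.pairwise_append] at hP₁
      simp only [List.mem_append, List.mem_cons] at hmemU
      rcases hmemU with (h3 | h3 | h3) | h3 | h3
      · exact hP₁.2.2 _ h3 b (by simp) Finset.subset_union_left
      · refine (List.pairwise_cons.mp hP₁.2.1).1 a (by simp) ?_
        rw [← congrArg Subtype.val h3]; exact Finset.subset_union_right
      · exact hU'.2 _ (List.mem_append_left _ h3) subset_rfl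
      · refine hP₂.1 b ((hmem b).mp (by simp)) ?_
        rw [← congrArg Subtype.val h3]; exact Finset.subset_union_left
      · exact hU'.2 _ (List.mem_append_right _ h3) subset_rfl
    rw [List.append_assoc] at h1
    simpa using h2.trans (CombEquiv.cons a h1)

/-! ### Collapsing families of faces. -/

theorem IsFace.append {q : SetSeq Ur} {t : FinPlus Ur} {L : SetSeq Ur} (h : IsFace q t)
    (hL : ∀ r ∈ L, IsFace q r) (h' : ∀ r ∈ L, ¬ r.1 ⊆ t.1) : IsFace (L ++ q) t :=
  isFace_iff_fa.mpr ((fa_append L fun r hr => (hL r hr).notMem h).mpr ⟨h.fa, h'⟩)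

/-- Exchanging `y` with the leftmost `w` turns `w` into `(w \ y) ∪ {y}`, a set that contains the
vertex `y` and stands outermost, so it can be welded to `y`. -/
theorem pw_collapse {q : SetSeq Ur} {y : FinPlus Ur} (hy : IsFace q y) : ∀ (W : SetSeq Ur)
    {f : Elem Ur → Elem Ur}, (∀ w ∈ W, IsFace q w) → (∀ w ∈ W, y.1 ⊆ w.1 ∧ y ≠ w) →
    (W.Pairwise fun a b => ¬ b.1 ⊆ a.1) → (∀ w ∈ W, f (ofSet w) = ofSet y) →
    f (ofSet y) = ofSet y → (∀ x ∈ vr q, f x = x) → PW (y :: (W ++ q)) (y :: q) f := by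
  intro W
  induction W with
  | nil =>
    intro f _ _ _ _ hfy hf
    refine (pw_id hy.ofSet_mem_vr_cons).congr_fun fun x hx => ?_
    rcases mem_vr_cons hx with h | ⟨rfl, -⟩
    · exact (hf x h).symm
    · exact hfy.symm
  | cons w W ih =>
    intro f hF hyW hP hfW hfy hf
    rw [List.pairwise_cons] at hP
    simp only [List.forall_mem_cons] at hF hyW hfW
    have hw : IsFace (W ++ q) w := hF.1.append hF.2 hP.1
    obtain ⟨hyw, hne⟩ := hyW.1
    have hne' : ofSet y ≠ ofSet w := fun h => hne (ofSet_injective h)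
    set w' := FinPlus.adjoin (w.1 \ y.1) y with hw'
    have hyw' : ofSet y ∈ w'.1 := by simp [hw', adjoin_val]
    have hw'q : ofSet w' ∉ vr (W ++ q) := notMem_vr_of_mem hyw' (hw.mono hyw).notMem_tc
    have hw'y : ofSet w' ≠ ofSet y := (ofSet_ne_of_mem hyw').symm
    have h1 : PW (y :: w :: (W ++ q)) (w' :: y :: (W ++ q))
        (Function.update id (ofSet w) (ofSet w')) :=
      pw_exchange hw hyw hne (by simp [hw']) (by simp [Function.update_of_ne hne'])
        fun x hx => by simp [Function.update_of_ne (hw.mem_vr_ne hx)]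
    have h2 : PW (w' :: y :: (W ++ q)) (y :: (W ++ q))
        (Function.update id (ofSet w') (ofSet y)) := by
      refine pw_weld (notMem_vr_cons hw'q hw'y) (by simpa using hyw') fun x hx => ?_
      have : x ≠ ofSet w' := by rintro rfl; exact notMem_vr_cons hw'q hw'y hx
      simp [Function.update_of_ne this]
    refine (((ih hF.2 hyW.2 hP.2 hfW.2 hfy hf).comp h2).comp h1).congr_fun fun x hx => ?_
    by_cases hxw : x = ofSet w
    · subst hxw
      simp [hfW.1, hfy]
    · have : x ≠ ofSet w' := by
        rintro rfl
        rcases mem_vr_cons hx with h | ⟨h, -⟩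
        · rcases mem_vr_cons h with h | ⟨h, -⟩
          · exact hw'q h
          · exact hxw h
        · exact hw'y h
      simp [Function.update_of_ne hxw, Function.update_of_ne this]

open Classical in
/-- The set `B ∪ {d}`. -/
noncomputable def FinPlus.ins (B : Finset (Elem Ur)) (d : Elem Ur) : FinPlus Ur :=
  ⟨insert d B, Finset.insert_nonempty _ _⟩

theorem ne_singleton {B e : Finset (Elem Ur)} (hB : B.Nonempty) (he : B ⊆ e) {d : Elem Ur}
    (hd : d ∈ e) (hdB : d ∉ B) (v : Elem Ur) : e ≠ {v} := by
  rintro rfl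
  obtain ⟨b, hb⟩ := hB
  have h1 := Finset.mem_singleton.mp (he hb)
  have h2 := Finset.mem_singleton.mp hd
  exact hdB (h2 ▸ h1 ▸ hb)

/-- The members that contain the first vertex `d` all include `B ∪ {d}` and collapse onto it. The
remaining members are made of old vertices, so they ride along by pure division, and they form a
family of the same kind over the divided sequence with one vertex `d` fewer. -/
theorem pw_star {B : Finset (Elem Ur)} (hB : B.Nonempty) : ∀ (ds : List (Elem Ur))
    {q E : SetSeq Ur}, Fa q B → ds.Nodup → (∀ d ∈ ds, d ∉ B) → (∀ e ∈ E, IsFace q e) →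
    (∀ e ∈ E, B ⊆ e.1) → (∀ e ∈ E, ∃ d ∈ ds, d ∈ e.1) → (∀ d ∈ ds, FinPlus.ins B d ∈ E) →
    (∀ a ∈ E, ∀ b ∈ E, IsFace q (a.union b) → a.union b ∈ E) →
    (E.Pairwise fun a b => ¬ b.1 ⊆ a.1) →
    ∃ f, PW (E ++ q) ((ds.map (FinPlus.ins B)).reverse ++ q) f ∧ (∀ x ∈ vr q, f x = x) ∧
      ∀ e ∈ E, ∃ d ∈ ds, f (ofSet e) = ofSet (FinPlus.ins B d) := by
  intro ds
  induction ds with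
  | nil =>
    intro q E hFB _ _ _ _ hE _ _ _
    have : E = [] := List.eq_nil_iff_forall_not_mem.mpr fun e he => by simpa using hE e he
    subst this
    obtain ⟨b, hb⟩ := hB
    exact ⟨id, pw_id (hFB.mem_vr hb), fun _ _ => rfl, by simp⟩
  | cons d ds ih =>
    intro q E hFB hnd hdB hEF hEB hEd hyE hadd hP
    simp only [List.forall_mem_cons, List.nodup_cons] at hnd hdB hyE
    set y := FinPlus.ins B d with hy
    have hyv : y.1 = insert d B := rfl
    have hyF : IsFace q y := hEF y hyE.1
    have hdy : d ∈ y.1 := by simp [hyv]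
    have hBy : B ⊆ y.1 := Finset.subset_insert _ _
    set E' := E.filter (fun e => d ∉ e.1) with hE'
    set W := E.filter (fun e => d ∈ e.1 ∧ e ≠ y) with hW
    have hmE' : ∀ e, e ∈ E' ↔ e ∈ E ∧ d ∉ e.1 := by intro e; rw [hE']; simp
    have hmW : ∀ e, e ∈ W ↔ e ∈ E ∧ d ∈ e.1 ∧ e ≠ y := by intro e; rw [hW]; simp
    have hyW : ∀ w ∈ W, y.1 ⊆ w.1 ∧ y ≠ w := fun w hw => by
      obtain ⟨h1, h2, h3⟩ := (hmW w).mp hw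
      exact ⟨Finset.insert_subset h2 (hEB w h1), h3.symm⟩
    -- Members without `d` may be moved to the left, as none of them can include a member with `d`.
    have hequiv : CombEquiv (E ++ q) (E' ++ (y :: (W ++ q))) := by
      have := CombEquiv.of_mem_iff (q := q) (L₁ := E) (L₂ := E' ++ y :: W) (fun a => ?_) hEF hadd hP
        ?_
      · simpa using this
      · simp only [List.mem_append, List.mem_cons, hmE', hmW]
        constructor
        · tauto
        · rintro (h | rfl | h)
          · exact h.1
          · exact hyE.1
          · exact h.1
      · rw [List.pairwise_append, List.pairwise_cons]
        refine ⟨hP.sublist List.filter_sublist, ⟨fun w hw h => ?_, hP.sublist List.filter_sublist⟩,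
          fun a ha b hb h => ?_⟩
        · exact (hyW w hw).2 (Subtype.ext ((hyW w hw).1.antisymm h))
        · refine ((hmE' a).mp ha).2 (h ?_)
          rcases List.mem_cons.mp hb with rfl | hb
          · exact hdy
          · exact ((hmW b).mp hb).2.1
    set h : Elem Ur → Elem Ur := fun x => if ∃ w ∈ W, x = ofSet w then ofSet y else x with hh
    have hW' : ∀ w ∈ W, h (ofSet w) = ofSet y := fun w hw => if_pos ⟨w, hw, rfl⟩
    have hn : ∀ x, (∀ w ∈ W, x ≠ ofSet w) → h x = x := fun x hx =>
      if_neg fun ⟨w, hw, e⟩ => hx w hw e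
    have hhy : h (ofSet y) = ofSet y := hn _ fun w hw e => (hyW w hw).2 (ofSet_injective e)
    have hhq : ∀ x ∈ vr q, h x = x := fun x hx => hn _ fun w hw =>
      (hEF w ((hmW w).mp hw).1).mem_vr_ne hx
    have hhE : ∀ e ∈ E', h (ofSet e) = ofSet e := fun e he => hn _ fun w hw e' =>
      ((hmE' e).mp he).2 (ofSet_injective e' ▸ ((hmW w).mp hw).2.1)
    have hWF : ∀ w ∈ W, IsFace q w := fun w hw => hEF w ((hmW w).mp hw).1
    have hE'F : ∀ e ∈ E', IsFace q e := fun e he => hEF e ((hmE' e).mp he).1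
    have h1 : PW (y :: (W ++ q)) (y :: q) h := pw_collapse hyF W hWF hyW
      (hP.sublist List.filter_sublist) hW' hhy hhq
    have himg : ∀ e ∈ E', e.image h = e := fun e he => Subtype.ext (by
      rw [image_val, Finset.image_congr (g := id) fun x hx => hhq x ((hE'F e he).mem_vr hx),
        Finset.image_id])
    have hv : ∀ v ∈ vr (y :: (W ++ q)), v ∈ vr q ∨ ∃ z ∈ y :: W, v = ofSet z := fun v hv =>
      mem_vr_of_append (L := y :: W) hv
    -- The collapse identifies only new vertices, whereas the members of `E'` consist of vertices of
    -- `q`; hence this division is pure.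
    have h2 : PW (E' ++ y :: (W ++ q)) (E'.map (FinPlus.image h) ++ y :: q) h := by
      refine h1.append E' (fun z hz v hvz => ?_) (fun z hz hzv => ?_) (fun z hz v hvz x hx hxv => ?_)
        ?_ (fun _ _ => rfl) fun z hz => by rw [himg z hz, hhE z hz]
      · refine mem_vr_append (y :: W) ((hE'F z hz).mem_vr hvz) ?_ ?_
        · rw [List.forall_mem_cons]
          exact ⟨hyF.mem_vr_ne ((hE'F z hz).mem_vr hvz), fun w hw =>
            (hWF w hw).mem_vr_ne ((hE'F z hz).mem_vr hvz)⟩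
        · rw [List.forall_mem_cons]
          exact ⟨ne_singleton hB hBy hdy hdB.1 v, fun w hw =>
            ne_singleton hB (hBy.trans (hyW w hw).1) ((hyW w hw).1 hdy) hdB.1 v⟩
      · rcases hv _ hzv with h | ⟨w, hw, e⟩
        · exact (hE'F z hz).notMem_vr h
        · have := ofSet_injective e
          subst this
          rcases List.mem_cons.mp hw with rfl | hw
          · exact ((hmE' _).mp hz).2 hdy
          · exact ((hmE' _).mp hz).2 ((hmW _).mp hw).2.1
      · have hvq := (hE'F z hz).mem_vr hvz
        rw [hhq v hvq] at hxv
        rcases hv x hx with hx | ⟨w, hw, rfl⟩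
        · rwa [hhq x hx] at hxv
        · exfalso
          have : h (ofSet w) = ofSet y := by
            rcases List.mem_cons.mp hw with rfl | hw
            · exact hhy
            · exact hW' w hw
          rw [this] at hxv
          exact hyF.notMem_vr (hxv ▸ hvq)
      · refine List.Pairwise.imp_of_mem (R := fun _ _ => True) ?_ (List.pairwise_of_forall
          fun _ _ => trivial)
        intro a b ha hb _ v hva
        obtain ⟨d', hd', hd'b⟩ := hEd b ((hmE' b).mp hb).1
        refine ne_singleton hB (hEB b ((hmE' b).mp hb).1) hd'b ?_ v
        rcases List.mem_cons.mp hd' with rfl | hd'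
        · exact hdB.1
        · exact hdB.2 d' hd'
    rw [List.map_congr_left himg, List.map_id'] at h2
    have hyF' : ∀ e ∈ E', ¬ y.1 ⊆ e.1 := fun e he h => ((hmE' e).mp he).2 (h hdy)
    obtain ⟨f, hf1, hf2, hf3⟩ : ∃ f, PW (E' ++ y :: q) ((ds.map (FinPlus.ins B)).reverse ++ y :: q) f ∧
        (∀ x ∈ vr (y :: q), f x = x) ∧
        ∀ e ∈ E', ∃ d ∈ ds, f (ofSet e) = ofSet (FinPlus.ins B d) := by
      refine ih (fa_cons_intro (fun h => hdB.1 (h hdy)) (Or.inl hFB)) hnd.2 hdB.2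
        (fun e he => ⟨fun h => hyF' e he h.2, Or.inl (hE'F e he)⟩)
        (fun e he => hEB e ((hmE' e).mp he).1) (fun e he => ?_) (fun d' hd' => ?_)
        (fun a ha b hb hab => ?_) (hP.sublist List.filter_sublist)
      · obtain ⟨d', hd', hd'e⟩ := hEd e ((hmE' e).mp he).1
        rcases List.mem_cons.mp hd' with rfl | hd'
        · exact absurd hd'e ((hmE' e).mp he).2
        · exact ⟨d', hd', hd'e⟩
      · refine (hmE' _).mpr ⟨hyE.2 d' hd', fun h => ?_⟩
        rcases Finset.mem_insert.mp h with rfl | h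
        · exact hnd.1 hd'
        · exact hdB.1 h
      · obtain ⟨ha1, ha2⟩ := (hmE' a).mp ha
        obtain ⟨hb1, hb2⟩ := (hmE' b).mp hb
        have hdU : d ∉ (a.union b).1 := by simp [union_val, ha2, hb2]
        refine (hmE' _).mpr ⟨hadd a ha1 b hb1 ?_, hdU⟩
        rcases hab.2 with h | ⟨h, -⟩
        · exact h
        · exfalso
          rcases Finset.mem_union.mp h with h | h
          · exact hyF.notMem (hE'F a ha) h
          · exact hyF.notMem (hE'F b hb) h
    refine ⟨f ∘ h, ?_, fun x hx => ?_, fun e he => ?_⟩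
    · have e : ((d :: ds).map (FinPlus.ins B)).reverse ++ q =
          (ds.map (FinPlus.ins B)).reverse ++ y :: q := by simp [hy]
      rw [e]
      exact (hf1.comp h2).congr hequiv.symm (.refl _) fun _ _ => rfl
    · rw [Function.comp_apply, hhq x hx]
      refine hf2 x ?_
      refine mem_vr_append [y] hx (by simpa using hyF.mem_vr_ne hx) ?_
      simpa using ne_singleton hB hBy hdy hdB.1 x
    · by_cases hde : d ∈ e.1
      · refine ⟨d, List.mem_cons_self, ?_⟩
        have : h (ofSet e) = ofSet y := by
          by_cases hey : e = y
          · rw [hey, hhy]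
          · exact hW' e ((hmW e).mpr ⟨he, hde, hey⟩)
        rw [Function.comp_apply, this]
        exact hf2 _ hyF.ofSet_mem_vr_cons
      · have he' := (hmE' e).mpr ⟨he, hde⟩
        obtain ⟨d', hd', hfe⟩ := hf3 e he'
        refine ⟨d', List.mem_cons_of_mem _ hd', ?_⟩
        rw [Function.comp_apply, hhE e he', hfe]

theorem image_eq_self {f : Elem Ur → Elem Ur} {z : FinPlus Ur} (h : ∀ x ∈ z.1, f x = x) :
    z.image f = z :=
  Subtype.ext ((Finset.image_congr (g := id) h).trans Finset.image_id)

/-- Only the division by `{x}` can remove the vertex `x`; freshness plays no role. -/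
theorem mem_vr_append_of_ne {q : SetSeq Ur} {x : Elem Ur} (L : SetSeq Ur) (hx : x ∈ vr q)
    (h : ∀ z ∈ L, z.1 ≠ {x}) : x ∈ vr (L ++ q) := by
  induction L with
  | nil => exact hx
  | cons a L ih =>
    have := ih fun z hz => h z (List.mem_cons_of_mem _ hz)
    rw [mem_vr_iff] at this ⊢
    exact fa_cons_intro (fun h' => h a List.mem_cons_self
      ((Finset.subset_singleton_iff.mp h').resolve_left a.2.ne_empty)) (Or.inl this)

/-! ### Carrying the division by one set across the divisions by `T`. -/

/-- The function that sends `a` to `a'`, `b` to `b'` and fixes everything else. -/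
noncomputable def move₂ (a a' b b' : Elem Ur) (x : Elem Ur) : Elem Ur :=
  if x = a then a' else if x = b then b' else x

theorem move₂_left (a a' b b' : Elem Ur) : move₂ a a' b b' a = a' := if_pos rfl

theorem move₂_right {a a' b b' : Elem Ur} (h : b ≠ a) : move₂ a a' b b' b = b' := by
  simp [move₂, h]

theorem move₂_of_ne {a a' b b' x : Elem Ur} (h : x ≠ a) (h' : x ≠ b) : move₂ a a' b b' x = x := by
  simp [move₂, h, h']

/-- Lifting a map that moves only two vertices under sets not containing them. -/
theorem PW.append_move₂ {d c : SetSeq Ur} {a a' b b' : Elem Ur} (H : PW d c (move₂ a a' b b'))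
    (hba : b ≠ a) (L : SetSeq Ur) (hz : ∀ z ∈ L, ∀ v ∈ z.1, v ∈ vr d ∧ v ≠ a ∧ v ≠ b ∧ v ≠ a' ∧ v ≠ b')
    (hfr : ∀ z ∈ L, ofSet z ∉ vr d ∧ ofSet z ≠ a ∧ ofSet z ≠ b) (hs : ∀ z ∈ L, ∀ v, z.1 ≠ {v}) :
    PW (L ++ d) (L ++ c) (move₂ a a' b b') := by
  have himg : ∀ z ∈ L, z.image (move₂ a a' b b') = z := fun z h => image_eq_self fun x hx =>
    move₂_of_ne (hz z h x hx).2.1 (hz z h x hx).2.2.1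
  have h := H.append L (fun z h v hv => (hz z h v hv).1) (fun z h => (hfr z h).1)
    (fun z h v hv x _ hxv => ?_) ?_ (fun _ _ => rfl) fun z h => by
      rw [himg z h, move₂_of_ne (hfr z h).2.1 (hfr z h).2.2]
  · rwa [List.map_congr_left himg, List.map_id'] at h
  · obtain ⟨-, h1, h2, h3, h4⟩ := hz z h v hv
    rw [move₂_of_ne h1 h2] at hxv
    by_cases hxa : x = a
    · subst hxa
      rw [move₂_left] at hxv
      exact absurd hxv.symm h3
    by_cases hxb : x = b
    · subst hxb
      rw [move₂_right hba] at hxv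
      exact absurd hxv.symm h4
    · rwa [move₂_of_ne hxa hxb] at hxv
  · exact List.Pairwise.imp_of_mem (R := fun _ _ => True) (fun {a b} _ hb _ v _ => hs b hb v)
      (List.pairwise_of_forall fun _ _ => trivial)

/-- The set `(t \ s) ∪ {p, s}`. -/
noncomputable def FinPlus.refold (p : Elem Ur) (s t : FinPlus Ur) : FinPlus Ur :=
  FinPlus.ins (FinPlus.adjoin (t.1 \ s.1) s).1 p

theorem mem_refold {p x : Elem Ur} {s t : FinPlus Ur} :
    x ∈ (FinPlus.refold p s t).1 ↔ x = p ∨ x = ofSet s ∨ (x ∈ t.1 ∧ x ∉ s.1) := by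
  simp [FinPlus.refold, FinPlus.ins, adjoin_val]

theorem mem_adjoin {x : Elem Ur} {r : Finset (Elem Ur)} {s : FinPlus Ur} :
    x ∈ (FinPlus.adjoin r s).1 ↔ x = ofSet s ∨ x ∈ r := by simp [adjoin_val]

/-- The isomorphism used when `s ∩ t = {p}`. -/
theorem pw_column_inter {q : SetSeq Ur} {s t : FinPlus Ur} {p : Elem Ur} (hs : IsFace q s)
    (ht : IsFace q t) (hst : s.1 ∩ t.1 = {p}) :
    PW (FinPlus.adjoin (s.1.erase p) t :: s :: t :: q) (FinPlus.adjoin (t.1 \ s.1) s :: t :: s :: q)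
      (move₂ (ofSet (FinPlus.adjoin (s.1.erase p) t)) (ofSet (FinPlus.adjoin (t.1 \ s.1) s))
        (ofSet t) (ofSet t)) := by
  have e : s.1.erase p = s.1 \ t.1 := by
    ext x
    have := Finset.ext_iff.mp hst x
    simp only [Finset.mem_inter, Finset.mem_singleton] at this
    simp only [Finset.mem_erase, Finset.mem_sdiff]
    tauto
  rw [e]
  have hXm : ofSet t ∈ (FinPlus.adjoin (s.1 \ t.1) t).1 := by simp [adjoin_val]
  have h1 : ofSet s ≠ ofSet (FinPlus.adjoin (s.1 \ t.1) t) := fun h =>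
    ht.notMem hs (ofSet_injective h ▸ hXm)
  have h2 : ofSet t ≠ ofSet (FinPlus.adjoin (s.1 \ t.1) t) := ofSet_ne_of_mem hXm
  refine pw_typeTwo hs ht (move₂_left _ _ _ _) ?_ (move₂_right h2) fun x hx => ?_
  · by_cases h : ofSet s = ofSet t
    · rw [h, move₂_right h2]
    · exact move₂_of_ne h1 h
  · refine move₂_of_ne ?_ (ht.mem_vr_ne hx)
    rintro rfl
    exact notMem_vr_of_mem hXm ht.notMem_tc hx

/-- The isomorphism used when `s ⊂ t`. -/
theorem pw_column_subset {q : SetSeq Ur} {s t : FinPlus Ur} {p : Elem Ur} (ht : IsFace q t)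
    (hst : s.1 ⊆ t.1) (hne : s ≠ t) (hp : p ∈ s.1) (hsp : s.1 ≠ {p}) :
    PW (FinPlus.adjoin (s.1.erase p) t :: s :: t :: q)
      (FinPlus.adjoin (t.1 \ s.1) s :: FinPlus.refold p s t :: s :: q)
      (move₂ (ofSet (FinPlus.adjoin (s.1.erase p) t)) (ofSet (FinPlus.adjoin (t.1 \ s.1) s))
        (ofSet t) (ofSet (FinPlus.refold p s t))) := by
  have hs := ht.mono hst
  set y := FinPlus.adjoin (s.1.erase p) t with hy
  set g := FinPlus.adjoin (t.1 \ s.1) s with hg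
  set w := FinPlus.refold p s t with hw
  set u := FinPlus.adjoin {p} t with hu
  set k := FinPlus.adjoin {p} g with hk
  have hty : ofSet t ∈ y.1 := mem_adjoin.mpr (Or.inl rfl)
  have htu : ofSet t ∈ u.1 := mem_adjoin.mpr (Or.inl rfl)
  have hsg : ofSet s ∈ g.1 := mem_adjoin.mpr (Or.inl rfl)
  have hgk : ofSet g ∈ k.1 := mem_adjoin.mpr (Or.inl rfl)
  have hpq : p ∈ vr q := hs.mem_vr hp
  have hne' : ofSet s ≠ ofSet t := fun h => hne (ofSet_injective h)
  have hyt : ofSet t ≠ ofSet y := ofSet_ne_of_mem hty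
  have hut : ofSet t ≠ ofSet u := ofSet_ne_of_mem htu
  have hgs : ofSet s ≠ ofSet g := ofSet_ne_of_mem hsg
  have hkg : ofSet g ≠ ofSet k := ofSet_ne_of_mem hgk
  have hys : ofSet s ≠ ofSet y := fun h => ht.notMem hs (ofSet_injective h ▸ hty)
  have hus : ofSet s ≠ ofSet u := fun h => ht.notMem hs (ofSet_injective h ▸ htu)
  have hgt : ofSet t ≠ ofSet g := fun h => hs.notMem ht (ofSet_injective h ▸ hsg)
  have hyq : ofSet y ∉ vr q := notMem_vr_of_mem hty ht.notMem_tc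
  have huq : ofSet u ∉ vr q := notMem_vr_of_mem htu ht.notMem_tc
  have hgq : ofSet g ∉ vr q := notMem_vr_of_mem hsg hs.notMem_tc
  have hgtc : ofSet g ∉ tc (vr q) := fun h => hs.notMem_tc (tc_of_isMem h (isMem_ofSet.mpr hsg))
  have hkq : ofSet k ∉ vr q := notMem_vr_of_mem hgk hgtc
  have hks : ofSet s ≠ ofSet k := fun h => by
    have : ofSet g ∈ s.1 := ofSet_injective h ▸ hgk
    exact hgq (hs.mem_vr this)
  have hpt : p ∈ t.1 := hst hp
  have hsx : ∀ x, s.1 ≠ {x} := by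
    rintro x hx
    rw [hx, Finset.mem_singleton] at hp
    exact hsp (hp ▸ hx)
  have htx : ∀ x, t.1 ≠ {x} := by
    rintro x hx
    exact hsx x ((Finset.subset_singleton_iff.mp (hx ▸ hst)).resolve_left s.2.ne_empty)
  -- Type 2 does not apply directly, because `s \ t` is empty. Type 1, with `r = s \ {p}` and `{p}`
  -- as the other part, trades `y` for `u = {p, t}`.
  have A : PW (y :: s :: t :: q) (u :: s :: t :: q) (move₂ (ofSet t) (ofSet u) (ofSet y) (ofSet t)) :=
    pw_typeOne ht hp hst (move₂_left _ _ _ _) (move₂_right hyt.symm)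
      (fun _ => move₂_of_ne hne' hys) fun x hx => move₂_of_ne (ht.mem_vr_ne hx) (by
        rintro rfl; exact hyq hx)
  have hvs : ∀ x ∈ vr (s :: t :: q), x ∈ vr q ∨ x = ofSet s ∨ x = ofSet t := by
    intro x hx
    rcases mem_vr_of_append (L := [s, t]) hx with h | ⟨z, hz, rfl⟩
    · exact Or.inl h
    · simp only [List.mem_cons, List.not_mem_nil, or_false] at hz
      rcases hz with rfl | rfl <;> simp
  -- Exchanging `s` and `t` replaces the vertex `t` by `g`. The division by `u` is pure over this
  -- map and becomes the division by `k = {p, g}`.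
  have B0 : PW (s :: t :: q) (g :: s :: q) (move₂ (ofSet t) (ofSet g) (ofSet u) (ofSet k)) :=
    pw_exchange ht hst hne (move₂_left _ _ _ _) (move₂_of_ne hne' hus) fun x hx =>
      move₂_of_ne (ht.mem_vr_ne hx) (by rintro rfl; exact huq hx)
  have hBp : move₂ (ofSet t) (ofSet g) (ofSet u) (ofSet k) p = p :=
    move₂_of_ne (ht.mem_vr_ne hpq) fun h => huq (h ▸ hpq)
  have himg : u.image (move₂ (ofSet t) (ofSet g) (ofSet u) (ofSet k)) = k := by
    refine Subtype.ext ?_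
    rw [image_val, hu, hk, adjoin_val, adjoin_val, Finset.image_insert, Finset.image_singleton,
      move₂_left, hBp]
  have B : PW (u :: s :: t :: q) (k :: g :: s :: q)
      (move₂ (ofSet t) (ofSet g) (ofSet u) (ofSet k)) := by
    have := B0.cons (z := u) (h' := move₂ (ofSet t) (ofSet g) (ofSet u) (ofSet k))
      (fun v hv => ?_) (fun v hv x hx hxv => ?_) (fun _ _ => rfl) ?_
    · rwa [himg] at this
    · rcases mem_adjoin.mp hv with rfl | hv
      · exact mem_vr_append_of_ne [s] ht.ofSet_mem_vr_cons (by simpa using hsx _)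
      · rw [Finset.mem_singleton.mp hv]
        exact mem_vr_append_of_ne [s, t] hpq (by simp [hsx, htx])
    · have hx' : x ≠ ofSet t → move₂ (ofSet t) (ofSet g) (ofSet u) (ofSet k) x = x := by
        intro h
        refine move₂_of_ne h ?_
        rintro rfl
        rcases hvs _ hx with h | h | h
        · exact huq h
        · exact hus h.symm
        · exact hut h.symm
      rcases mem_adjoin.mp hv with rfl | hv
      · by_contra h
        rw [hx' h, move₂_left] at hxv
        subst hxv
        rcases hvs _ hx with h | h | h
        · exact hgq h
        · exact hgs h.symm
        · exact hgt h.symm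
      · rw [Finset.mem_singleton.mp hv, hBp] at hxv
        rw [Finset.mem_singleton.mp hv]
        by_cases h : x = ofSet t
        · rw [h, move₂_left] at hxv
          exact absurd (hxv ▸ hpq) hgq
        · rwa [hx' h] at hxv
    · rw [himg, move₂_right hut.symm]
  have hpg : p ∉ g.1 := fun h => by
    rcases mem_adjoin.mp h with h | h
    · exact hs.mem_vr_ne hpq h
    · exact (Finset.mem_sdiff.mp h).2 hp
  have hwv : w.1 = insert p g.1 := rfl
  have hwg : w.1 \ g.1 = {p} := by
    rw [hwv, Finset.insert_sdiff_of_notMem _ hpg, Finset.sdiff_self]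
    rfl
  have hgw : g ≠ w := fun h => hpg (by rw [h]; exact mem_refold.mpr (Or.inl rfl))
  have hwF : IsFace (s :: q) w := by
    refine Fa.isFace (fa_cons_intro (fun h => hsp ?_) (Or.inr ⟨mem_refold.mpr (by simp), ?_⟩))
    · refine Finset.Subset.antisymm (fun x hx => ?_) (by simpa using hp)
      rcases mem_refold.mp (h hx) with h | h | h
      · simp [h]
      · exact absurd (h ▸ hx) (notMem_self s)
      · exact absurd hx h.2
    · refine ht.fa.mono (Finset.union_subset (fun x hx => ?_) hst)
      obtain ⟨h1, h2⟩ := Finset.mem_erase.mp hx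
      rcases mem_refold.mp h2 with h | h | h
      · exact h ▸ hpt
      · exact absurd h h1
      · exact h.1
  -- With `w = g ∪ {p}` one has `w \ g = {p}`, so `k` is exactly the adjoined set in the reverse
  -- exchange of `g` and `w`.
  have C : PW (k :: g :: s :: q) (g :: w :: s :: q) (Function.update id (ofSet k) (ofSet w)) := by
    have e : FinPlus.adjoin (w.1 \ g.1) g = k := by rw [hwg]
    have := pw_exchange' (y := g) (f := Function.update id (ofSet k) (ofSet w)) hwF
      (Finset.subset_insert _ _) hgw (by rw [e, Function.update_self]) ?_ fun x hx => ?_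
    · rwa [e] at this
    · rw [Function.update_of_ne hkg]; rfl
    · rw [Function.update_of_ne (by rintro rfl; exact notMem_vr_cons hkq hks.symm hx)]
      rfl
  refine ((C.comp B).comp A).congr_fun fun x hx => ?_
  rcases mem_vr_of_append (L := [y, s, t]) hx with h1 | ⟨z, hz, rfl⟩
  · have hxt := ht.mem_vr_ne h1
    have hxy : x ≠ ofSet y := by rintro rfl; exact hyq h1
    have hxu : x ≠ ofSet u := by rintro rfl; exact huq h1
    have hxk : x ≠ ofSet k := by rintro rfl; exact hkq h1
    simp only [Function.comp_apply]
    rw [move₂_of_ne hxt hxy, move₂_of_ne hxt hxu, Function.update_of_ne hxk, move₂_of_ne hxy hxt]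
    rfl
  · simp only [List.mem_cons, List.not_mem_nil, or_false] at hz
    simp only [Function.comp_apply]
    rcases hz with rfl | rfl | rfl
    · rw [move₂_right hyt.symm, move₂_left, Function.update_of_ne hkg, move₂_left]
      rfl
    · rw [move₂_of_ne hne' hys, move₂_of_ne hne' hus, Function.update_of_ne hks,
        move₂_of_ne hys hne']
      rfl
    · rw [move₂_left, move₂_right hut.symm, Function.update_self, move₂_right hyt]

/-- The sets that replace the division by `s` above a division by `T`. -/
noncomputable def colY (q : SetSeq Ur) (p : Elem Ur) (s : FinPlus Ur) : SetSeq Ur → SetSeq Ur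
  | [] => []
  | t :: T => colY q p s T ++
      if IsFace (T ++ q) (s.union t) then [FinPlus.adjoin (s.1.erase p) t] else []

/-- The set that replaces `t` after a division by `s`. -/
noncomputable def colT (p : Elem Ur) (s t : FinPlus Ur) : FinPlus Ur :=
  if s.1 ⊆ t.1 then FinPlus.refold p s t else t

/-- The situation in which a division by `s` is moved across a division by `T`. -/
structure ColHyp (q : SetSeq Ur) (p : Elem Ur) (s : FinPlus Ur) (T : SetSeq Ur) : Prop where
  hs : IsFace q s
  hps : p ∈ s.1
  hsp : s.1 ≠ {p}
  hT : ∀ t ∈ T, IsFace q t ∧ p ∈ t.1 ∧ t.1 ≠ {p}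
  hP : T.Pairwise fun a b => ¬ b.1 ⊆ a.1
  tri : ∀ T₀ t T₁, T = T₀ ++ t :: T₁ → IsFace (T₁ ++ q) (s.union t) →
    s.1 ⊆ t.1 ∨ s.1 ∩ t.1 = {p}

theorem ColHyp.tail {q : SetSeq Ur} {p : Elem Ur} {s t : FinPlus Ur} {T : SetSeq Ur}
    (h : ColHyp q p s (t :: T)) : ColHyp q p s T :=
  ⟨h.hs, h.hps, h.hsp, fun a ha => h.hT a (List.mem_cons_of_mem _ ha), (List.pairwise_cons.mp h.hP).2,
    fun T₀ a T₁ e => h.tri (t :: T₀) a T₁ (by simp [e])⟩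

/-- The sets `z` that may stand to the left of the divisions by `s` and `T`. -/
structure ColZ (q : SetSeq Ur) (p : Elem Ur) (s : FinPlus Ur) (T : SetSeq Ur) (z : FinPlus Ur) :
    Prop where
  hp : p ∈ z.1
  hzp : z.1 ≠ {p}
  hv : ∀ v ∈ z.1, v ∈ vr q ∨ v = ofSet s
  hsz : ofSet s ∈ z.1 → IsFace (T ++ q) s
  hz : ofSet z ∉ vr q
  hzs : z ≠ s
  hzT : z ∉ T

theorem mem_colY {q : SetSeq Ur} {p : Elem Ur} {s y : FinPlus Ur} {T : SetSeq Ur}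
    (h : y ∈ colY q p s T) : ∃ t ∈ T, y = FinPlus.adjoin (s.1.erase p) t := by
  induction T with
  | nil => simp [colY] at h
  | cons t T ih =>
    rw [colY, List.mem_append] at h
    rcases h with h | h
    · obtain ⟨t', h1, h2⟩ := ih h
      exact ⟨t', List.mem_cons_of_mem _ h1, h2⟩
    · split_ifs at h
      · exact ⟨t, List.mem_cons_self, List.mem_singleton.mp h⟩
      · simp at h

theorem IsFace.of_append {q : SetSeq Ur} {L : SetSeq Ur} {t : FinPlus Ur} (h : IsFace (L ++ q) t)
    (hL : ∀ r ∈ L, ofSet r ∉ t.1) : IsFace q t ∧ ∀ r ∈ L, ¬ r.1 ⊆ t.1 := by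
  obtain ⟨h1, h2⟩ := (fa_append L hL).mp h.fa
  exact ⟨h1.isFace, h2⟩

theorem notMem_of_vr {q : SetSeq Ur} {t : FinPlus Ur} {x : Elem Ur} (ht : IsFace q t)
    (hx : x ∉ vr q) : x ∉ t.1 := fun h => hx (ht.mem_vr h)

/-- The map that removes one set `y` from above `s t q`, under a list `L` of further divisions. -/
theorem pw_column_lift {q : SetSeq Ur} {s t y g w : FinPlus Ur} {L : SetSeq Ur}
    (H : PW (y :: s :: t :: q) (g :: w :: s :: q) (move₂ (ofSet y) (ofSet g) (ofSet t) (ofSet w)))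
    (hty : ofSet t ≠ ofSet y) (hsg : ofSet s ∈ g.1) (hwg : ofSet w ≠ ofSet g)
    (hgq : ofSet g ∉ vr q) (hgy : ofSet g ≠ ofSet y) (hgt : ofSet g ≠ ofSet t)
    (hv : ∀ z ∈ L, ∀ v ∈ z.1, v ∈ vr (y :: s :: t :: q) ∧ v ≠ ofSet y ∧ v ≠ ofSet t ∧
      v ≠ ofSet g ∧ v ≠ ofSet w)
    (hz : ∀ z ∈ L, ofSet z ∉ vr (y :: s :: t :: q) ∧ ofSet z ≠ ofSet y ∧ ofSet z ≠ ofSet t)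
    (hzg : ∀ z ∈ L, ofSet z ≠ ofSet g) (hz1 : ∀ z ∈ L, ∀ v, z.1 ≠ {v})
    (hzg' : ∀ z ∈ L, ofSet z ∉ g.1) (hzw' : ∀ z ∈ L, ofSet z ∉ w.1)
    (hd : ∀ z ∈ L, w.1 ⊆ z.1 ∪ g.1 ∨ Disjoint z.1 g.1) :
    PW (L ++ y :: s :: t :: q) (L ++ w :: s :: q)
      (move₂ (ofSet y) (ofSet s) (ofSet t) (ofSet w)) := by
  have hgs : ofSet g ≠ ofSet s := (ofSet_ne_of_mem hsg).symm
  have h1 := H.append_move₂ hty L hv hz hz1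
  -- The auxiliary set `g` is brought to the front, where it can be welded to its element `s`. It
  -- passes a set of `L` either because their union includes `w`, which is already divided, or
  -- because the two are disjoint.
  have h2 : CombEquiv (L ++ g :: (w :: s :: q)) (g :: (L ++ w :: s :: q)) := by
    refine CombEquiv.move fun P₁ b P₂ e => ?_
    have hb : b ∈ L := by simp [e]
    have hP₂ : ∀ r ∈ P₂, r ∈ L := fun r hr => by simp [e, hr]
    refine ⟨hzg' b hb, fun h => (hv b hb _ h).2.2.2.1 rfl, ?_⟩
    rcases hd b hb with h | h
    · refine Or.inl fun hF => ?_
      have hF' : Fa (P₂ ++ w :: s :: q) w.1 := hF.fa.mono h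
      rw [fa_append P₂ fun r hr => hzw' r (hP₂ r hr)] at hF'
      exact not_fa_cons_of_subset subset_rfl hF'.1
    · exact Or.inr h
  have hgL : ofSet g ∉ vr (L ++ w :: s :: q) :=
    notMem_vr_append (notMem_vr_cons (notMem_vr_cons hgq hgs) hwg.symm) fun z h => (hzg z h).symm
  have h3 : PW (g :: (L ++ w :: s :: q)) (L ++ w :: s :: q)
      (Function.update id (ofSet g) (ofSet s)) :=
    pw_weld hgL (by simpa using hsg) fun x hx => by
      rw [Function.update_of_ne (by rintro rfl; exact hgL hx)]; rfl
  refine (h3.comp (h1.congr (.refl _) h2 fun _ _ => rfl)).congr_fun fun x hx => ?_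
  simp only [Function.comp_apply]
  by_cases hxy : x = ofSet y
  · subst hxy
    rw [move₂_left, move₂_left, Function.update_self]
  by_cases hxt : x = ofSet t
  · subst hxt
    rw [move₂_right hty, move₂_right hty, Function.update_of_ne hwg]; rfl
  · rw [move₂_of_ne hxy hxt, move₂_of_ne hxy hxt, Function.update_of_ne]
    · rfl
    · rintro rfl
      refine notMem_vr_append ?_ (fun z h => (hzg z h).symm) hx
      exact notMem_vr_cons (notMem_vr_cons (notMem_vr_cons hgq hgt) hgs) hgy

/-- Facts about the sets standing to the left of `s t`. -/
theorem ColHyp.left_facts {q : SetSeq Ur} {p : Elem Ur} {s t w : FinPlus Ur} {Z T : SetSeq Ur}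
    (H : ColHyp q p s (t :: T)) (hZ : ∀ z ∈ Z, ColZ q p s (t :: T) z)
    (hU : IsFace (T ++ q) (s.union t)) (hw1 : ∀ x ∈ w.1, x = ofSet s ∨ x ∈ t.1)
    (hw2 : ∀ x ∈ w.1, x = p ∨ x ∈ (FinPlus.adjoin (t.1 \ s.1) s).1)
    (hw3 : ofSet s ∈ w.1 ∨ w = t) (hw4 : ∀ x ∈ w.1, x ∈ s.1 → x = p)
    {z : FinPlus Ur} (hz : z ∈ Z ++ colY q p s T) :
    (∀ v ∈ z.1, v ∈ vr (FinPlus.adjoin (s.1.erase p) t :: s :: t :: (T ++ q)) ∧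
      v ≠ ofSet (FinPlus.adjoin (s.1.erase p) t) ∧ v ≠ ofSet t ∧
      v ≠ ofSet (FinPlus.adjoin (t.1 \ s.1) s) ∧ v ≠ ofSet w) ∧
    (ofSet z ∉ vr (FinPlus.adjoin (s.1.erase p) t :: s :: t :: (T ++ q)) ∧
      ofSet z ≠ ofSet (FinPlus.adjoin (s.1.erase p) t) ∧ ofSet z ≠ ofSet t) ∧
    ofSet z ≠ ofSet (FinPlus.adjoin (t.1 \ s.1) s) ∧ (∀ v, z.1 ≠ {v}) ∧
    ofSet z ∉ (FinPlus.adjoin (t.1 \ s.1) s).1 ∧ ofSet z ∉ w.1 ∧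
    (w.1 ⊆ z.1 ∪ (FinPlus.adjoin (t.1 \ s.1) s).1 ∨
      Disjoint z.1 (FinPlus.adjoin (t.1 \ s.1) s).1) ∧
    (z ∈ colY q p s T → Disjoint z.1 w.1) := by
  set y := FinPlus.adjoin (s.1.erase p) t with hy
  set g := FinPlus.adjoin (t.1 \ s.1) s with hg
  have hmy : ∀ x, x ∈ y.1 ↔ x = ofSet t ∨ (x ≠ p ∧ x ∈ s.1) := fun x => by
    rw [hy, mem_adjoin, Finset.mem_erase]
  have hmg : ∀ x, x ∈ g.1 ↔ x = ofSet s ∨ (x ∈ t.1 ∧ x ∉ s.1) := fun x => by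
    rw [hg, mem_adjoin, Finset.mem_sdiff]
  obtain ⟨ht, hpt, htp⟩ := H.hT t List.mem_cons_self
  have hT : ∀ t' ∈ T, IsFace q t' ∧ p ∈ t'.1 ∧ t'.1 ≠ {p} := H.tail.hT
  have hs := H.hs
  have hps := H.hps
  have hpq : p ∈ vr q := hs.mem_vr hps
  have hsT : s ∉ T := by
    intro h
    have := hU.of_append (L := T) fun r hr h => by
      rcases Finset.mem_union.mp h with h | h
      · exact (hT r hr).1.notMem hs h
      · exact (hT r hr).1.notMem ht h
    exact this.2 s h Finset.subset_union_left
  have hPt := (List.pairwise_cons.mp H.hP).1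
  have htT : t ∉ T := fun h => hPt t h subset_rfl
  have hy1 : ∀ v, y.1 ≠ {v} := by
    obtain ⟨b, hb, hbp⟩ : ∃ b ∈ s.1, b ≠ p := by
      by_contra h
      push Not at h
      exact H.hsp (Finset.Subset.antisymm (fun x hx => by simp [h x hx]) (by simpa using hps))
    intro v hv
    have h1 := (hmy (ofSet t)).mpr (Or.inl rfl)
    have h2 := (hmy b).mpr (Or.inr ⟨hbp, hb⟩)
    rw [hv, Finset.mem_singleton] at h1 h2
    exact ht.notMem hs (h1 ▸ h2 ▸ hb)
  have hone : ∀ a : FinPlus Ur, p ∈ a.1 → a.1 ≠ {p} → ∀ v, a.1 ≠ {v} := by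
    intro a h1 h2 v hv
    rw [hv, Finset.mem_singleton] at h1
    exact h2 (h1 ▸ hv)
  have hall : ∀ a ∈ y :: s :: t :: T, ∀ v, a.1 ≠ {v} := by
    intro a ha
    simp only [List.mem_cons] at ha
    rcases ha with rfl | rfl | rfl | ha
    · exact hy1
    · exact hone _ hps H.hsp
    · exact hone _ hpt htp
    · exact hone _ (hT a ha).2.1 (hT a ha).2.2
  have hty : ofSet t ∈ y.1 := (hmy _).mpr (Or.inl rfl)
  have hsg : ofSet s ∈ g.1 := (hmg _).mpr (Or.inl rfl)
  have htq := ht.notMem_vr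
  have hsq := hs.notMem_vr
  have hyq : ofSet y ∉ vr q := notMem_vr_of_mem hty ht.notMem_tc
  have hgq : ofSet g ∉ vr q := notMem_vr_of_mem hsg hs.notMem_tc
  have hwq : ofSet w ∉ vr q := by
    rcases hw3 with h | rfl
    · exact notMem_vr_of_mem h hs.notMem_tc
    · exact htq
  have hpy : p ∉ y.1 := fun h => by
    rcases (hmy p).mp h with h | h
    · exact htq (h ▸ hpq)
    · exact h.1 rfl
  have hpg : p ∉ g.1 := fun h => by
    rcases (hmg p).mp h with h | h
    · exact hsq (h ▸ hpq)
    · exact h.2 hps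
  -- Members of `Z` contain `p`, which neither `y` nor `g` does; this keeps them apart.
  rcases List.mem_append.mp hz with hz | hz
  · have hZz := hZ z hz
    have hsne : ofSet s ∈ z.1 → IsFace (t :: (T ++ q)) s := hZz.hsz
    have hst : ofSet s ∈ z.1 → s ≠ t := by
      rintro h rfl
      exact not_fa_cons_of_subset subset_rfl (hsne h).fa
    refine ⟨fun v hv => ?_, ⟨?_, ?_, ?_⟩, ?_, hone z hZz.hp hZz.hzp, ?_, ?_, Or.inl ?_, ?_⟩
    · rcases hZz.hv v hv with hvq | rfl
      · refine ⟨mem_vr_append_of_ne (y :: s :: t :: T) hvq fun a ha => hall a ha v, ?_, ?_, ?_, ?_⟩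
        all_goals rintro rfl; contradiction
      · refine ⟨mem_vr_append_of_ne [y] (hsne hv).ofSet_mem_vr_cons (by simpa using hy1 _),
          ?_, fun h => hst hv (ofSet_injective h), ofSet_ne_of_mem hsg, ?_⟩
        · intro h
          exact ht.notMem hs (ofSet_injective h ▸ hty)
        · rcases hw3 with h | rfl
          · exact ofSet_ne_of_mem h
          · exact fun h => hst hv (ofSet_injective h)
    · refine notMem_vr_append (L := y :: s :: t :: T) hZz.hz fun a ha h => ?_
      have := ofSet_injective h
      subst this
      simp only [List.mem_cons] at ha
      rcases ha with h | h | h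
      · exact hpy (h ▸ hZz.hp)
      · exact hZz.hzs h
      · exact hZz.hzT (List.mem_cons.mpr h)
    · exact fun h => hpy (ofSet_injective h ▸ hZz.hp)
    · exact fun h => hZz.hzT (ofSet_injective h ▸ List.mem_cons_self)
    · exact fun h => hpg (ofSet_injective h ▸ hZz.hp)
    · intro h
      rcases (hmg _).mp h with h | h
      · exact hZz.hzs (ofSet_injective h)
      · exact hZz.hz (ht.mem_vr h.1)
    · intro h
      rcases hw1 _ h with h | h
      · exact hZz.hzs (ofSet_injective h)
      · exact hZz.hz (ht.mem_vr h)
    · intro x hx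
      rcases hw2 x hx with rfl | h
      · exact Finset.mem_union_left _ hZz.hp
      · exact Finset.mem_union_right _ h
    · intro h
      exfalso
      obtain ⟨t', ht', rfl⟩ := mem_colY h
      rcases mem_adjoin.mp hZz.hp with h | h
      · exact (hT t' ht').1.notMem_vr (h ▸ hpq)
      · simp at h
  -- Here the set is `(s \ {p}) ∪ {t'}` with `t' ∈ T`. The vertex `t'` distinguishes it from the
  -- sets named for `t`, and it misses `g` and `w`, which meet `s` at most in `p`.
  · have hzY := hz
    obtain ⟨t', ht', rfl⟩ := mem_colY hz
    set z := FinPlus.adjoin (s.1.erase p) t' with hzdef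
    have hmz : ∀ x, x ∈ z.1 ↔ x = ofSet t' ∨ (x ≠ p ∧ x ∈ s.1) := fun x => by
      rw [hzdef, mem_adjoin, Finset.mem_erase]
    have hF' := (hT t' ht').1
    have htz : ofSet t' ∈ z.1 := (hmz _).mpr (Or.inl rfl)
    have hzq : ofSet z ∉ vr q := notMem_vr_of_mem htz hF'.notMem_tc
    have htt : ofSet t' ≠ ofSet t := fun h => htT (ofSet_injective h ▸ ht')
    have hts : ofSet t' ≠ ofSet s := fun h => hsT (ofSet_injective h ▸ ht')
    have htw : ofSet t' ∉ w.1 := fun h => by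
      rcases hw1 _ h with h | h
      · exact hts h
      · exact hF'.notMem ht h
    have hdj : ∀ x ∈ z.1, x ∉ g.1 := fun x hx hxg => by
      rcases (hmz x).mp hx with rfl | hx
      · rcases (hmg _).mp hxg with h | h
        · exact hts h
        · exact hF'.notMem ht h.1
      · rcases (hmg _).mp hxg with rfl | h
        · exact notMem_self s hx.2
        · exact h.2 hx.2
    refine ⟨fun v hv => ?_, ⟨?_, ?_, ?_⟩, ?_, ?_, ?_, ?_, Or.inr (Finset.disjoint_left.mpr hdj),
      fun _ => Finset.disjoint_left.mpr fun x hx hxw => ?_⟩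
    · rcases (hmz v).mp hv with rfl | hv
      · obtain ⟨T₀, T₁, e⟩ := List.append_of_mem ht'
        have hP := H.tail.hP
        rw [e, List.pairwise_append, List.pairwise_cons] at hP
        have hF : IsFace (T₁ ++ q) t' := hF'.append (fun r hr => (hT r (by simp [e, hr])).1)
          hP.2.1.1
        refine ⟨?_, ?_, htt, ?_, ?_⟩
        · have := mem_vr_append_of_ne (y :: s :: t :: T₀) hF.ofSet_mem_vr_cons fun a ha => hall a (by
            simp only [e, List.mem_cons, List.mem_append] at ha ⊢; tauto) _
          rw [e]
          simpa using this
        · exact fun h => ht.notMem hF' (ofSet_injective h ▸ hty)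
        · exact fun h => hs.notMem hF' (ofSet_injective h ▸ hsg)
        · rcases hw3 with h | rfl
          · exact fun h' => hs.notMem hF' (ofSet_injective h' ▸ h)
          · exact htt
      · have hvq := hs.mem_vr hv.2
        refine ⟨mem_vr_append_of_ne (y :: s :: t :: T) hvq fun a ha => hall a ha v, ?_, ?_, ?_, ?_⟩
        all_goals rintro rfl; contradiction
    · refine notMem_vr_append (L := y :: s :: t :: T) hzq fun a ha h => ?_
      have := ofSet_injective h
      rw [this] at htz
      simp only [List.mem_cons] at ha
      rcases ha with rfl | rfl | rfl | ha
      · rcases (hmy _).mp htz with h | h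
        · exact htt h
        · exact hF'.notMem hs h.2
      · exact hF'.notMem hs htz
      · exact hF'.notMem ht htz
      · exact hF'.notMem (hT a ha).1 htz
    · intro h
      rw [ofSet_injective h] at htz
      rcases (hmy _).mp htz with h | h
      · exact htt h
      · exact hF'.notMem hs h.2
    · exact fun h => hF'.notMem ht (ofSet_injective h ▸ htz)
    · exact fun h => hdj _ htz (ofSet_injective h ▸ htz)
    · obtain ⟨b, hb, hbp⟩ : ∃ b ∈ s.1, b ≠ p := by
        by_contra h
        push Not at h
        exact H.hsp (Finset.Subset.antisymm (fun x hx => by simp [h x hx]) (by simpa using hps))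
      intro v hv
      have h2 := (hmz b).mpr (Or.inr ⟨hbp, hb⟩)
      rw [hv, Finset.mem_singleton] at htz h2
      exact hF'.notMem hs (htz ▸ h2 ▸ hb)
    · intro h
      rcases (hmg _).mp h with h | h
      · exact hF'.notMem hs (ofSet_injective h ▸ htz)
      · exact hzq (ht.mem_vr h.1)
    · intro h
      rcases hw1 _ h with h | h
      · exact hF'.notMem hs (ofSet_injective h ▸ htz)
      · exact hzq (ht.mem_vr h)
    · rcases (hmz x).mp hx with rfl | hx
      · exact htw hxw
      · exact hx.1 (hw4 x hxw hx.2)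

/-- The isomorphism used when `s = t`. -/
theorem pw_column_self {q : SetSeq Ur} {s : FinPlus Ur} {p : Elem Ur} (hs : IsFace q s)
    (hp : p ∈ s.1) :
    PW (FinPlus.adjoin (s.1.erase p) s :: s :: s :: q) (FinPlus.refold p s s :: s :: q)
      (move₂ (ofSet (FinPlus.adjoin (s.1.erase p) s)) (ofSet s) (ofSet s)
        (ofSet (FinPlus.refold p s s))) := by
  have hws : FinPlus.refold p s s = FinPlus.adjoin {p} s := Subtype.ext (by
    ext x
    rw [mem_refold, mem_adjoin, Finset.mem_singleton]
    tauto)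
  rw [hws]
  have hsy : ofSet s ∈ (FinPlus.adjoin (s.1.erase p) s).1 := mem_adjoin.mpr (Or.inl rfl)
  have h1 : PW (FinPlus.adjoin (s.1.erase p) s :: s :: s :: q)
      (FinPlus.adjoin {p} s :: s :: s :: q)
      (move₂ (ofSet (FinPlus.adjoin (s.1.erase p) s)) (ofSet s) (ofSet s)
        (ofSet (FinPlus.adjoin {p} s))) :=
    pw_typeOne hs hp subset_rfl (move₂_right (ofSet_ne_of_mem hsy)) (move₂_left _ _ _ _)
      (fun h => absurd rfl h) fun x hx => move₂_of_ne (fun e =>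
        notMem_vr_of_mem hsy hs.notMem_tc (e ▸ hx)) (hs.mem_vr_ne hx)
  have h2 : ¬ IsFace (s :: q) s := fun h => not_fa_cons_of_subset subset_rfl h.fa
  exact h1.congr (.refl _) (.cons _ (.drop _ _ h2)) fun _ _ => rfl

/-- The crossing of `s` and `t` when `s ∪ t` is a face. The three isomorphisms, for `s = t`, for `s`
properly included in `t` and for `s ∩ t = {p}`, move only two vertices. The sets to the left avoid
these vertices and their images, so the maps lift by pure division. -/
theorem pw_column_head {q : SetSeq Ur} {p : Elem Ur} {s t : FinPlus Ur} {Z T : SetSeq Ur}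
    (H : ColHyp q p s (t :: T)) (hZ : ∀ z ∈ Z, ColZ q p s (t :: T) z)
    (hU : IsFace (T ++ q) (s.union t)) :
    PW (Z ++ (colY q p s T ++ FinPlus.adjoin (s.1.erase p) t :: s :: t :: (T ++ q)))
      (Z ++ colT p s t :: (colY q p s T ++ s :: (T ++ q)))
      (move₂ (ofSet (FinPlus.adjoin (s.1.erase p) t)) (ofSet s) (ofSet t)
        (ofSet (colT p s t))) := by
  set w := colT p s t with hw
  have ht := (H.hT t List.mem_cons_self).1
  have hpt := (H.hT t List.mem_cons_self).2.1
  have hs := H.hs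
  have hsF : IsFace (T ++ q) s := hU.mono Finset.subset_union_left
  have htF : IsFace (T ++ q) t := hU.mono Finset.subset_union_right
  have htri := H.tri [] t T rfl hU
  have hr : ¬ s.1 ⊆ t.1 → s.1 ∩ t.1 = {p} := fun h => htri.resolve_left h
  have hwt : ¬ s.1 ⊆ t.1 → w = t := fun h => by rw [hw, colT, if_neg h]
  have hww : s.1 ⊆ t.1 → w = FinPlus.refold p s t := fun h => by rw [hw, colT, if_pos h]
  have hinter : ¬ s.1 ⊆ t.1 → ∀ x ∈ t.1, x ∈ s.1 → x = p := fun h x h1 h2 => by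
    have : x ∈ s.1 ∩ t.1 := Finset.mem_inter.mpr ⟨h2, h1⟩
    rw [hr h] at this
    exact Finset.mem_singleton.mp this
  have hw1 : ∀ x ∈ w.1, x = ofSet s ∨ x ∈ t.1 := by
    by_cases h : s.1 ⊆ t.1
    · rw [hww h]
      intro x hx
      rcases mem_refold.mp hx with rfl | h | h
      · exact Or.inr hpt
      · exact Or.inl h
      · exact Or.inr h.1
    · rw [hwt h]
      exact fun x hx => Or.inr hx
  have hw2 : ∀ x ∈ w.1, x = p ∨ x ∈ (FinPlus.adjoin (t.1 \ s.1) s).1 := by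
    by_cases h : s.1 ⊆ t.1
    · rw [hww h]
      intro x hx
      rw [mem_adjoin, Finset.mem_sdiff]
      exact mem_refold.mp hx
    · rw [hwt h]
      intro x hx
      rw [mem_adjoin, Finset.mem_sdiff]
      by_cases hxs : x ∈ s.1
      · exact Or.inl (hinter h x hx hxs)
      · exact Or.inr (Or.inr ⟨hx, hxs⟩)
  have hw3 : ofSet s ∈ w.1 ∨ w = t := by
    by_cases h : s.1 ⊆ t.1
    · rw [hww h]
      exact Or.inl (mem_refold.mpr (by simp))
    · exact Or.inr (hwt h)
  have hw4 : ∀ x ∈ w.1, x ∈ s.1 → x = p := by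
    by_cases h : s.1 ⊆ t.1
    · rw [hww h]
      intro x hx hxs
      rcases mem_refold.mp hx with h | rfl | h
      · exact h
      · exact absurd hxs (notMem_self s)
      · exact absurd hxs h.2
    · rw [hwt h]
      exact hinter h
  have facts := fun z hz => H.left_facts hZ hU hw1 hw2 hw3 hw4 (z := z) hz
  set y := FinPlus.adjoin (s.1.erase p) t with hy
  set g := FinPlus.adjoin (t.1 \ s.1) s with hg
  have hty : ofSet t ∈ y.1 := mem_adjoin.mpr (Or.inl rfl)
  have hsg : ofSet s ∈ g.1 := mem_adjoin.mpr (Or.inl rfl)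
  have hty' := ofSet_ne_of_mem hty
  have hwq : ofSet w ∉ vr (T ++ q) := by
    rcases hw3 with h | h
    · exact notMem_vr_of_mem h hsF.notMem_tc
    · rw [h]; exact htF.notMem_vr
  have hgq : ofSet g ∉ vr (T ++ q) := notMem_vr_of_mem hsg hsF.notMem_tc
  have hpg : p ∉ g.1 := fun h => by
    rcases mem_adjoin.mp h with h | h
    · exact hs.notMem_vr (h ▸ hs.mem_vr H.hps)
    · exact (Finset.mem_sdiff.mp h).2 H.hps
  have hpw : p ∈ w.1 := by
    by_cases h : s.1 ⊆ t.1
    · rw [hww h]; exact mem_refold.mpr (Or.inl rfl)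
    · rw [hwt h]; exact hpt
  have key : PW ((Z ++ colY q p s T) ++ y :: s :: t :: (T ++ q))
      ((Z ++ colY q p s T) ++ w :: s :: (T ++ q))
      (move₂ (ofSet y) (ofSet s) (ofSet t) (ofSet w)) := by
    by_cases hst : s = t
    · subst hst
      have h1 : PW (y :: s :: s :: (T ++ q)) (w :: s :: (T ++ q))
          (move₂ (ofSet y) (ofSet s) (ofSet s) (ofSet w)) := by
        rw [hww subset_rfl]
        exact pw_column_self hsF H.hps
      refine h1.append_move₂ hty' _ (fun z hz v hv => ?_) (fun z hz => ?_) fun z hz =>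
        (facts z hz).2.2.2.1
      · obtain ⟨h1, h2, h3, h4, h5⟩ := (facts z hz).1 v hv
        exact ⟨h1, h2, h3, h3, h5⟩
      · exact (facts z hz).2.1
    · have hgs : ofSet s ≠ ofSet g := ofSet_ne_of_mem hsg
      have H0 : PW (y :: s :: t :: (T ++ q)) (g :: w :: s :: (T ++ q))
          (move₂ (ofSet y) (ofSet g) (ofSet t) (ofSet w)) := by
        by_cases h : s.1 ⊆ t.1
        · have := pw_column_subset htF h hst H.hps H.hsp
          rwa [← hww h] at this
        · rw [hwt h]
          exact pw_column_inter hsF htF (hr h)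
      have hgt : ofSet g ≠ ofSet t := fun h => hs.notMem ht (ofSet_injective h ▸ hsg)
      refine pw_column_lift H0 hty' hsg ?_ hgq ?_ hgt (fun z hz => (facts z hz).1)
        (fun z hz => (facts z hz).2.1) (fun z hz => (facts z hz).2.2.1)
        (fun z hz => (facts z hz).2.2.2.1) (fun z hz => (facts z hz).2.2.2.2.1)
        (fun z hz => (facts z hz).2.2.2.2.2.1) fun z hz => (facts z hz).2.2.2.2.2.2.1
      · exact fun h => hpg (ofSet_injective h ▸ hpw)
      · intro h
        have : ofSet s ∈ y.1 := ofSet_injective h ▸ hsg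
        rcases mem_adjoin.mp this with h | h
        · exact hst (ofSet_injective h)
        · exact notMem_self s (Finset.mem_of_mem_erase h)
  rw [List.append_assoc, List.append_assoc] at key
  -- The replacement of `t` passes the remaining `(s \ {p}) ∪ {t'}` because it is disjoint from
  -- them.
  refine key.congr (.refl _) (CombEquiv.append_left Z (CombEquiv.move fun P₁ b P₂ e => ?_))
    fun _ _ => rfl
  have hb : b ∈ colY q p s T := by simp [e]
  obtain ⟨h1, -, -, -, -, h2, -, h3⟩ := facts b (List.mem_append_right _ hb)
  exact ⟨h2, fun h => (h1 _ h).2.2.2.2 rfl, Or.inr (h3 hb)⟩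

/-- When `s ∪ t` is not a face, `s` and `t` interchange directly. Then `t` passes each `(s \ {p}) ∪
{t'}`: since `p ∈ t`, their union includes `s`, which has been divided. -/
theorem CombEquiv.column_skip {q : SetSeq Ur} {p : Elem Ur} {s t : FinPlus Ur} {T : SetSeq Ur}
    (H : ColHyp q p s (t :: T)) (hU : ¬ IsFace (T ++ q) (s.union t)) :
    CombEquiv (colY q p s T ++ s :: t :: (T ++ q)) (t :: (colY q p s T ++ s :: (T ++ q))) := by
  obtain ⟨ht, hpt, -⟩ := H.hT t List.mem_cons_self
  have hs := H.hs
  have htT : t ∉ T := fun h => (List.pairwise_cons.mp H.hP).1 t h subset_rfl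
  have hz : ∀ z ∈ colY q p s T, ∃ t' ∈ T, z = FinPlus.adjoin (s.1.erase p) t' ∧
      ofSet z ∉ vr q := fun z hz => by
    obtain ⟨t', h1, rfl⟩ := mem_colY hz
    exact ⟨t', h1, rfl, notMem_vr_of_mem (mem_adjoin.mpr (Or.inl rfl)) (H.tail.hT t' h1).1.notMem_tc⟩
  refine (CombEquiv.append_left _ (.swap s t _ (hs.notMem ht) (ht.notMem hs) (Or.inl hU))).trans
    (CombEquiv.move fun P₁ b P₂ e => ?_)
  obtain ⟨t', ht', hbe, hbq⟩ := hz b (by simp [e])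
  have hF' := (H.tail.hT t' ht').1
  have hmb : ∀ x, x ∈ b.1 ↔ x = ofSet t' ∨ (x ≠ p ∧ x ∈ s.1) := fun x => by
    rw [hbe, mem_adjoin, Finset.mem_erase]
  refine ⟨notMem_of_vr ht hbq, fun h => ?_, Or.inl fun hF => ?_⟩
  · rcases (hmb _).mp h with h | h
    · exact htT (ofSet_injective h ▸ ht')
    · exact ht.notMem hs h.2
  · have := hF.of_append (L := P₂) fun r hr h => by
      obtain ⟨t'', ht'', hre, hrq⟩ := hz r (by simp [e, hr])
      rcases Finset.mem_union.mp h with h | h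
      · rcases (hmb _).mp h with h | h
        · have h3 : ofSet t'' ∈ t'.1 := by
            rw [← ofSet_injective h, hre]
            exact mem_adjoin.mpr (Or.inl rfl)
          exact (H.tail.hT t'' ht'').1.notMem hF' h3
        · exact hrq (hs.mem_vr h.2)
      · exact hrq (ht.mem_vr h)
    refine not_fa_cons_of_subset (fun x hx => ?_) this.1.fa
    rw [union_val, Finset.mem_union]
    by_cases hxp : x = p
    · exact Or.inr (hxp ▸ hpt)
    · exact Or.inl ((hmb x).mpr (Or.inr ⟨hxp, hx⟩))

/-- Induction along `T` from its leftmost member. The list `Z` collects what stands to the left and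
must stay fixed, in particular the replacements of the members already crossed. -/
theorem pw_columns {q : SetSeq Ur} {p : Elem Ur} {s : FinPlus Ur} : ∀ (T Z : SetSeq Ur),
    ColHyp q p s T → (∀ z ∈ Z, ColZ q p s T z) →
    ∃ h, PW (Z ++ (colY q p s T ++ s :: (T ++ q))) (Z ++ (T.map (colT p s) ++ s :: q)) h ∧
      (∀ x ∈ vr q, h x = x) ∧ (∀ z ∈ Z, h (ofSet z) = ofSet z) ∧
      (∀ y ∈ colY q p s T, h (ofSet y) = ofSet s) ∧
      (∀ t ∈ T, h (ofSet t) = ofSet (colT p s t)) ∧ (s ∉ T → h (ofSet s) = ofSet s) := by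
  intro T
  induction T with
  | nil =>
    intro Z H hZ
    refine ⟨id, ?_, fun _ _ => rfl, fun _ _ => rfl, by simp [colY], by simp, fun _ => rfl⟩
    refine pw_id (x := p) (mem_vr_append_of_ne Z (mem_vr_append_of_ne [s] (H.hs.mem_vr H.hps) ?_) ?_)
    · simpa using H.hsp
    · exact fun z hz => (hZ z hz).hzp
  | cons t T ih =>
    intro Z H hZ
    obtain ⟨ht, hpt, htp⟩ := H.hT t List.mem_cons_self
    have hs := H.hs
    have hPt := (List.pairwise_cons.mp H.hP).1
    have hwcases : (s.1 ⊆ t.1 ∧ colT p s t = FinPlus.refold p s t) ∨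
        (¬ s.1 ⊆ t.1 ∧ colT p s t = t) := by
      by_cases h : s.1 ⊆ t.1
      · exact Or.inl ⟨h, if_pos h⟩
      · exact Or.inr ⟨h, if_neg h⟩
    have htF : IsFace (T ++ q) t := ht.append (fun r hr => (H.tail.hT r hr).1) hPt
    have hUt : s.1 ⊆ t.1 → IsFace (T ++ q) (s.union t) := fun h => by
      have : s.union t = t := Subtype.ext (Finset.union_eq_right.mpr h)
      rwa [this]
    have htT : t ∉ T := fun h => hPt t h subset_rfl
    have hstT : IsFace (T ++ q) s → s ∉ T := fun h hsT =>
      (h.of_append fun r hr => (H.tail.hT r hr).1.notMem hs).2 s hsT subset_rfl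
    have hsq := hs.notMem_vr
    -- The replacement of `t` joins `Z` for the crossing of the remaining members.
    have hZ' : ∀ z ∈ Z ++ [colT p s t], ColZ q p s T z := by
      intro z hz
      rcases List.mem_append.mp hz with hz | hz
      · have := hZ z hz
        exact ⟨this.hp, this.hzp, this.hv, fun h => ((this.hsz h).of_append (L := [t]) (by
          simpa using ht.notMem hs)).1, this.hz, this.hzs, fun h => this.hzT (List.mem_cons_of_mem _ h)⟩
      · rw [List.mem_singleton.mp hz]
        rcases hwcases with ⟨h, e⟩ | ⟨h, e⟩
        · rw [e]
          have hsF := (hUt h).mono (s := s) Finset.subset_union_left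
          have hsw : ofSet s ∈ (FinPlus.refold p s t).1 := mem_refold.mpr (by simp)
          refine ⟨mem_refold.mpr (Or.inl rfl), fun h' => ?_, fun v hv => ?_, fun _ => hsF,
            notMem_vr_of_mem hsw hs.notMem_tc, ?_, ?_⟩
          · rw [h', Finset.mem_singleton] at hsw
            exact hsq (hsw ▸ hs.mem_vr H.hps)
          · rcases mem_refold.mp hv with rfl | h | h
            · exact Or.inl (hs.mem_vr H.hps)
            · exact Or.inr h
            · exact Or.inl (ht.mem_vr h.1)
          · intro h'
            rw [h'] at hsw
            exact notMem_self s hsw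
          · intro h'
            exact hs.notMem (H.tail.hT _ h').1 hsw
        · rw [e]
          exact ⟨hpt, htp, fun v hv => Or.inl (ht.mem_vr hv), fun h' => absurd h' (hs.notMem ht),
            ht.notMem_vr, fun h' => h (h' ▸ subset_rfl), htT⟩
    obtain ⟨h, h1, h2, h3, h4, h5, h6⟩ := ih (Z ++ [colT p s t]) H.tail hZ'
    rw [List.append_assoc, List.append_assoc] at h1
    by_cases hU : IsFace (T ++ q) (s.union t)
    · have hsT : s ∉ T := hstT (hU.mono Finset.subset_union_left)
      set y := FinPlus.adjoin (s.1.erase p) t with hy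
      have hty : ofSet t ∈ y.1 := mem_adjoin.mpr (Or.inl rfl)
      have hYe : colY q p s (t :: T) = colY q p s T ++ [y] := by rw [colY, if_pos hU]
      have hyq : ofSet y ∉ vr q := notMem_vr_of_mem hty ht.notMem_tc
      have hpy : p ∉ y.1 := fun h => by
        rcases mem_adjoin.mp h with h | h
        · exact ht.notMem_vr (h ▸ hs.mem_vr H.hps)
        · simp at h
      refine ⟨h ∘ move₂ (ofSet y) (ofSet s) (ofSet t) (ofSet (colT p s t)), ?_, fun x hx => ?_,
        fun z hz => ?_, fun y' hy' => ?_, fun t' ht' => ?_, fun hst => ?_⟩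
      · rw [hYe]
        have := h1.comp (pw_column_head H hZ hU)
        simpa using this
      · rw [Function.comp_apply, move₂_of_ne (by rintro rfl; exact hyq hx) (ht.mem_vr_ne hx)]
        exact h2 x hx
      · rw [Function.comp_apply, move₂_of_ne]
        · exact h3 z (List.mem_append_left _ hz)
        · exact fun e => hpy (ofSet_injective e ▸ (hZ z hz).hp)
        · exact fun e => (hZ z hz).hzT (ofSet_injective e ▸ List.mem_cons_self)
      · rw [hYe] at hy'
        rw [Function.comp_apply]
        by_cases hyy : y' = y
        · rw [hyy, move₂_left]
          exact h6 hsT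
        · have hy'' : y' ∈ colY q p s T := by simpa [hyy] using hy'
          obtain ⟨t', ht', rfl⟩ := mem_colY hy''
          rw [move₂_of_ne (fun e => hyy (ofSet_injective e))]
          · exact h4 _ hy''
          · intro e
            refine (H.tail.hT t' ht').1.notMem ht ?_
            rw [← ofSet_injective e]
            exact mem_adjoin.mpr (Or.inl rfl)
      · rw [Function.comp_apply]
        by_cases htt : t' = t
        · rw [htt, move₂_right (ofSet_ne_of_mem hty)]
          exact h3 _ (by simp)
        · have ht'' : t' ∈ T := by simpa [htt] using ht'
          rw [move₂_of_ne _ (fun e => htt (ofSet_injective e))]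
          · exact h5 t' ht''
          · exact fun e => ht.notMem (H.tail.hT t' ht'').1 (ofSet_injective e ▸ hty)
      · rw [Function.comp_apply, move₂_of_ne]
        · exact h6 hsT
        · exact fun e => ht.notMem hs (ofSet_injective e ▸ hty)
        · exact fun e => hst (ofSet_injective e ▸ List.mem_cons_self)
    · have hn : ¬ s.1 ⊆ t.1 := fun h => hU (hUt h)
      have hwt : colT p s t = t := if_neg hn
      have hYe : colY q p s (t :: T) = colY q p s T := by rw [colY, if_neg hU, List.append_nil]
      rw [hwt] at h1 h3
      refine ⟨h, ?_, h2, fun z hz => h3 z (List.mem_append_left _ hz), ?_, ?_, ?_⟩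
      · rw [hYe]
        refine PW.congr (c := Z ++ ([t] ++ (T.map (colT p s) ++ s :: q))) h1
          (CombEquiv.append_left Z (CombEquiv.column_skip H hU).symm) ?_ fun _ _ => rfl
        simp only [List.map_cons, hwt]
        exact .refl _
      · rw [hYe]; exact h4
      · intro t' ht'
        rcases List.mem_cons.mp ht' with rfl | ht'
        · rw [hwt]; exact h3 _ (by simp)
        · exact h5 t' ht'
      · exact fun hst => h6 fun h => hst (List.mem_cons_of_mem _ h)

/-! ### The fiber of a set under the weld map, and the division by one set. -/

/-- The function of `weldFamily`. -/
noncomputable def wf (p : Elem Ur) (T : SetSeq Ur) (x : Elem Ur) : Elem Ur :=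
  if ∃ t ∈ T, x = ofSet t then p else x

theorem wf_mem {p : Elem Ur} {T : SetSeq Ur} {t : FinPlus Ur} (h : t ∈ T) : wf p T (ofSet t) = p :=
  if_pos ⟨t, h, rfl⟩

theorem wf_of_ne {p : Elem Ur} {T : SetSeq Ur} {x : Elem Ur} (h : ∀ t ∈ T, x ≠ ofSet t) :
    wf p T x = x := if_neg fun ⟨t, ht, e⟩ => h t ht e

theorem wf_of_mem_vr {q : SetSeq Ur} {p : Elem Ur} {T : SetSeq Ur} {x : Elem Ur}
    (hT : ∀ t ∈ T, IsFace q t) (h : x ∈ vr q) : wf p T x = x :=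
  wf_of_ne fun t ht => (hT t ht).mem_vr_ne h

theorem wf_image_of_subset {q : SetSeq Ur} {p : Elem Ur} {T : SetSeq Ur} {s : FinPlus Ur}
    (hT : ∀ t ∈ T, IsFace q t) (hs : IsFace q s) : s.image (wf p T) = s :=
  image_eq_self fun _ hx => wf_of_mem_vr hT (hs.mem_vr hx)

theorem mem_of_wf_image {p : Elem Ur} {T : SetSeq Ur} {x s : FinPlus Ur}
    (h : x.image (wf p T) = s) {b : Elem Ur} (hb : b ∈ s.1) (hbp : b ≠ p) :
    b ∈ x.1 := by
  have hb' : b ∈ x.1.image (wf p T) := by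
    have := congrArg Subtype.val h
    rw [image_val] at this
    rwa [this]
  obtain ⟨y, hy, rfl⟩ := Finset.mem_image.mp hb'
  by_cases h' : ∃ t ∈ T, y = ofSet t
  · exact absurd (if_pos h') hbp
  · rwa [show wf p T y = y from if_neg h']

/-- The vertices that distinguish the members of the fiber of `s`. -/
noncomputable def colD (q : SetSeq Ur) (s : FinPlus Ur) : SetSeq Ur → List (Elem Ur)
  | [] => []
  | t :: T => (if IsFace (T ++ q) (s.union t) then [ofSet t] else []) ++ colD q s T

theorem mem_colD {q : SetSeq Ur} {s : FinPlus Ur} {T : SetSeq Ur} {d : Elem Ur} :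
    d ∈ colD q s T ↔ ∃ T₀ t T₁, T = T₀ ++ t :: T₁ ∧ d = ofSet t ∧ IsFace (T₁ ++ q) (s.union t) := by
  induction T with
  | nil => simp [colD]
  | cons t T ih =>
    rw [colD, List.mem_append, ih]
    constructor
    · rintro (h | ⟨T₀, t', T₁, rfl, h⟩)
      · split_ifs at h with hF
        · exact ⟨[], t, T, rfl, List.mem_singleton.mp h, hF⟩
        · simp at h
      · exact ⟨t :: T₀, t', T₁, rfl, h⟩
    · rintro ⟨T₀, t', T₁, e, h, hF⟩
      cases T₀ with
      | nil =>
        simp only [List.nil_append, List.cons.injEq] at e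
        obtain ⟨rfl, rfl⟩ := e
        exact Or.inl (by simp [hF, h])
      | cons a T₀ =>
        simp only [List.cons_append, List.cons.injEq] at e
        exact Or.inr ⟨T₀, t', T₁, e.2, h, hF⟩

theorem colD_map_reverse (q : SetSeq Ur) (p : Elem Ur) (s : FinPlus Ur) (T : SetSeq Ur) :
    ((colD q s T).map (FinPlus.ins (s.1.erase p))).reverse = colY q p s T := by
  induction T with
  | nil => rfl
  | cons t T ih =>
    rw [colD, colY, List.map_append, List.reverse_append, ih]
    split_ifs <;> rfl

theorem nodup_colD {q : SetSeq Ur} {s : FinPlus Ur} {T : SetSeq Ur} (h : T.Nodup) :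
    (colD q s T).Nodup := by
  induction T with
  | nil => simp [colD]
  | cons t T ih =>
    rw [List.nodup_cons] at h
    rw [colD]
    split_ifs
    · rw [List.singleton_append, List.nodup_cons]
      refine ⟨fun h' => ?_, ih h.2⟩
      obtain ⟨T₀, t', T₁, rfl, e, -⟩ := mem_colD.mp h'
      exact h.1 (by simp [ofSet_injective e])
    · exact ih h.2

theorem image_union_val (f : Elem Ur → Elem Ur) (a b : FinPlus Ur) :
    (a.union b).image f = (a.image f).union (b.image f) :=
  Subtype.ext (Finset.image_union _ _)

theorem union_self_eq (s : FinPlus Ur) : s.union s = s := Subtype.ext (Finset.union_self _)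

/-- A member of the fiber consists of `s \ {p}` and at least one vertex over `p`, which is `p`
itself or some `t ∈ T`. So the fiber is a star over `s \ {p}`; collapsing it leaves just the sets
that carrying `s` across `T` consumes. -/
theorem pw_column {q : SetSeq Ur} {p : Elem Ur} {s : FinPlus Ur} {T E : SetSeq Ur}
    (H : ColHyp q p s T) (hE : ∀ x, x ∈ E ↔ IsFace (T ++ q) x ∧ x.image (wf p T) = s)
    (hP : E.Pairwise fun a b => ¬ b.1 ⊆ a.1) :
    ∃ h, PW (E ++ (T ++ q)) (T.map (colT p s) ++ s :: q) h ∧ (∀ x ∈ vr q, h x = x) ∧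
      (∀ e ∈ E, h (ofSet e) = ofSet s) ∧ ∀ t ∈ T, h (ofSet t) = ofSet (colT p s t) := by
  have hs := H.hs
  have hps := H.hps
  have hTF : ∀ t ∈ T, IsFace q t := fun t ht => (H.hT t ht).1
  have hpq : p ∈ vr q := hs.mem_vr hps
  set B := s.1.erase p with hB
  have hpB : p ∉ B := by simp [hB]
  have hBs : B ⊆ s.1 := Finset.erase_subset _ _
  have hBq : ∀ b ∈ B, b ∈ vr q := fun b hb => hs.mem_vr (hBs hb)
  have hBne : B.Nonempty := by
    by_contra h
    rw [Finset.not_nonempty_iff_eq_empty] at h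
    refine H.hsp ?_
    rw [← Finset.insert_erase hps, ← hB, h]
    rfl
  have hBx : ∀ x ∈ E, B ⊆ x.1 := fun x hx b hb =>
    mem_of_wf_image ((hE x).mp hx).2 (hBs hb) (by rintro rfl; exact hpB hb)
  have hnT : ∀ t ∈ T, ofSet t ∉ B := fun t ht h => (hTF t ht).notMem hs (hBs h)
  have hsplit : ∀ T₀ t T₁, T = T₀ ++ t :: T₁ → ∀ r ∈ T₀, ofSet r ≠ ofSet t := by
    rintro T₀ t T₁ rfl r hr e
    have := nodup_of_pairwise H.hP
    rw [List.nodup_append] at this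
    exact this.2.2 r hr t (by simp) (ofSet_injective e)
  have hmem : ∀ {T₀ t T₁}, T = T₀ ++ t :: T₁ → t ∈ T ∧ (∀ r ∈ T₀, r ∈ T) ∧ ∀ r ∈ T₁, r ∈ T := by
    rintro T₀ t T₁ rfl
    exact ⟨by simp, fun r hr => by simp [hr], fun r hr => by simp [hr]⟩
  have hinsv : ∀ d, (FinPlus.ins B d).1 = insert d B := fun _ => rfl
  have hinsp : FinPlus.ins B p = s := Subtype.ext (Finset.insert_erase hps)
  -- The vertex `p` counts only if `s` is still a face after the division by `T`, that is, if no
  -- member of `T` is included in `s`.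
  set ds := (if IsFace (T ++ q) s then [p] else []) ++ colD q s T with hds
  have hmds : ∀ d, d ∈ ds ↔ (d = p ∧ IsFace (T ++ q) s) ∨ d ∈ colD q s T := fun d => by
    rw [hds, List.mem_append]
    split_ifs with h <;> simp [h]
  have hFB : Fa (T ++ q) B := (fa_append T hnT).mpr ⟨hs.fa.mono hBs, fun t ht h =>
    hpB (h (H.hT t ht).2.1)⟩
  have hyE : ∀ d ∈ ds, FinPlus.ins B d ∈ E := by
    intro d hd
    rcases (hmds d).mp hd with ⟨rfl, hF⟩ | hd
    · rw [hinsp, hE]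
      exact ⟨hF, wf_image_of_subset hTF hs⟩
    · obtain ⟨T₀, t, T₁, e, rfl, hF⟩ := mem_colD.mp hd
      obtain ⟨htT, hT₀, hT₁⟩ := hmem e
      rw [hE]
      refine ⟨?_, Subtype.ext ?_⟩
      · have h1 : Fa (t :: (T₁ ++ q)) (insert (ofSet t) B) := by
          refine fa_cons_intro (fun h => ?_) (Or.inr ⟨by simp, hF.fa.mono ?_⟩)
          · rcases Finset.mem_insert.mp (h (H.hT t htT).2.1) with h | h
            · exact (hTF t htT).mem_vr_ne hpq h
            · exact hpB h
          · rw [Finset.erase_insert (hnT t htT)]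
            exact Finset.union_subset_union hBs subset_rfl
        rw [e, List.append_assoc, List.cons_append]
        refine Fa.isFace ((fa_append T₀ fun r hr h => ?_).mpr ⟨h1, fun r hr h => ?_⟩)
        · rcases Finset.mem_insert.mp h with h | h
          · exact hsplit T₀ t T₁ e r hr h
          · exact hnT r (hT₀ r hr) h
        · rcases Finset.mem_insert.mp (h (H.hT r (hT₀ r hr)).2.1) with h | h
          · exact (hTF t htT).mem_vr_ne hpq h
          · exact hpB h
      · rw [image_val, hinsv, Finset.image_insert, wf_mem htT,
          (Finset.image_congr (g := id) fun x hx => wf_of_mem_vr hTF (hBq x hx) :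
            B.image (wf p T) = B.image id), Finset.image_id]
        exact Finset.insert_erase hps
  obtain ⟨f, hf1, hf2, hf3⟩ : ∃ f, PW (E ++ (T ++ q))
      ((ds.map (FinPlus.ins B)).reverse ++ (T ++ q)) f ∧ (∀ x ∈ vr (T ++ q), f x = x) ∧
      ∀ e ∈ E, ∃ d ∈ ds, f (ofSet e) = ofSet (FinPlus.ins B d) := by
    refine pw_star hBne ds hFB ?_ ?_ (fun e he => ((hE e).mp he).1) hBx ?_ hyE ?_ hP
    · have := nodup_colD (q := q) (s := s) (nodup_of_pairwise H.hP)
      rw [hds]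
      split_ifs
      · rw [List.singleton_append, List.nodup_cons]
        refine ⟨fun h => ?_, this⟩
        obtain ⟨T₀, t, T₁, e, h', -⟩ := mem_colD.mp h
        exact (hTF t (hmem e).1).mem_vr_ne hpq h'
      · exact this
    · intro d hd
      rcases (hmds d).mp hd with ⟨rfl, -⟩ | hd
      · exact hpB
      · obtain ⟨T₀, t, T₁, e, rfl, hF⟩ := mem_colD.mp hd
        exact hnT t (hmem e).1
    · intro e he
      have hBe := hBx e he
      obtain ⟨heF, hei⟩ := (hE e).mp he
      have hpe : p ∈ e.1.image (wf p T) := by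
        have := congrArg Subtype.val hei
        rw [image_val] at this
        rwa [this]
      -- A vertex of `e` over `p`. If it is some `t`, unfolding `t` in the face `B ∪ {t}` shows that
      -- `s ∪ t` is a face when `t` is divided, as `p ∈ t`.
      obtain ⟨d, hd, hdp⟩ := Finset.mem_image.mp hpe
      refine ⟨d, (hmds d).mpr ?_, hd⟩
      by_cases h : ∃ t ∈ T, d = ofSet t
      · right
        obtain ⟨t, ht, rfl⟩ := h
        obtain ⟨T₀, T₁, eT⟩ := List.append_of_mem ht
        obtain ⟨htT, hT₀, hT₁⟩ := hmem eT
        refine mem_colD.mpr ⟨T₀, t, T₁, eT, rfl, ?_⟩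
        have h1 : Fa (T ++ q) (insert (ofSet t) B) := heF.fa.mono (Finset.insert_subset hd hBe)
        rw [eT, List.append_assoc, List.cons_append, fa_append T₀ fun r hr h => by
          rcases Finset.mem_insert.mp h with h | h
          · exact hsplit T₀ t T₁ eT r hr h
          · exact hnT r (hT₀ r hr) h] at h1
        have htF : ofSet t ∉ vr (T₁ ++ q) := by
          refine notMem_vr_append (hTF t ht).notMem_vr fun z hz e => ?_
          have := nodup_of_pairwise H.hP
          rw [eT, List.nodup_append, List.nodup_cons] at this
          exact this.2.1.1 (ofSet_injective e ▸ hz)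
        obtain ⟨-, ⟨h2, -⟩ | ⟨-, h2⟩⟩ := (fa_cons htF).mp h1.1
        · simp at h2
        · refine (h2.mono fun x hx => ?_).isFace
          rw [Finset.erase_insert (hnT t ht), Finset.mem_union]
          rcases Finset.mem_union.mp hx with hx | hx
          · by_cases hxp : x = p
            · exact Or.inr (hxp ▸ (H.hT t ht).2.1)
            · exact Or.inl (Finset.mem_erase.mpr ⟨hxp, hx⟩)
          · exact Or.inr hx
      · left
        have hdp : d = p := by rw [← hdp, show wf p T d = d from if_neg h]
        refine ⟨hdp, heF.mono fun x hx => ?_⟩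
        by_cases hxp : x = p
        · rw [hxp, ← hdp]; exact hd
        · exact hBe (Finset.mem_erase.mpr ⟨hxp, hx⟩)
    · intro a ha b hb hab
      refine (hE _).mpr ⟨hab, ?_⟩
      rw [image_union_val, ((hE a).mp ha).2, ((hE b).mp hb).2, union_self_eq]
  obtain ⟨h, h1, h2, -, h4, h5, h6⟩ := pw_columns T [] H (by simp)
  have hequiv : CombEquiv ((ds.map (FinPlus.ins B)).reverse ++ (T ++ q))
      (colY q p s T ++ s :: (T ++ q)) := by
    rw [hds, List.map_append, List.reverse_append, colD_map_reverse, List.append_assoc]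
    refine CombEquiv.append_left _ ?_
    split_ifs with hF
    · rw [List.map_singleton, hinsp]
      exact .refl _
    · exact (CombEquiv.drop _ _ hF).symm
  have hTx : ∀ t ∈ T, ∀ v, t.1 ≠ {v} := by
    intro t ht v hv
    obtain ⟨-, h1, h2⟩ := H.hT t ht
    rw [hv, Finset.mem_singleton] at h1
    exact h2 (h1 ▸ hv)
  refine ⟨h ∘ f, h1.comp (hf1.congr (.refl _) hequiv fun _ _ => rfl), fun x hx => ?_, fun e he => ?_,
    fun t ht => ?_⟩
  · rw [Function.comp_apply, hf2 x (mem_vr_append_of_ne T hx fun t ht => hTx t ht x)]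
    exact h2 x hx
  · obtain ⟨d, hd, hfe⟩ := hf3 e he
    rw [Function.comp_apply, hfe]
    rcases (hmds d).mp hd with ⟨rfl, hF⟩ | hd
    · rw [hinsp]
      -- A member of `T` is not a face after the division by `T`.
      refine h6 fun hsT => ?_
      exact (hF.of_append fun r hr => (hTF r hr).notMem hs).2 s hsT subset_rfl
    · refine h4 _ ?_
      rw [← colD_map_reverse, List.mem_reverse]
      exact List.mem_map_of_mem hd
  · rw [Function.comp_apply, hf2]
    · exact h5 t ht
    · obtain ⟨T₀, T₁, e⟩ := List.append_of_mem ht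
      have hP := H.hP
      rw [e, List.pairwise_append, List.pairwise_cons] at hP
      have hF : IsFace (T₁ ++ q) t := (hTF t ht).append (fun r hr => hTF r ((hmem e).2.2 r hr))
        hP.2.1.1
      have := mem_vr_append_of_ne T₀ hF.ofSet_mem_vr_cons fun a ha => hTx a ((hmem e).2.1 a ha) _
      rw [e]
      simpa using this

/-! ### Pulling a division back along a map. -/

/-- Since the sets of the list do not contain one another, a set that is a face after some of the
divisions was one before; the others drop out. -/
theorem CombEquiv.filter_isFace {d : SetSeq Ur} : ∀ {L : SetSeq Ur},
    (∀ r ∈ L, ∀ r' ∈ L, ofSet r ∉ r'.1) →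
    CombEquiv (L.filter (fun z => IsFace d z) ++ d) (L ++ d)
  | [], _ => .refl _
  | a :: L, h => by
    have ih := CombEquiv.filter_isFace (d := d) (L := L) fun r hr r' hr' =>
      h r (List.mem_cons_of_mem _ hr) r' (List.mem_cons_of_mem _ hr')
    by_cases ha : IsFace d a
    · rw [List.filter_cons_of_pos (by simpa using ha)]
      exact .cons a ih
    · rw [List.filter_cons_of_neg (by simpa using ha)]
      refine ih.trans (CombEquiv.drop a (L ++ d) fun hF => ha ?_).symm
      exact (hF.of_append fun r hr => h r (List.mem_cons_of_mem _ hr) a List.mem_cons_self).1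

theorem image_image (f g : Elem Ur → Elem Ur) (z : FinPlus Ur) :
    (z.image g).image f = z.image (f ∘ g) := Subtype.ext Finset.image_image

/-- A pure weld-division map with a divided domain can be precomposed with a map that has unique
preimages for all relevant vertices; the division is then pulled back along this map. -/
theorem PW.transfer {d d₁ c E₁ : SetSeq Ur} {h f₁ F₁ g : Elem Ur → Elem Ur} {S : Set (FinPlus Ur)}
    (H : PW d d₁ h) (H₁ : PW (E₁ ++ d₁) c F₁)
    (hE₁ : ∀ x, x ∈ E₁ ↔ IsFace d₁ x ∧ x.image f₁ ∈ S)
    (hP : E₁.Pairwise fun a b => ¬ b.1 ⊆ a.1)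
    (hg : ∀ e ∈ E₁, ∀ v ∈ e.1, g v ∈ vr d ∧ h (g v) = v ∧ ∀ x ∈ vr d, h x = v → x = g v)
    (hfr : ∀ e ∈ E₁, ofSet (e.image g) ∉ vr d) :
    ∃ L F, PW (L ++ d) c F ∧ (∀ x, x ∈ L ↔ IsFace d x ∧ x.image (f₁ ∘ h) ∈ S) ∧
      (L.Pairwise fun a b => ¬ b.1 ⊆ a.1) ∧ (∀ x ∈ vr d, F x = F₁ (h x)) ∧
      ∀ x ∈ L, x.image h ∈ E₁ ∧ F (ofSet x) = F₁ (ofSet (x.image h)) := by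
  have himg : ∀ e ∈ E₁, (e.image g).image h = e := fun e he => by
    rw [image_image]
    exact image_eq_self fun v hv => (hg e he v hv).2.1
  -- As `g` picks the unique preimage under `h`, the sets to divide by upstairs are the `g`-images
  -- of those downstairs. Some need not be faces of `d`; they are filtered out at the end.
  set L := E₁.map (FinPlus.image g) with hL
  have hmL : ∀ z, z ∈ L ↔ ∃ e ∈ E₁, e.image g = z := fun z => List.mem_map
  have hLv : ∀ z ∈ L, ∀ v ∈ z.1, v ∈ vr d := by
    intro z hz v hv
    obtain ⟨e, he, rfl⟩ := (hmL z).mp hz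
    obtain ⟨w, hw, rfl⟩ := Finset.mem_image.mp hv
    exact (hg e he w hw).1
  have hLf : ∀ z ∈ L, ofSet z ∉ vr d := by
    intro z hz
    obtain ⟨e, he, rfl⟩ := (hmL z).mp hz
    exact hfr e he
  have hLh : ∀ z ∈ L, z.image h ∈ E₁ := by
    intro z hz
    obtain ⟨e, he, rfl⟩ := (hmL z).mp hz
    rwa [himg e he]
  have hmap : L.map (FinPlus.image h) = E₁ := by
    rw [hL, List.map_map]
    conv_rhs => rw [← List.map_id E₁]
    exact List.map_congr_left fun e he => himg e he
  have hLP : L.Pairwise fun a b => ¬ b.1 ⊆ a.1 := by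
    rw [← hmap, List.pairwise_map] at hP
    exact hP.imp fun hab h' => hab (Finset.image_subset_image h')
  -- The set underlying a vertex is recovered by choice; `FinPlus.sing x` is a default that is never
  -- reached.
  set F₀ : Elem Ur → Elem Ur := fun x => if ∃ z ∈ L, x = ofSet z then ofSet
    (if hx : ∃ z, x = ofSet z then hx.choose.image h else FinPlus.sing x) else h x with hF₀
  have hF₀L : ∀ z ∈ L, F₀ (ofSet z) = ofSet (z.image h) := by
    intro z hz
    have h1 : ∃ w ∈ L, ofSet z = ofSet w := ⟨z, hz, rfl⟩
    have h2 : ∃ w, ofSet z = ofSet w := ⟨z, rfl⟩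
    rw [hF₀]
    simp only [if_pos h1, dif_pos h2]
    rw [← ofSet_injective h2.choose_spec]
  have hF₀d : ∀ x ∈ vr d, F₀ x = h x := fun x hx =>
    if_neg fun ⟨z, hz, e⟩ => hLf z hz (e ▸ hx)
  have key : PW (L ++ d) (E₁ ++ d₁) F₀ := by
    rw [← hmap]
    refine H.append L hLv hLf ?_ ?_ hF₀d hF₀L
    · intro z hz v hv x hx hxv
      obtain ⟨e, he, rfl⟩ := (hmL z).mp hz
      obtain ⟨w, hw, rfl⟩ := Finset.mem_image.mp hv
      obtain ⟨-, h1, h2⟩ := hg e he w hw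
      exact h2 x hx (hxv.trans h1)
    · refine hLP.imp fun hab v hv e => hab ?_
      rw [e]
      exact Finset.singleton_subset_iff.mpr hv
  refine ⟨L.filter (fun z => IsFace d z), F₁ ∘ F₀, (H₁.comp key).congr
    (CombEquiv.filter_isFace fun r hr r' hr' hm => hLf r hr (hLv r' hr' _ hm)).symm (.refl _)
    fun _ _ => rfl, fun x => ?_, hLP.filter _, fun x hx => ?_, fun x hx => ?_⟩
  · rw [List.mem_filter, decide_eq_true_iff]
    constructor
    · rintro ⟨h1, h2⟩
      refine ⟨h2, ?_⟩
      rw [← image_image]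
      exact ((hE₁ _).mp (hLh x h1)).2
    · rintro ⟨h1, h2⟩
      refine ⟨(hmL x).mpr ⟨x.image h, (hE₁ _).mpr ⟨H.isFace h1, by rwa [image_image]⟩, ?_⟩, h1⟩
      have he : x.image h ∈ E₁ := (hE₁ _).mpr ⟨H.isFace h1, by rwa [image_image]⟩
      rw [image_image]
      refine image_eq_self fun v hv => ?_
      exact ((hg _ he (h v) (Finset.mem_image_of_mem h hv)).2.2 v (h1.mem_vr hv) rfl).symm
  · rw [Function.comp_apply, hF₀d x hx]
  · have hx' := (List.mem_filter.mp hx).1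
    exact ⟨hLh x hx', by rw [Function.comp_apply, hF₀L x hx']⟩

/-! ### Enumerations, finiteness of fibers, and weld maps of families. -/

theorem IsNonDecEnum.pairwise {E : SetSeq Ur} {S : Set (FinPlus Ur)} (h : IsNonDecEnum E S) :
    E.Pairwise fun a b => ¬ b.1 ⊆ a.1 := by
  rw [List.pairwise_iff_get]
  intro i j hij hs
  exact absurd (h.2.2 j i hs) (not_le.mpr hij)

theorem exists_pairwise_enum {S : Set (FinPlus Ur)} (h : S.Finite) :
    ∃ E : SetSeq Ur, (∀ x, x ∈ E ↔ x ∈ S) ∧ E.Pairwise fun a b => ¬ b.1 ⊆ a.1 := by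
  obtain ⟨E, hE⟩ := exists_isNonDecEnum h.toFinset
  exact ⟨E, fun x => by rw [hE.2.1]; simp, hE.pairwise⟩

/-- A family of sets with elements in a fixed finite set is finite. -/
theorem finite_of_subset (V : Finset (Elem Ur)) {S : Set (FinPlus Ur)} (h : ∀ x ∈ S, x.1 ⊆ V) :
    S.Finite :=
  Set.Finite.of_finite_image (f := Subtype.val)
    (V.powerset.finite_toSet.subset (by rintro _ ⟨x, hx, rfl⟩; simpa using h x hx))
    Subtype.val_injective.injOn

theorem finite_wf_fiber (p : Elem Ur) (T d : SetSeq Ur) (s : FinPlus Ur) :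
    {x | IsFace d x ∧ x.image (wf p T) = s}.Finite := by
  refine finite_of_subset (s.1 ∪ (T.map ofSet).toFinset) ?_
  rintro x ⟨-, hx⟩ v hv
  rw [Finset.mem_union]
  by_cases h : ∃ t ∈ T, v = ofSet t
  · obtain ⟨t, ht, rfl⟩ := h
    exact Or.inr (List.mem_toFinset.mpr (List.mem_map_of_mem ht))
  · left
    rw [← hx, image_val]
    refine Finset.mem_image.mpr ⟨v, hv, if_neg h⟩

theorem wf_cons {p : Elem Ur} {t : FinPlus Ur} {T : SetSeq Ur} {x : Elem Ur} (h : x ≠ ofSet t) :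
    wf p (t :: T) x = wf p T x := by
  unfold wf
  simp [h]

/-- The members of `T` are welded to `p` one after the other, the leftmost first; no division is
involved. -/
theorem pw_weldFamily {q : SetSeq Ur} {p : Elem Ur} (hp : p ∈ vr q) : ∀ {T : SetSeq Ur},
    (∀ t ∈ T, IsFace q t ∧ p ∈ t.1) → (T.Pairwise fun a b => ¬ b.1 ⊆ a.1) →
    PW (T ++ q) q (wf p T)
  | [], _, _ => (pw_id hp).congr_fun fun _ _ => (wf_of_ne (by simp)).symm
  | t :: T, hT, hP => by
    simp only [List.forall_mem_cons] at hT
    have hP' := List.pairwise_cons.mp hP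
    have ht : ofSet t ∉ vr (T ++ q) := notMem_vr_append hT.1.1.notMem_vr fun z hz e =>
      (List.nodup_cons.mp (nodup_of_pairwise hP)).1 (ofSet_injective e ▸ hz)
    have h1 : PW (t :: (T ++ q)) (T ++ q) (Function.update id (ofSet t) p) :=
      pw_weld ht (by simpa using hT.1.2) fun x hx => by
        rw [Function.update_of_ne (by rintro rfl; exact ht hx)]; rfl
    refine ((pw_weldFamily hp hT.2 hP'.2).comp h1).congr_fun fun x hx => ?_
    rw [Function.comp_apply]
    by_cases hxt : x = ofSet t
    · subst hxt
      rw [Function.update_self, wf_mem List.mem_cons_self]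
      exact wf_of_mem_vr (fun r hr => (hT.2 r hr).1) hp
    · rw [Function.update_of_ne hxt, wf_cons hxt]; rfl

theorem ofSet_mem_vr_append {q : SetSeq Ur} {T : SetSeq Ur} (hT : ∀ t ∈ T, IsFace q t)
    (hx : ∀ t ∈ T, ∀ v, t.1 ≠ {v}) (hP : T.Pairwise fun a b => ¬ b.1 ⊆ a.1) {t : FinPlus Ur}
    (ht : t ∈ T) : ofSet t ∈ vr (T ++ q) := by
  obtain ⟨T₀, T₁, rfl⟩ := List.append_of_mem ht
  rw [List.pairwise_append, List.pairwise_cons] at hP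
  have hF : IsFace (T₁ ++ q) t := (hT t ht).append (fun r hr => hT r (by simp [hr])) hP.2.1.1
  have := mem_vr_append_of_ne T₀ hF.ofSet_mem_vr_cons fun a ha => hx a (by simp [ha]) _
  simpa using this

/-! ### Induction over the members of `S` that contain `p` and differ from `{p}`. -/

/-- `F` is the map obtained from `f` by division based on the family `S`, and it is a pure
weld-division map. -/
structure Good (d c : SetSeq Ur) (f : Elem Ur → Elem Ur) (S : Set (FinPlus Ur))
    (E Sl : SetSeq Ur) (F : Elem Ur → Elem Ur) : Prop where
  mem_dom : ∀ x, x ∈ E ↔ IsFace d x ∧ x.image f ∈ S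
  dom_pairwise : E.Pairwise fun a b => ¬ b.1 ⊆ a.1
  mem_cod : ∀ s, s ∈ Sl ↔ s ∈ S
  cod_pairwise : Sl.Pairwise fun a b => ¬ b.1 ⊆ a.1
  pw : PW (E ++ d) (Sl ++ c) F
  eq_of_vr : ∀ x ∈ vr (E ++ d), x ∈ vr d → F x = f x
  eq_of_mem : ∀ e ∈ E, F (ofSet e) = ofSet (e.image f)

theorem ne_singleton_of_image {f : Elem Ur → Elem Ur} {p : Elem Ur} {x s : FinPlus Ur}
    (h : x.image f = s) (hp : p ∈ s.1) (hsp : s.1 ≠ {p}) (v : Elem Ur) : x.1 ≠ {v} := by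
  intro hv
  have h1 : s.1 = {f v} := by rw [← h, image_val, hv, Finset.image_singleton]
  rw [h1, Finset.mem_singleton] at hp
  exact hsp (hp ▸ h1)

theorem colT_of_subset {p : Elem Ur} {s t : FinPlus Ur} (h : s.1 ⊆ t.1) :
    colT p s t = FinPlus.refold p s t := if_pos h

theorem colT_of_not {p : Elem Ur} {s t : FinPlus Ur} (h : ¬ s.1 ⊆ t.1) : colT p s t = t := if_neg h

theorem mem_colT {p : Elem Ur} {s t : FinPlus Ur} (ht : p ∈ t.1) : p ∈ (colT p s t).1 := by
  by_cases h : s.1 ⊆ t.1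
  · rw [colT_of_subset h, mem_refold]
    exact Or.inl rfl
  · rwa [colT_of_not h]

/-- The replacement of `t` reflects inclusion: it records `t` outside `s` and, through the element
`s`, whether `t` includes `s`. Hence the new list is again non-decreasing, and distinct members stay
distinct. -/
theorem subset_of_colT_subset {p : Elem Ur} {s a b : FinPlus Ur} (ha : ofSet s ∉ a.1)
    (hb : ofSet s ∉ b.1) (hpa : p ∈ a.1) (h : (colT p s b).1 ⊆ (colT p s a).1) : b.1 ⊆ a.1 := by
  by_cases hsa : s.1 ⊆ a.1 <;> by_cases hsb : s.1 ⊆ b.1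
  · rw [colT_of_subset hsa, colT_of_subset hsb] at h
    intro x hx
    by_cases hxs : x ∈ s.1
    · exact hsa hxs
    · rcases mem_refold.mp (h (mem_refold.mpr (Or.inr (Or.inr ⟨hx, hxs⟩)))) with h | h | h
      · exact h ▸ hpa
      · exact absurd (h ▸ hx) hb
      · exact h.1
  · rw [colT_of_subset hsa, colT_of_not hsb] at h
    intro x hx
    rcases mem_refold.mp (h hx) with h | h | h
    · exact h ▸ hpa
    · exact absurd (h ▸ hx) hb
    · exact h.1
  · rw [colT_of_not hsa, colT_of_subset hsb] at h
    exact absurd (h (mem_refold.mpr (Or.inr (Or.inl rfl)))) ha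
  · rwa [colT_of_not hsa, colT_of_not hsb] at h

theorem ColHyp.isFace_colT {q : SetSeq Ur} {p : Elem Ur} {s : FinPlus Ur} {T : SetSeq Ur}
    (H : ColHyp q p s T) {t : FinPlus Ur} (ht : t ∈ T) : IsFace (s :: q) (colT p s t) := by
  obtain ⟨htF, hpt, -⟩ := H.hT t ht
  by_cases h : s.1 ⊆ t.1
  · rw [colT_of_subset h]
    refine Fa.isFace (fa_cons_intro (fun h' => H.hsp ?_) (Or.inr ⟨mem_refold.mpr (by simp), ?_⟩))
    · refine Finset.eq_singleton_iff_unique_mem.mpr ⟨H.hps, fun x hx => ?_⟩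
      rcases mem_refold.mp (h' hx) with h1 | h1 | h1
      · exact h1
      · exact absurd (h1 ▸ hx) (notMem_self s)
      · exact absurd hx h1.2
    · refine htF.fa.mono fun x hx => ?_
      rcases Finset.mem_union.mp hx with hx | hx
      · obtain ⟨h1, h2⟩ := Finset.mem_erase.mp hx
        rcases mem_refold.mp h2 with h2 | h2 | h2
        · exact h2 ▸ hpt
        · exact absurd h2 h1
        · exact h2.1
      · exact h hx
  · rw [colT_of_not h]
    exact htF.append (L := [s]) (by simpa using H.hs) (by simpa using h)

theorem ColHyp.colT_ne {q : SetSeq Ur} {p : Elem Ur} {s : FinPlus Ur} {T : SetSeq Ur}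
    (H : ColHyp q p s T) {t : FinPlus Ur} (ht : t ∈ T) : (colT p s t).1 ≠ {p} := by
  by_cases h : s.1 ⊆ t.1
  · rw [colT_of_subset h]
    intro h'
    have : ofSet s ∈ (FinPlus.refold p s t).1 := mem_refold.mpr (by simp)
    rw [h', Finset.mem_singleton] at this
    exact H.hs.notMem_vr (this ▸ H.hs.mem_vr H.hps)
  · rw [colT_of_not h]
    exact (H.hT t ht).2.2

theorem ColHyp.colT_pairwise {q : SetSeq Ur} {p : Elem Ur} {s : FinPlus Ur} {T : SetSeq Ur}
    (H : ColHyp q p s T) : (T.map (colT p s)).Pairwise fun a b => ¬ b.1 ⊆ a.1 := by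
  rw [List.pairwise_map]
  refine H.hP.imp_of_mem fun {a b} ha hb h h' => h ?_
  exact subset_of_colT_subset (H.hs.notMem (H.hT a ha).1) (H.hs.notMem (H.hT b hb).1)
    (H.hT a ha).2.1 h'

/-- The hypotheses persist after a division based on a maximal member of the family. -/
theorem ColHyp.divide {q : SetSeq Ur} {p : Elem Ur} {s s' : FinPlus Ur} {T : SetSeq Ur}
    (H : ColHyp q p s T) (H' : ColHyp q p s' T) (hss : ¬ s.1 ⊆ s'.1)
    (hU : IsFace q (s'.union s) → s'.1 ⊆ s.1) : ColHyp (s :: q) p s' (T.map (colT p s)) where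
  hs := H'.hs.append (L := [s]) (by simpa using H.hs) (by simpa using hss)
  hps := H'.hps
  hsp := H'.hsp
  hT := by
    intro t' ht'
    obtain ⟨t, ht, rfl⟩ := List.mem_map.mp ht'
    exact ⟨H.isFace_colT ht, mem_colT (H.hT t ht).2.1, H.colT_ne ht⟩
  hP := H.colT_pairwise
  tri := by
    intro T₀' t' T₁' e hF
    obtain ⟨T₀, R, rfl, rfl, e'⟩ := List.map_eq_append_iff.mp e
    obtain ⟨t, T₁, rfl, rfl, rfl⟩ := List.map_eq_cons_iff.mp e'
    have ht : t ∈ T₀ ++ t :: T₁ := by simp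
    have hT₁ : ∀ r ∈ T₁, r ∈ T₀ ++ t :: T₁ := fun r hr => by simp [hr]
    have hs' : IsFace (s :: q) s' :=
      H'.hs.append (L := [s]) (by simpa using H.hs) (by simpa using hss)
    obtain ⟨h1, h2⟩ := hF.of_append fun r' hr' => by
      obtain ⟨r, hr, rfl⟩ := List.mem_map.mp hr'
      rw [union_val, Finset.mem_union, not_or]
      have hr := H.isFace_colT (hT₁ r hr)
      exact ⟨hr.notMem hs', hr.notMem (H.isFace_colT ht)⟩
    -- If `t` was replaced, a face through the vertex `s` unfolds to show that `s' ∪ s` is a face.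
    -- Then `s' ⊆ s`, and the replacement meets `s'` only in `p`. If `t` was kept, the old
    -- alternative is inherited.
    by_cases hst : s.1 ⊆ t.1
    · right
      rw [colT_of_subset hst] at h1 ⊢
      have h3 : IsFace q (s'.union s) := by
        obtain ⟨-, ⟨h3, -⟩ | ⟨-, h3⟩⟩ := (fa_cons H.hs.notMem_vr).mp h1.fa
        · exact absurd (Finset.mem_union_right _ (mem_refold.mpr (by simp))) h3
        · refine (h3.mono (Finset.union_subset_union (fun x hx => ?_) subset_rfl)).isFace
          refine Finset.mem_erase.mpr ⟨fun e => H.hs.notMem H'.hs (e ▸ hx),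
            Finset.mem_union_left _ hx⟩
      refine Finset.eq_singleton_iff_unique_mem.mpr
        ⟨Finset.mem_inter.mpr ⟨H'.hps, mem_refold.mpr (by simp)⟩, fun x hx => ?_⟩
      obtain ⟨hx1, hx2⟩ := Finset.mem_inter.mp hx
      rcases mem_refold.mp hx2 with h | h | h
      · exact h
      · exact absurd (h ▸ hx1) (H.hs.notMem H'.hs)
      · exact absurd (hU h3 hx1) h.2
    · rw [colT_of_not hst] at h1 h2 ⊢
      have hns : ofSet s ∉ (s'.union t).1 := by
        rw [union_val, Finset.mem_union, not_or]
        exact ⟨H.hs.notMem H'.hs, H.hs.notMem (H.hT t ht).1⟩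
      obtain ⟨h3, h4⟩ := IsFace.of_append (L := [s]) h1 (by simpa using hns)
      refine H'.tri T₀ t T₁ rfl (h3.append (fun r hr => (H.hT r (hT₁ r hr)).1) fun r hr h5 => ?_)
      by_cases hsr : s.1 ⊆ r.1
      · exact h4 s (by simp) (hsr.trans h5)
      · exact h2 _ (List.mem_map_of_mem hr) (by rwa [colT_of_not hsr])

/-- The induction varies `q` and `T` as well: after one set `s` is divided, the rest is handled over
`s q` with the replaced family, and the result is pulled back along the map of `pw_column`. -/
theorem exists_good_of_colHyp {p : Elem Ur} : ∀ (n : ℕ) (q T : SetSeq Ur) (S : Finset (FinPlus Ur)),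
    S.card = n → IsAdditive q (S : Set (FinPlus Ur)) → (∀ s ∈ S, ColHyp q p s T) →
    (∀ t ∈ T, IsFace q t ∧ p ∈ t.1) → (T.Pairwise fun a b => ¬ b.1 ⊆ a.1) → p ∈ vr q →
    ∃ E Sl F, Good (T ++ q) q (wf p T) (S : Set (FinPlus Ur)) E Sl F := by
  intro n
  induction n with
  | zero =>
    intro q T S hn _ _ hT hP hp
    rw [Finset.card_eq_zero] at hn
    subst hn
    exact ⟨[], [], wf p T, by simp, by simp, by simp, by simp, pw_weldFamily hp hT hP,
      fun _ _ _ => rfl, by simp⟩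
  | succ n ih =>
    intro q T S hn hS hH _ _ hp
    -- A set of largest cardinality is included in no other member, so it can stand last in the
    -- list, where it is divided first.
    obtain ⟨s, hsS, hsmax⟩ := S.exists_max_image (fun s => s.1.card)
      (Finset.card_pos.mp (by omega))
    have H := hH s hsS
    have hs := H.hs
    have hTF : ∀ t ∈ T, IsFace q t := fun t ht => (H.hT t ht).1
    have hTx : ∀ t ∈ T, ∀ v, t.1 ≠ {v} := by
      intro t ht v hv
      obtain ⟨-, h1, h2⟩ := H.hT t ht
      rw [hv, Finset.mem_singleton] at h1
      exact h2 (h1 ▸ hv)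
    have hmax : ∀ s' ∈ S, s.1 ⊆ s'.1 → s' = s := fun s' hs' h =>
      (Subtype.ext (Finset.eq_of_subset_of_card_le h (hsmax s' hs'))).symm
    have hmax' : ∀ s' ∈ S.erase s, ¬ s.1 ⊆ s'.1 := fun s' hs' h =>
      (Finset.mem_erase.mp hs').1 (hmax s' (Finset.mem_erase.mp hs').2 h)
    obtain ⟨Es, hmE, hEP⟩ := exists_pairwise_enum (finite_wf_fiber p T (T ++ q) s)
    simp only [Set.mem_ofPred_eq] at hmE
    have hEF : ∀ e ∈ Es, IsFace (T ++ q) e := fun e he => ((hmE e).mp he).1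
    have hEi : ∀ e ∈ Es, e.image (wf p T) = s := fun e he => ((hmE e).mp he).2
    have hEx : ∀ e ∈ Es, ∀ v, e.1 ≠ {v} := fun e he =>
      ne_singleton_of_image (hEi e he) H.hps H.hsp
    obtain ⟨h, hpw, hq, hE, hT⟩ := pw_column H hmE hEP
    have hS' : IsAdditive (s :: q) ((S.erase s : Finset _) : Set (FinPlus Ur)) := by
      have hF : ∀ s' ∈ S.erase s, IsFace (s :: q) s' := fun s' hs' =>
        (hS.1 s' (Finset.mem_erase.mp hs').2).append (L := [s]) (by simpa using hs)
          (by simpa using hmax' s' hs')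
      refine ⟨hF, fun a ha b hb hab => ?_⟩
      have ha' := (Finset.mem_erase.mp ha).2
      have hb' := (Finset.mem_erase.mp hb).2
      obtain ⟨h1, h2⟩ := IsFace.of_append (L := [s]) hab (by
        simpa [union_val] using ⟨hs.notMem (hS.1 a ha'), hs.notMem (hS.1 b hb')⟩)
      refine Finset.mem_coe.mpr (Finset.mem_erase.mpr ⟨fun e => h2 s (by simp) ?_,
        hS.2 a ha' b hb' h1⟩)
      rw [e]
    have hH' : ∀ s' ∈ S.erase s, ColHyp (s :: q) p s' (T.map (colT p s)) := by
      intro s' hs'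
      have hs'S := (Finset.mem_erase.mp hs').2
      refine H.divide (hH s' hs'S) (hmax' s' hs') fun hF => ?_
      have h1 := hmax _ (hS.2 s' hs'S s hsS hF) Finset.subset_union_right
      rw [← h1]
      exact Finset.subset_union_left
    have hvq : ∀ v ∈ vr q, v ∈ vr (s :: q) := fun v hv => by
      refine mem_vr_append_of_ne [s] hv ?_
      intro z hz e
      rw [List.mem_singleton.mp hz] at e
      have := H.hps
      rw [e, Finset.mem_singleton] at this
      exact H.hsp (this ▸ e)
    have hT'F : ∀ t ∈ T.map (colT p s), IsFace (s :: q) t ∧ p ∈ t.1 := by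
      intro t' ht'
      obtain ⟨t, ht, rfl⟩ := List.mem_map.mp ht'
      exact ⟨H.isFace_colT ht, mem_colT (H.hT t ht).2.1⟩
    obtain ⟨E₁, S₁, F₁, G⟩ := ih (s :: q) (T.map (colT p s)) (S.erase s)
      (by rw [Finset.card_erase_of_mem hsS]; omega) hS' hH' hT'F H.colT_pairwise (hvq p hp)
    set f₁ := wf p (T.map (colT p s)) with hf₁
    have hf₁T : ∀ t ∈ T, f₁ (ofSet (colT p s t)) = p := fun t ht =>
      wf_mem (List.mem_map_of_mem ht)
    have hf₁v : ∀ v ∈ vr (s :: q), f₁ v = v := fun v hv =>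
      wf_of_mem_vr (fun t ht => (hT'F t ht).1) hv
    have hfh : ∀ x ∈ vr (T ++ q), f₁ (h x) = wf p T x := by
      intro x hx
      rcases mem_vr_of_append hx with hx | ⟨t, ht, rfl⟩
      · rw [hq x hx, hf₁v x (hvq x hx), wf_of_mem_vr hTF hx]
      · rw [hT t ht, hf₁T t ht, wf_mem ht]
    have hEv : ∀ e ∈ E₁, ∀ v ∈ e.1, v ∈ vr q ∨ ∃ t ∈ T, v = ofSet (colT p s t) := by
      intro e he v hv
      by_cases h' : ∃ t ∈ T, v = ofSet (colT p s t)
      · exact Or.inr h'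
      · left
        have h1 := (hS.1 _ (Finset.mem_erase.mp ((G.mem_dom e).mp he).2).2)
        refine h1.mem_vr (Finset.mem_image.mpr ⟨v, hv, wf_of_ne fun t' ht' e => h' ?_⟩)
        obtain ⟨t, ht, rfl⟩ := List.mem_map.mp ht'
        exact ⟨t, ht, e⟩
    -- The section of `h`: it undoes the replacement of `t` and fixes the rest. It is needed only on
    -- vertices of members of `E₁`, and the vertex `s`, onto which the fiber collapses, is not among
    -- them.
    set g : Elem Ur → Elem Ur := fun x =>
      if hx : ∃ t ∈ T, x = ofSet (colT p s t) then ofSet hx.choose else x with hg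
    have hinj : ∀ a ∈ T, ∀ b ∈ T, ofSet (colT p s a) = ofSet (colT p s b) → a = b := by
      intro a ha b hb e
      have e' := ofSet_injective e
      have h1 := hs.notMem (hTF a ha)
      have h2 := hs.notMem (hTF b hb)
      exact Subtype.ext (Finset.Subset.antisymm
        (subset_of_colT_subset h2 h1 (H.hT b hb).2.1 (by rw [e']))
        (subset_of_colT_subset h1 h2 (H.hT a ha).2.1 (by rw [e'])))
    have hgT : ∀ t ∈ T, g (ofSet (colT p s t)) = ofSet t := by
      intro t ht
      have hx : ∃ r ∈ T, ofSet (colT p s t) = ofSet (colT p s r) := ⟨t, ht, rfl⟩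
      rw [hg]
      simp only [dif_pos hx]
      exact congrArg ofSet (hinj _ ht _ hx.choose_spec.1 hx.choose_spec.2).symm
    have hneT : ∀ v ∈ vr q, ∀ t ∈ T, v ≠ ofSet (colT p s t) := fun v hv t ht =>
      (H.isFace_colT ht).mem_vr_ne (hvq v hv)
    have hgq : ∀ v ∈ vr q, g v = v := fun v hv => dif_neg fun ⟨t, ht, e⟩ => hneT v hv t ht e
    have hsT : ∀ t ∈ T, ofSet s ≠ ofSet (colT p s t) := fun t ht e =>
      not_fa_cons_of_subset (q := q) (a := s) subset_rfl (by
        have := H.isFace_colT ht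
        rw [← ofSet_injective e] at this
        exact this.fa)
    have hwg : ∀ e ∈ E₁, (e.image g).image (wf p T) = e.image f₁ := by
      intro e he
      rw [image_image]
      refine image_congr_fun fun v hv => ?_
      rw [Function.comp_apply]
      rcases hEv e he v hv with hv | ⟨t, ht, rfl⟩
      · rw [hgq v hv, wf_of_mem_vr hTF hv, hf₁v v (hvq v hv)]
      · rw [hgT t ht, wf_mem ht, hf₁T t ht]
    obtain ⟨L, F, hF1, hF2, hF3, hF4, hF5⟩ := hpw.transfer (g := g) G.pw G.mem_dom G.dom_pairwise
      (by
        intro e he v hv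
        rcases hEv e he v hv with hv | ⟨t, ht, rfl⟩
        · rw [hgq v hv]
          refine ⟨mem_vr_append_of_ne Es (mem_vr_append_of_ne T hv fun t ht => hTx t ht v)
            fun e he => hEx e he v, hq v hv, fun x hx hxv => ?_⟩
          rcases mem_vr_of_append hx with hx | ⟨r, hr, rfl⟩
          · rcases mem_vr_of_append hx with hx | ⟨t, ht, rfl⟩
            · rwa [hq x hx] at hxv
            · rw [hT t ht] at hxv
              exact absurd hxv.symm (hneT v hv t ht)
          · rw [hE r hr] at hxv
            exact absurd hxv.symm (hs.mem_vr_ne hv)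
        · rw [hgT t ht]
          refine ⟨mem_vr_append_of_ne Es (ofSet_mem_vr_append hTF hTx H.hP ht)
            fun e he => hEx e he _, hT t ht, fun x hx hxv => ?_⟩
          rcases mem_vr_of_append hx with hx | ⟨r, hr, rfl⟩
          · rcases mem_vr_of_append hx with hx | ⟨t', ht', rfl⟩
            · rw [hq x hx] at hxv
              exact absurd hxv (hneT x hx t ht)
            · rw [hT t' ht'] at hxv
              rw [hinj _ ht' _ ht hxv]
          · rw [hE r hr] at hxv
            exact absurd hxv (hsT t ht))
      (by
        intro e he
        obtain ⟨heF, hei⟩ := (G.mem_dom e).mp he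
        have hei' := Finset.mem_erase.mp hei
        -- If `e` uses a replaced vertex, its `g`-image contains a face `t` as an element and so is
        -- not a vertex of `q`. Otherwise `e` is itself a face of `q`; it cannot belong to `T`, for
        -- it would be its own replacement and already divided. In either case it is outside the
        -- fiber of `s`, because its image is another member of `S`.
        by_cases hn : ∃ t ∈ T, ofSet (colT p s t) ∈ e.1
        · obtain ⟨t, ht, hte⟩ := hn
          have htm : ofSet t ∈ (e.image g).1 := Finset.mem_image.mpr ⟨_, hte, hgT t ht⟩
          refine notMem_vr_append (notMem_vr_append
            (notMem_vr_of_mem htm (hTF t ht).notMem_tc) fun r hr e' => ?_) fun r hr e' => ?_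
          · rw [ofSet_injective e'] at htm
            exact (hTF t ht).notMem (hTF r hr) htm
          · refine hei'.1 ?_
            rw [← hwg e he, ofSet_injective e']
            exact hEi r hr
        · have hev : ∀ v ∈ e.1, v ∈ vr q := fun v hv => (hEv e he v hv).resolve_right
            fun ⟨t, ht, h'⟩ => hn ⟨t, ht, h' ▸ hv⟩
          have he1 : e.image f₁ = e := image_eq_self fun v hv => hf₁v v (hvq v (hev v hv))
          rw [image_eq_self fun v hv => hgq v (hev v hv)]
          rw [he1] at hei hei'
          have heq : IsFace q e := hS.1 e hei'.2
          refine notMem_vr_append (notMem_vr_append heq.notMem_vr fun r hr e' => ?_)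
            fun r hr e' => ?_
          · have h1 := (heF.of_append fun t' ht' h' => by
              obtain ⟨t, ht, rfl⟩ := List.mem_map.mp ht'
              exact hn ⟨t, ht, h'⟩).2 _ (List.mem_map_of_mem hr)
            rw [← ofSet_injective e', colT_of_not (hmax' e hei)] at h1
            exact h1 subset_rfl
          · refine hei'.1 ?_
            rw [← wf_image_of_subset hTF heq, ofSet_injective e']
            exact hEi r hr)
    have hsub : ∀ x : FinPlus Ur, x.image (wf p T) ∈ S.erase s → ∀ r ∈ Es, ¬ r.1 ⊆ x.1 := by
      intro x hx r hr hrx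
      refine hmax' _ hx ?_
      rw [← hEi r hr]
      exact Finset.image_subset_image hrx
    have himg : ∀ x, IsFace (T ++ q) x → x.image (f₁ ∘ h) = x.image (wf p T) := fun x hx =>
      image_congr_fun fun v hv => hfh v (hx.mem_vr hv)
    have hsv : ofSet s ∉ vr q := hs.notMem_vr
    have hf₁s : f₁ (ofSet s) = ofSet s := wf_of_ne fun t' ht' e => by
      obtain ⟨t, ht, rfl⟩ := List.mem_map.mp ht'
      exact hsT t ht e
    -- Dividing by the fiber of `s` does not affect the fibers of the others: a face through a new
    -- vertex would have an image containing `s` as an element, and a face including a member of the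
    -- fiber would have an image including `s`.
    have hmL : ∀ x, x ∈ L ↔ IsFace (T ++ q) x ∧ x.image (wf p T) ∈ S.erase s := by
      intro x
      rw [hF2]
      constructor
      · rintro ⟨h1, h2⟩
        have h3 : IsFace (T ++ q) x := (h1.of_append fun r hr hrx => by
          refine hsv ((hS.1 _ (Finset.mem_erase.mp h2).2).mem_vr
            (Finset.mem_image.mpr ⟨_, hrx, ?_⟩))
          rw [Function.comp_apply, hE r hr, hf₁s]).1
        rw [himg x h3] at h2
        exact ⟨h3, h2⟩
      · rintro ⟨h1, h2⟩
        refine ⟨h1.append hEF (hsub x h2), ?_⟩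
        rw [himg x h1]
        exact h2
    have hLE : ∀ e ∈ E₁, ∀ v, e.1 ≠ {v} := fun e he =>
      ne_singleton_of_image (f := f₁) rfl (hH _ (Finset.mem_erase.mp ((G.mem_dom e).mp he).2).2).hps
        (hH _ (Finset.mem_erase.mp ((G.mem_dom e).mp he).2).2).hsp
    have hF₁ : ∀ x ∈ vr (T.map (colT p s) ++ s :: q), F₁ x = f₁ x := fun x hx =>
      G.eq_of_vr x (mem_vr_append_of_ne E₁ hx fun e he => hLE e he x) hx
    refine ⟨L ++ Es, S₁ ++ [s], F, fun x => ?_, ?_, fun x => ?_, ?_, ?_, fun x _ hx => ?_,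
      fun e he => ?_⟩
    · rw [List.mem_append, hmL, hmE, Finset.mem_erase, Finset.mem_coe]
      constructor
      · rintro (⟨h1, h2, h3⟩ | ⟨h1, h2⟩)
        · exact ⟨h1, h3⟩
        · exact ⟨h1, h2 ▸ hsS⟩
      · rintro ⟨h1, h2⟩
        by_cases h3 : x.image (wf p T) = s
        · exact Or.inr ⟨h1, h3⟩
        · exact Or.inl ⟨h1, h3, h2⟩
    · exact List.pairwise_append.mpr ⟨hF3, hEP, fun a ha b hb => hsub a ((hmL a).mp ha).2 b hb⟩
    · rw [List.mem_append, G.mem_cod, Finset.mem_coe, Finset.mem_coe, Finset.mem_erase,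
        List.mem_singleton]
      constructor
      · rintro (h | rfl)
        · exact h.2
        · exact hsS
      · intro h
        by_cases h3 : x = s
        · exact Or.inr h3
        · exact Or.inl ⟨h3, h⟩
    · refine List.pairwise_append.mpr ⟨G.cod_pairwise, by simp, fun a ha b hb => ?_⟩
      rw [List.mem_singleton.mp hb]
      exact hmax' a (Finset.mem_coe.mp ((G.mem_cod a).mp ha))
    · simpa using hF1
    · have hx' : x ∈ vr (Es ++ (T ++ q)) := mem_vr_append_of_ne Es hx fun e he => hEx e he x
      rw [hF4 x hx', hF₁ _ (hpw.mem_vr hx'), hfh x hx]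
    · rcases List.mem_append.mp he with he | he
      · obtain ⟨h1, h2⟩ := hF5 e he
        rw [h2, G.eq_of_mem _ h1, image_image, himg e ((hmL e).mp he).1]
      · have hx : ofSet e ∈ vr (Es ++ (T ++ q)) := ofSet_mem_vr_append hEF hEx hEP he
        have h1 := hpw.mem_vr hx
        rw [hF4 _ hx, hF₁ _ h1, hE e he, hf₁s, hEi e he]

/-! ### Adding `{p}` and the sets that do not contain `p`. -/

theorem mem_sing {x y : Elem Ur} : y ∈ (FinPlus.sing x).1 ↔ y = x := Finset.mem_singleton

theorem isFace_sing {q : SetSeq Ur} {x : Elem Ur} (h : x ∈ vr q) : IsFace q (FinPlus.sing x) :=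
  isFace_iff_fa.mpr (mem_vr_iff.mp h)

theorem image_sing (f : Elem Ur → Elem Ur) (x : Elem Ur) :
    (FinPlus.sing x).image f = FinPlus.sing (f x) := Subtype.ext (Finset.image_singleton f x)

theorem wf_self {q : SetSeq Ur} {p : Elem Ur} {T : SetSeq Ur} (hT : ∀ t ∈ T, IsFace q t)
    (hp : p ∈ vr q) : wf p T p = p := wf_of_mem_vr hT hp

/-- The set `{p}` can be added to the family `T`. -/
theorem Good.cons_sing {q T E Sl : SetSeq Ur} {p : Elem Ur} {S : Set (FinPlus Ur)}
    {F : Elem Ur → Elem Ur} (G : Good (T ++ q) q (wf p T) S E Sl F)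
    (hT : ∀ t ∈ T, IsFace q t ∧ p ∈ t.1 ∧ t.1 ≠ {p}) (hp : p ∈ vr q)
    (hS : ∀ s ∈ S, p ∈ s.1 ∧ s.1 ≠ {p}) :
    ∃ E' F', Good (FinPlus.sing p :: T ++ q) q (wf p (FinPlus.sing p :: T)) S E' Sl F' := by
  have hTF : ∀ t ∈ T, IsFace q t := fun t ht => (hT t ht).1
  have hpd : p ∈ vr (T ++ q) := mem_vr_append_of_ne T hp fun t ht => (hT t ht).2.2
  have hpF := isFace_sing hpd
  set u := ofSet (FinPlus.sing p) with hu
  have hud : u ∉ vr (T ++ q) := hpF.notMem_vr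
  have hup : u ≠ p := fun h => hud (h ▸ hpd)
  have hud' : u ∈ vr (FinPlus.sing p :: (T ++ q)) := hpF.ofSet_mem_vr_cons
  -- After division by `{p}` the vertex `p` is gone and `{p}` has taken its place, so the weld of
  -- `{p}` to `p` is a bijective renaming and divisions pull back along it.
  have hpd' : p ∉ vr (FinPlus.sing p :: (T ++ q)) := fun h =>
    not_fa_cons_of_subset (a := FinPlus.sing p) subset_rfl (mem_vr_iff.mp h)
  have hcase : ∀ x ∈ vr (FinPlus.sing p :: (T ++ q)), x = u ∨ (x ≠ u ∧ x ≠ p ∧ x ∈ vr (T ++ q)) := by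
    intro x hx
    rcases mem_vr_cons hx with h | h
    · exact Or.inr ⟨fun e => hud (e ▸ h), fun e => hpd' (e ▸ hx), h⟩
    · exact Or.inl h.1
  set h : Elem Ur → Elem Ur := Function.update id u p with hh
  have hh1 : h u = p := Function.update_self ..
  have hh2 : ∀ x, x ≠ u → h x = x := fun x hx => Function.update_of_ne hx ..
  set g : Elem Ur → Elem Ur := Function.update id p u with hg
  have hg1 : g p = u := Function.update_self ..
  have hg2 : ∀ x, x ≠ p → g x = x := fun x hx => Function.update_of_ne hx ..
  have hpw : PW (FinPlus.sing p :: (T ++ q)) (T ++ q) h := pw_weld hud (mem_sing.mpr hh1)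
    fun x hx => hh2 x fun e => hud (e ▸ hx)
  have hEx : ∀ e ∈ E, ∀ v, e.1 ≠ {v} := fun e he =>
    ne_singleton_of_image (f := wf p T) rfl (hS _ ((G.mem_dom e).mp he).2).1
      (hS _ ((G.mem_dom e).mp he).2).2
  have hEF : ∀ e ∈ E, IsFace (T ++ q) e := fun e he => ((G.mem_dom e).mp he).1
  obtain ⟨L, F', h1, h2, h3, h4, h5⟩ := hpw.transfer (g := g) G.pw G.mem_dom G.dom_pairwise
    (by
      intro e he v hv
      have hvd := (hEF e he).mem_vr hv
      have hvu : v ≠ u := fun e => hud (e ▸ hvd)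
      by_cases hvp : v = p
      · subst hvp
        rw [hg1]
        refine ⟨hud', hh1, fun x hx hxv => ?_⟩
        rcases hcase x hx with h | ⟨h1, h2, -⟩
        · exact h
        · rw [hh2 x h1] at hxv
          exact absurd hxv h2
      · rw [hg2 v hvp]
        refine ⟨mem_vr_append_of_ne [FinPlus.sing p] hvd ?_, hh2 v hvu, fun x hx hxv => ?_⟩
        · intro z hz e
          rw [List.mem_singleton.mp hz] at e
          exact hvp (Finset.singleton_injective e).symm
        · rcases hcase x hx with rfl | ⟨h1, -, -⟩
          · exact absurd (hxv.symm.trans hh1) hvp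
          · rwa [hh2 x h1] at hxv)
    (by
      intro e he
      by_cases hpe : p ∈ e.1
      · have hm : u ∈ (e.image g).1 := Finset.mem_image.mpr ⟨p, hpe, hg1⟩
        refine notMem_vr_cons (notMem_vr_of_mem hm hpF.notMem_tc) fun e' => ?_
        rw [ofSet_injective e', mem_sing] at hm
        exact hup hm
      · rw [image_eq_self fun v hv => hg2 v fun e => hpe (e ▸ hv)]
        refine notMem_vr_cons (hEF e he).notMem_vr fun e' => hpe ?_
        rw [ofSet_injective e', mem_sing])
  have hwf : ∀ x ∈ vr (FinPlus.sing p :: (T ++ q)), wf p T (h x) = wf p (FinPlus.sing p :: T) x := by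
    intro x hx
    rcases hcase x hx with rfl | ⟨h1, -, -⟩
    · rw [hh1, wf_mem List.mem_cons_self, wf_self hTF hp]
    · rw [hh2 x h1, wf_cons h1]
  have himg : ∀ x, IsFace (FinPlus.sing p :: (T ++ q)) x →
      x.image (wf p T ∘ h) = x.image (wf p (FinPlus.sing p :: T)) := fun x hx =>
    image_congr_fun fun v hv => hwf v (hx.mem_vr hv)
  refine ⟨L, F', fun x => ?_, h3, G.mem_cod, G.cod_pairwise, h1, fun x _ hx => ?_, fun e he => ?_⟩
  · rw [h2]
    exact and_congr_right fun hx => by rw [himg x hx]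
  · rw [h4 x hx, G.eq_of_vr _ (mem_vr_append_of_ne E (hpw.mem_vr hx) fun e he => hEx e he _)
      (hpw.mem_vr hx), hwf x hx]
  · rw [(h5 e he).2, G.eq_of_mem _ (h5 e he).1, image_image, himg e ((h2 e).mp he).1]

/-- Each set is welded to an arbitrary element of its own. As the sets do not contain one another,
these elements are fixed by the later welds. -/
theorem exists_pw_weld_list {R : SetSeq Ur} {x : Elem Ur} (hx : x ∈ vr R) : ∀ {L : SetSeq Ur},
    (∀ a ∈ L, ofSet a ∉ vr R) → L.Nodup → (∀ a ∈ L, ∀ v ∈ a.1, ∀ b ∈ L, v ≠ ofSet b) →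
    ∃ W, PW (L ++ R) R W ∧ (∀ x, (∀ a ∈ L, x ≠ ofSet a) → W x = x) ∧ ∀ a ∈ L, W (ofSet a) ∈ a.1
  | [], _, _, _ => ⟨id, pw_id hx, fun _ _ => rfl, by simp⟩
  | a :: L, h1, h2, h3 => by
    rw [List.nodup_cons] at h2
    obtain ⟨W, hW1, hW2, hW3⟩ := exists_pw_weld_list hx (L := L)
      (fun b hb => h1 b (List.mem_cons_of_mem _ hb)) h2.2 fun b hb v hv c hc =>
        h3 b (List.mem_cons_of_mem _ hb) v hv c (List.mem_cons_of_mem _ hc)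
    obtain ⟨v, hv⟩ := a.2
    have ha : ofSet a ∉ vr (L ++ R) := notMem_vr_append (h1 a List.mem_cons_self) fun z hz e =>
      h2.1 (ofSet_injective e ▸ hz)
    have hne : ∀ b ∈ L, ofSet b ≠ ofSet a := fun b hb e => h2.1 (ofSet_injective e ▸ hb)
    refine ⟨W ∘ Function.update id (ofSet a) v, hW1.comp (pw_weld ha (by simpa using hv)
      fun x hx => ?_), fun x hx => ?_, fun b hb => ?_⟩
    · rw [Function.update_of_ne (by rintro rfl; exact ha hx)]; rfl
    · rw [Function.comp_apply, Function.update_of_ne (hx a List.mem_cons_self)]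
      exact hW2 x fun b hb => hx b (List.mem_cons_of_mem _ hb)
    · rw [Function.comp_apply]
      rcases List.mem_cons.mp hb with rfl | hb
      · rw [Function.update_self, hW2 v fun c hc => h3 b List.mem_cons_self v hv c
          (List.mem_cons_of_mem _ hc)]
        exact hv
      · rw [Function.update_of_ne (hne b hb)]
        exact hW3 b hb

/-- The set `{p}` can be added to the family on which the division is based. -/
theorem Good.insert_sing {q T E Sl : SetSeq Ur} {p : Elem Ur} {S : Set (FinPlus Ur)}
    {F : Elem Ur → Elem Ur} (G : Good (T ++ q) q (wf p T) S E Sl F)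
    (hp : p ∈ vr q) (hS : ∀ s ∈ S, IsFace q s ∧ p ∈ s.1 ∧ s.1 ≠ {p}) (hne : (vr (T ++ q)).Nonempty) :
    ∃ E' Sl' F', Good (T ++ q) q (wf p T) (insert (FinPlus.sing p) S) E' Sl' F' := by
  obtain ⟨D, hmD, hDP⟩ := exists_pairwise_enum (finite_wf_fiber p T (T ++ q) (FinPlus.sing p))
  simp only [Set.mem_ofPred_eq] at hmD
  have hDF : ∀ e ∈ D, IsFace (T ++ q) e := fun e he => ((hmD e).mp he).1
  have hDi : ∀ e ∈ D, ∀ v ∈ e.1, wf p T v = p := fun e he v hv => by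
    have := Finset.mem_image_of_mem (wf p T) hv
    rwa [← image_val, ((hmD e).mp he).2, mem_sing] at this
  have hEx : ∀ e ∈ E, ∀ v, e.1 ≠ {v} := fun e he =>
    ne_singleton_of_image (f := wf p T) rfl (hS _ ((G.mem_dom e).mp he).2).2.1
      (hS _ ((G.mem_dom e).mp he).2).2.2
  have hsS : FinPlus.sing p ∉ S := fun h => (hS _ h).2.2 rfl
  have hDE : ∀ e ∈ D, e ∉ E := fun e he h => hsS (((hmD e).mp he).2 ▸ ((G.mem_dom e).mp h).2)
  obtain ⟨x₀, hx₀⟩ := hne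
  -- Division by `{p}` is not pure when `p` has several preimages. Instead the fiber of `{p}` is
  -- welded away, the known map is applied, and `p` is renamed to `{p}`.
  obtain ⟨W, hW1, hW2, hW3⟩ := exists_pw_weld_list
    (mem_vr_append_of_ne E hx₀ fun e he => hEx e he x₀) (L := D)
    (fun a ha => notMem_vr_append (hDF a ha).notMem_vr fun z hz e =>
      hDE a ha (ofSet_injective e ▸ hz)) (nodup_of_pairwise hDP)
    fun a ha v hv b hb => (hDF b hb).mem_vr_ne ((hDF a ha).mem_vr hv)
  set u := ofSet (FinPlus.sing p) with hu
  have huq : u ∉ vr (Sl ++ q) := notMem_vr_append (isFace_sing hp).notMem_vr fun z hz e =>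
    hsS (ofSet_injective e ▸ (G.mem_cod z).mp hz)
  have h3 : PW (Sl ++ q) (FinPlus.sing p :: (Sl ++ q)) (Function.update id p u) :=
    pw_toSing huq (Function.update_self ..) fun y _ hy => Function.update_of_ne hy ..
  have hsub : ∀ b ∈ S, ¬ b.1 ⊆ {p} := fun b hb h =>
    (hS b hb).2.2 ((Finset.subset_singleton_iff.mp h).resolve_left b.2.ne_empty)
  refine ⟨D ++ E, FinPlus.sing p :: Sl, Function.update id p u ∘ F ∘ W, fun x => ?_, ?_,
    fun s => ?_, ?_, ?_, fun x hx hx' => ?_, fun e he => ?_⟩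
  · rw [List.mem_append, hmD, G.mem_dom, Set.mem_insert_iff]
    tauto
  · refine List.pairwise_append.mpr ⟨hDP, G.dom_pairwise, fun a ha b hb hba => ?_⟩
    refine hsub _ ((G.mem_dom b).mp hb).2 ?_
    have := Finset.image_subset_image (f := wf p T) hba
    rw [← image_val, ← image_val, ((hmD a).mp ha).2] at this
    exact this
  · rw [List.mem_cons, G.mem_cod, Set.mem_insert_iff]
  · exact List.pairwise_cons.mpr ⟨fun b hb => hsub b ((G.mem_cod b).mp hb), G.cod_pairwise⟩
  · rw [List.append_assoc]
    exact h3.comp (G.pw.comp hW1)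
  · rw [List.append_assoc] at hx
    have hWx : W x = x := hW2 x fun a ha => (hDF a ha).mem_vr_ne hx'
    have hx2 := hW1.mem_vr hx
    rw [hWx] at hx2
    -- For a vertex `x` over `p`, the singleton `{x}` lies in the fiber of `{p}`, so its division
    -- has removed `x`. Hence the final renaming does not affect the images of surviving vertices.
    have hwx : wf p T x ≠ p := by
      intro h
      have hxD : FinPlus.sing x ∈ D := (hmD _).mpr ⟨isFace_sing hx', by rw [image_sing, h]⟩
      have h4 := mem_vr_iff.mp hx
      rw [fa_append D fun r hr h' =>
        (hDF r hr).mem_vr_ne hx' (Finset.mem_singleton.mp h').symm] at h4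
      exact h4.2 _ hxD subset_rfl
    rw [Function.comp_apply, Function.comp_apply, hWx, G.eq_of_vr x hx2 hx',
      Function.update_of_ne hwx]
    rfl
  · rw [Function.comp_apply, Function.comp_apply]
    rcases List.mem_append.mp he with he | he
    · have hv := (hDF e he).mem_vr (hW3 e he)
      rw [G.eq_of_vr _ (mem_vr_append_of_ne E hv fun e he => hEx e he _) hv,
        hDi e he _ (hW3 e he), Function.update_self, ((hmD e).mp he).2]
    · rw [hW2 (ofSet e) fun a ha e' => hDE a ha (ofSet_injective e' ▸ he), G.eq_of_mem e he,
        Function.update_of_ne]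
      · rfl
      · intro h
        refine (hS _ ((G.mem_dom e).mp he).2).1.notMem_vr ?_
        rwa [h]

/-- Sets that do not contain `p` can be added to the family on which the division is based. -/
theorem Good.union_left {q T E Sl : SetSeq Ur} {p : Elem Ur} {S : Set (FinPlus Ur)}
    {F : Elem Ur → Elem Ur} (G : Good (T ++ q) q (wf p T) S E Sl F)
    (hT : ∀ t ∈ T, IsFace q t ∧ p ∈ t.1) (hS : ∀ s ∈ S, IsFace q s ∧ p ∈ s.1)
    {S' : Set (FinPlus Ur)} (hS' : ∀ s ∈ S', IsFace q s ∧ p ∉ s.1) (hfin : S'.Finite) :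
    ∃ E' Sl' F', Good (T ++ q) q (wf p T) (S' ∪ S) E' Sl' F' := by
  obtain ⟨L, hmL, hLP⟩ := exists_pairwise_enum hfin
  have hTF : ∀ t ∈ T, IsFace q t := fun t ht => (hT t ht).1
  have hLF : ∀ z ∈ L, IsFace q z := fun z hz => (hS' z ((hmL z).mp hz)).1
  have hLp : ∀ z ∈ L, p ∉ z.1 := fun z hz => (hS' z ((hmL z).mp hz)).2
  have hEF : ∀ e ∈ E, IsFace (T ++ q) e := fun e he => ((G.mem_dom e).mp he).1
  have hEp : ∀ e ∈ E, p ∈ e.1.image (wf p T) := fun e he => (hS _ ((G.mem_dom e).mp he).2).2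
  have hLw : ∀ z ∈ L, z.image (wf p T) = z := fun z hz => wf_image_of_subset hTF (hLF z hz)
  have hEL : ∀ z ∈ L, ∀ e ∈ E, ¬ e.1 ⊆ z.1 := fun z hz e he h => hLp z hz (by
    have := Finset.image_subset_image (f := wf p T) h (hEp e he)
    rwa [← image_val, hLw z hz] at this)
  set d := E ++ (T ++ q) with hd
  have hv : ∀ z ∈ L, ∀ v ∈ z.1, v ∈ vr (T ++ q) ∧ v ∈ vr d ∧ F v = v := by
    intro z hz v hv
    have hvq := (hLF z hz).mem_vr hv
    have hvp : v ≠ p := fun e => hLp z hz (e ▸ hv)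
    have h1 : v ∈ vr (T ++ q) := mem_vr_append_of_ne T hvq fun t ht e => hvp (by
      have := (hT t ht).2
      rw [e, Finset.mem_singleton] at this
      exact this.symm)
    have h2 : v ∈ vr d := mem_vr_append_of_ne E h1 fun e he e' => hvp (by
      have := hEp e he
      rw [e', Finset.image_singleton, Finset.mem_singleton, wf_of_mem_vr hTF hvq] at this
      exact this.symm)
    exact ⟨h1, h2, by rw [G.eq_of_vr v h2 h1, wf_of_mem_vr hTF hvq]⟩
  have hfr : ∀ z ∈ L, ofSet z ∉ vr d := fun z hz =>
    notMem_vr_append (notMem_vr_append (hLF z hz).notMem_vr fun t ht e => hLp z hz (by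
      rw [ofSet_injective e]
      exact (hT t ht).2)) fun e he e' => hEL z hz e he (by rw [ofSet_injective e'])
  have hLi : ∀ z ∈ L, z.image F = z := fun z hz => image_eq_self fun v h => (hv z hz v h).2.2
  set F' : Elem Ur → Elem Ur := fun x => if ∃ z ∈ L, x = ofSet z then x else F x with hF'
  have hF'd : ∀ x ∈ vr d, F' x = F x := fun x hx =>
    if_neg fun ⟨z, hz, e⟩ => hfr z hz (e ▸ hx)
  have hF'L : ∀ z ∈ L, F' (ofSet z) = ofSet z := fun z hz => if_pos ⟨z, hz, rfl⟩
  have key : PW (L ++ d) (L ++ (Sl ++ q)) F' := by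
    have hmap : L.map (FinPlus.image F) = L := by
      conv_rhs => rw [← List.map_id L]
      exact List.map_congr_left fun z hz => hLi z hz
    rw [← congrArg (· ++ (Sl ++ q)) hmap]
    -- The vertices of these sets differ from `p`, hence have only themselves as preimages, and the
    -- division is pure.
    refine G.pw.append L (fun z hz v h => (hv z hz v h).2.1) hfr (fun z hz v h x hx hxv => ?_) ?_
      hF'd fun z hz => by rw [hF'L z hz, hLi z hz]
    · rw [(hv z hz v h).2.2] at hxv
      have hvq := (hLF z hz).mem_vr h
      rcases mem_vr_of_append hx with hx' | ⟨e, he, rfl⟩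
      · rw [G.eq_of_vr x hx hx'] at hxv
        by_cases hn : ∃ t ∈ T, x = ofSet t
        · rw [show wf p T x = p from if_pos hn] at hxv
          exact absurd (hxv ▸ h) (hLp z hz)
        · rwa [show wf p T x = x from if_neg hn] at hxv
      · rw [G.eq_of_mem e he] at hxv
        exact absurd hxv.symm ((hS _ ((G.mem_dom e).mp he).2).1.mem_vr_ne hvq)
    · refine hLP.imp fun hab v hva e => hab ?_
      rw [e]
      exact Finset.singleton_subset_iff.mpr hva
  have hfilter : ∀ z, z ∈ L.filter (fun z => IsFace d z) ↔ z ∈ L ∧ IsFace (T ++ q) z := by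
    intro z
    rw [List.mem_filter, decide_eq_true_iff]
    refine and_congr_right fun hz => ⟨fun h => (h.of_append fun e he hez => ?_).1, fun h =>
      h.append hEF (hEL z hz)⟩
    exact (hEF e he).mem_vr_ne (hv z hz _ hez).1 rfl
  refine ⟨L.filter (fun z => IsFace d z) ++ E, L ++ Sl, F', fun x => ?_, ?_, fun s => ?_, ?_, ?_,
    fun x hx hx' => ?_, fun e he => ?_⟩
  · rw [List.mem_append, hfilter, G.mem_dom, Set.mem_union]
    constructor
    · rintro (⟨h1, h2⟩ | h)
      · exact ⟨h2, Or.inl (by rw [hLw x h1]; exact (hmL x).mp h1)⟩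
      · exact ⟨h.1, Or.inr h.2⟩
    · rintro ⟨h1, h2 | h2⟩
      · left
        have hxT : ∀ v ∈ x.1, wf p T v = v := fun v h => by
          by_cases hn : ∃ t ∈ T, v = ofSet t
          · have hv : wf p T v = p := if_pos hn
            have h3 := Finset.mem_image_of_mem (wf p T) h
            rw [hv] at h3
            exact absurd h3 (hS' _ h2).2
          · exact if_neg hn
        rw [image_eq_self hxT] at h2
        exact ⟨(hmL x).mpr h2, h1⟩
      · exact Or.inr ⟨h1, h2⟩
  · exact List.pairwise_append.mpr ⟨hLP.filter _, G.dom_pairwise, fun a ha b hb =>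
      hEL a ((hfilter a).mp ha).1 b hb⟩
  · rw [List.mem_append, hmL, G.mem_cod, Set.mem_union]
  · exact List.pairwise_append.mpr ⟨hLP, G.cod_pairwise, fun a ha b hb h =>
      hLp a ha (h (hS b ((G.mem_cod b).mp hb)).2)⟩
  · rw [List.append_assoc, List.append_assoc]
    exact key.congr (CombEquiv.filter_isFace fun r hr r' hr' hm =>
      hfr r hr (hv r' hr' _ hm).2.1).symm (.refl _) fun _ _ => rfl
  · have hx2 : x ∈ vr d := by
      rw [List.append_assoc] at hx
      rcases mem_vr_of_append hx with h | ⟨z, hz, rfl⟩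
      · exact h
      · exact absurd hx' ((hfilter z).mp hz).2.notMem_vr
    rw [hF'd x hx2, G.eq_of_vr x hx2 hx']
  · rcases List.mem_append.mp he with he | he
    · have he' := ((hfilter e).mp he).1
      rw [hF'L e he', hLw e he']
    · rw [← G.eq_of_mem e he]
      refine if_neg fun ⟨z, hz, e'⟩ => hEL z hz e he (by rw [ofSet_injective e'])

/-! ### The general additive family. -/

/-- The union `s ∪ t` is in `T`. It is not to the right of `t`, for it would already be divided, and
not to the left, because the list is non-decreasing. So it equals `t`. -/
theorem tri_of_union_mem {q T : SetSeq Ur} {s : FinPlus Ur} (hs : IsFace q s)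
    (hT : ∀ t ∈ T, IsFace q t) (hP : T.Pairwise fun a b => ¬ b.1 ⊆ a.1)
    (hsT : ∀ t ∈ T, IsFace q (s.union t) → s.union t ∈ T) {T₀ T₁ : SetSeq Ur} {t : FinPlus Ur}
    (e : T = T₀ ++ t :: T₁) (hF : IsFace (T₁ ++ q) (s.union t)) : s.1 ⊆ t.1 := by
  subst e
  have ht : t ∈ T₀ ++ t :: T₁ := by simp
  obtain ⟨h1, h2⟩ := hF.of_append fun r hr => by
    have hrF := hT r (by simp [hr])
    rw [union_val, Finset.mem_union, not_or]
    exact ⟨hrF.notMem hs, hrF.notMem (hT t ht)⟩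
  have h3 := hsT t ht h1
  rw [List.mem_append, List.mem_cons] at h3
  rcases h3 with h3 | h3 | h3
  · exact absurd Finset.subset_union_right ((List.pairwise_append.mp hP).2.2 _ h3 t (by simp))
  · rw [← h3]
    exact Finset.subset_union_left
  · exact absurd subset_rfl (h2 _ h3)

/-- The members of `S` are split by their relation to `p`: those that contain `p` properly are
treated by induction, then `{p}` is added, and then the sets without `p`, which may come last since
they include none of the others. -/
theorem exists_good {q T : SetSeq Ur} {S : Finset (FinPlus Ur)} {p : Elem Ur}
    (hS : IsAdditive q (S : Set (FinPlus Ur))) (hT : ∀ t ∈ T, IsFace q t ∧ p ∈ t.1)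
    (hP : T.Pairwise fun a b => ¬ b.1 ⊆ a.1)
    (hST : ∀ s ∈ S, ∀ t ∈ T, IsFace q (s.union t) → s.union t ∈ T) (hp : p ∈ vr q) :
    ∃ E Sl F, Good (T ++ q) q (wf p T) (S : Set (FinPlus Ur)) E Sl F := by
  have hTF : ∀ t ∈ T, IsFace q t := fun t ht => (hT t ht).1
  set S₁ := S.filter (fun s => p ∈ s.1 ∧ s.1 ≠ {p}) with hS₁
  have hm₁ : ∀ s, s ∈ S₁ ↔ s ∈ S ∧ p ∈ s.1 ∧ s.1 ≠ {p} := fun s => Finset.mem_filter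
  have hadd : IsAdditive q (S₁ : Set (FinPlus Ur)) := by
    refine ⟨fun s hs => hS.1 s ((hm₁ s).mp hs).1, fun a ha b hb hab => ?_⟩
    obtain ⟨ha1, ha2, ha3⟩ := (hm₁ a).mp ha
    obtain ⟨hb1, -, -⟩ := (hm₁ b).mp hb
    refine (hm₁ _).mpr ⟨hS.2 a ha1 b hb1 hab, Finset.mem_union_left _ ha2, fun h => ha3 ?_⟩
    exact (Finset.subset_singleton_iff.mp (h ▸ Finset.subset_union_left :
      a.1 ⊆ {p})).resolve_left a.2.ne_empty
  have hcol : ∀ {T' : SetSeq Ur}, (∀ t ∈ T', IsFace q t ∧ p ∈ t.1 ∧ t.1 ≠ {p}) →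
      (∃ T₀, T = T₀ ++ T') → ∀ s ∈ S₁, ColHyp q p s T' := by
    rintro T' hT' ⟨T₀, rfl⟩ s hs
    obtain ⟨h1, h2, h3⟩ := (hm₁ s).mp hs
    refine ⟨hS.1 s h1, h2, h3, hT', (List.pairwise_append.mp hP).2.1, fun T₁ t T₂ e hF => Or.inl ?_⟩
    exact tri_of_union_mem (hS.1 s h1) hTF hP (hST s h1) (T₀ := T₀ ++ T₁) (by simp [e]) hF
  have hcore : ∃ E Sl F, Good (T ++ q) q (wf p T) (S₁ : Set (FinPlus Ur)) E Sl F := by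
    by_cases hsing : FinPlus.sing p ∈ T
    · cases T with
      | nil => simp at hsing
      | cons t T =>
        -- Every member of `T` includes `{p}`, so in a non-decreasing list `{p}` stands first.
        have ht : t = FinPlus.sing p := by
          rcases List.mem_cons.mp hsing with h | h
          · exact h.symm
          · exact absurd (Finset.singleton_subset_iff.mpr (hT t (by simp)).2)
              ((List.pairwise_cons.mp hP).1 _ h)
        subst ht
        have hT' : ∀ t ∈ T, IsFace q t ∧ p ∈ t.1 ∧ t.1 ≠ {p} := fun t ht =>
          ⟨hTF t (List.mem_cons_of_mem _ ht), (hT t (List.mem_cons_of_mem _ ht)).2, fun h =>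
            (List.pairwise_cons.mp hP).1 t ht h.subset⟩
        obtain ⟨E, Sl, F, G⟩ := exists_good_of_colHyp _ q T S₁ rfl hadd
          (hcol hT' ⟨[FinPlus.sing p], rfl⟩) (fun t ht => ⟨(hT' t ht).1, (hT' t ht).2.1⟩)
          (List.pairwise_cons.mp hP).2 hp
        obtain ⟨E', F', G'⟩ := G.cons_sing hT' hp fun s hs => ((hm₁ s).mp hs).2
        exact ⟨E', Sl, F', G'⟩
    · have hT' : ∀ t ∈ T, IsFace q t ∧ p ∈ t.1 ∧ t.1 ≠ {p} := fun t ht =>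
        ⟨(hT t ht).1, (hT t ht).2, fun h => hsing (by
          rwa [← (Subtype.ext h : t = FinPlus.sing p)])⟩
      exact exists_good_of_colHyp _ q T S₁ rfl hadd (hcol hT' ⟨[], rfl⟩) hT hP hp
  have hcore' : ∃ E Sl F, Good (T ++ q) q (wf p T) {s | s ∈ S ∧ p ∈ s.1} E Sl F := by
    obtain ⟨E, Sl, F, G⟩ := hcore
    by_cases h : FinPlus.sing p ∈ S
    · have hvr : (vr (T ++ q)).Nonempty := by
        by_contra hvr
        rw [Set.not_nonempty_iff_eq_empty] at hvr
        have : Fa (T ++ q) {p} → False := fun h => by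
          have := mem_vr_iff.mpr h
          rwa [hvr] at this
        cases T with
        | nil => exact this (mem_vr_iff.mp hp)
        | cons t T =>
          have hF : IsFace (T ++ q) t := (hTF t (by simp)).append
            (fun r hr => hTF r (by simp [hr])) (List.pairwise_cons.mp hP).1
          have := hF.ofSet_mem_vr_cons
          rw [← List.cons_append, hvr] at this
          exact this
      obtain ⟨E', Sl', F', G'⟩ := G.insert_sing hp (fun s hs =>
        ⟨hadd.1 s hs, ((hm₁ s).mp hs).2⟩) hvr
      refine ⟨E', Sl', F', ?_⟩
      convert G' using 1
      ext s
      simp only [Set.mem_ofPred_eq, Set.mem_insert_iff, Finset.mem_coe, hm₁]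
      constructor
      · rintro ⟨h1, h2⟩
        by_cases h3 : s.1 = {p}
        · exact Or.inl (Subtype.ext h3)
        · exact Or.inr ⟨h1, h2, h3⟩
      · rintro (rfl | h1)
        · exact ⟨h, mem_sing.mpr rfl⟩
        · exact ⟨h1.1, h1.2.1⟩
    · refine ⟨E, Sl, F, ?_⟩
      convert G using 1
      ext s
      simp only [Set.mem_ofPred_eq, Finset.mem_coe, hm₁]
      refine ⟨fun h1 => ⟨h1.1, h1.2, fun h2 => h ?_⟩, fun h1 => ⟨h1.1, h1.2.1⟩⟩
      rw [← (Subtype.ext h2 : s = FinPlus.sing p)]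
      exact h1.1
  obtain ⟨E, Sl, F, G⟩ := hcore'
  obtain ⟨E', Sl', F', G'⟩ := G.union_left hT (fun s hs => ⟨hS.1 s hs.1, hs.2⟩)
    (S' := {s | s ∈ S ∧ p ∉ s.1}) (fun s hs => ⟨hS.1 s hs.1, hs.2⟩)
    (S.finite_toSet.subset fun s hs => hs.1)
  refine ⟨E', Sl', F', ?_⟩
  convert G' using 1
  ext s
  simp only [Set.mem_union, Set.mem_ofPred_eq, Finset.mem_coe]
  tauto

/-! ### Iterated division and the main theorem. -/

/-- The shape of an iterated division. -/
structure IsFullDivision (f : SeqMap Ur) (S E : SetSeq Ur) (g : SeqMap Ur) : Prop where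
  dom : g.dom = E ++ f.dom
  cod : g.cod = S ++ f.cod
  mem_dom : ∀ x, x ∈ E ↔ IsFace f.dom x ∧ x.image f.toFun ∈ S
  pairwise : E.Pairwise fun a b => ¬ b.1 ⊆ a.1
  eq_of_vr : ∀ x ∈ vr f.dom, g.toFun x = f.toFun x
  eq_of_mem : ∀ e ∈ E, g.toFun (ofSet e) = ofSet (e.image f.toFun)

/-- Earlier divisions are based on faces that `s` neither contains nor includes, so they leave the
fiber of `s` unchanged. Thus an iterated division can be read off from the undivided map. -/
theorem IsFullDivision.mem_fiber {f g : SeqMap Ur} {S E : SetSeq Ur} (H : IsFullDivision f S E g)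
    {s : FinPlus Ur} (hs : IsFace f.cod s) (hS : ∀ r ∈ S, IsFace f.cod r ∧ ¬ r.1 ⊆ s.1)
    (x : FinPlus Ur) : x ∈ g.fiber s ↔ IsFace f.dom x ∧ x.image f.toFun = s := by
  have himg : ∀ x, IsFace f.dom x → x.image g.toFun = x.image f.toFun := fun x hx =>
    image_congr_fun fun v hv => H.eq_of_vr v (hx.mem_vr hv)
  change IsFace g.dom x ∧ _ ↔ _
  rw [H.dom]
  constructor
  · rintro ⟨h1, h2⟩
    have h3 := (h1.of_append fun r hr hrx => by
      refine (hS _ ((H.mem_dom r).mp hr).2).1.notMem hs ?_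
      rw [← h2, ← H.eq_of_mem r hr]
      exact Finset.mem_image_of_mem _ hrx).1
    exact ⟨h3, by rw [← himg x h3, h2]⟩
  · rintro ⟨h1, h2⟩
    refine ⟨h1.append (fun r hr => ((H.mem_dom r).mp hr).1) fun r hr hrx => ?_, by rw [himg x h1, h2]⟩
    refine (hS _ ((H.mem_dom r).mp hr).2).2 ?_
    rw [← h2]
    exact Finset.image_subset_image hrx

theorem IsFullDivision.divide {f g : SeqMap Ur} {S E D : SetSeq Ur} (H : IsFullDivision f S E g)
    {s : FinPlus Ur} (hs : IsFace f.cod s) (hS : ∀ r ∈ S, IsFace f.cod r ∧ ¬ r.1 ⊆ s.1)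
    (hD : IsNonDecEnum D (g.fiber s)) : IsFullDivision f (s :: S) (D ++ E) (g.divide s D) := by
  have hmD : ∀ x, x ∈ D ↔ IsFace f.dom x ∧ x.image f.toFun = s := fun x =>
    (hD.2.1 x).trans (H.mem_fiber hs hS x)
  refine ⟨?_, ?_, fun x => ?_, ?_, fun x hx => ?_, fun e he => ?_⟩
  · change D ++ g.dom = _
    rw [H.dom, List.append_assoc]
  · change s :: g.cod = _
    rw [H.cod]
    rfl
  · rw [List.mem_append, hmD, H.mem_dom, List.mem_cons]
    tauto
  · refine List.pairwise_append.mpr ⟨hD.pairwise, H.pairwise, fun a ha b hb hba => ?_⟩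
    refine (hS _ ((H.mem_dom b).mp hb).2).2 ?_
    rw [← ((hmD a).mp ha).2]
    exact Finset.image_subset_image hba
  · rw [← H.eq_of_vr x hx]
    exact if_neg fun ⟨t, ht, e⟩ => ((H.mem_fiber hs hS t).mp ht).1.mem_vr_ne hx e
  · rcases List.mem_append.mp he with he | he
    · rw [((hmD e).mp he).2]
      exact if_pos ⟨e, (hD.2.1 e).mp he, rfl⟩
    · rw [← H.eq_of_mem e he]
      refine if_neg fun ⟨t, ht, e'⟩ => ?_
      have h1 := ((H.mem_fiber hs hS t).mp ht).2
      rw [← ofSet_injective e'] at h1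
      exact (hS _ ((H.mem_dom e).mp he).2).2 (h1 ▸ subset_rfl)

theorem isFullDivision_nil (f : SeqMap Ur) : IsFullDivision f [] [] f :=
  ⟨rfl, rfl, by simp, by simp, fun _ _ => rfl, by simp⟩

theorem SeqMap.IsIterDivision.exists_isFullDivision {f g : SeqMap Ur} {S : SetSeq Ur}
    (h : IsIterDivision f S g) (hS : ∀ s ∈ S, IsFace f.cod s)
    (hP : S.Pairwise fun a b => ¬ b.1 ⊆ a.1) : ∃ E, IsFullDivision f S E g := by
  induction h with
  | nil => exact ⟨[], isFullDivision_nil f⟩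
  | cons s _ hE ih =>
    rw [List.pairwise_cons] at hP
    rw [List.forall_mem_cons] at hS
    obtain ⟨E', H⟩ := ih hS.2 hP.2
    exact ⟨_, H.divide hS.1 (fun r hr => ⟨hS.2 r hr, hP.1 r hr⟩) hE⟩

theorem exists_isIterDivision {f : SeqMap Ur} : ∀ {S : SetSeq Ur}, (∀ s ∈ S, IsFace f.cod s) →
    (S.Pairwise fun a b => ¬ b.1 ⊆ a.1) →
    (∀ s ∈ S, {x | IsFace f.dom x ∧ x.image f.toFun = s}.Finite) → ∃ g, IsIterDivision f S g
  | [], _, _, _ => ⟨f, .nil⟩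
  | s :: S, hS, hP, hfin => by
    rw [List.pairwise_cons] at hP
    rw [List.forall_mem_cons] at hS hfin
    obtain ⟨g, hg⟩ := exists_isIterDivision hS.2 hP.2 hfin.2
    obtain ⟨E, H⟩ := hg.exists_isFullDivision hS.2 hP.2
    have hf : (g.fiber s).Finite := hfin.1.subset fun x hx =>
      (H.mem_fiber hS.1 (fun r hr => ⟨hS.2 r hr, hP.1 r hr⟩) x).mp hx
    obtain ⟨D, hD⟩ := exists_isNonDecEnum hf.toFinset
    rw [Set.Finite.coe_toFinset] at hD
    exact ⟨_, .cons s hg hD⟩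

/-- The map constructed above and the given iterated division may list the same families in
different orders. Both families are additive, so the sequences are equivalent and the two maps are
the same. -/
theorem isPureWeldDivision_of_isFullDivision {q T S E : SetSeq Ur} {S' : Finset (FinPlus Ur)}
    {p : Elem Ur} {g : SeqMap Ur} (H : IsFullDivision (weldFamily q p T) S E g)
    (hmS : ∀ s, s ∈ S ↔ s ∈ S') (hSP : S.Pairwise fun a b => ¬ b.1 ⊆ a.1)
    (hS : IsAdditive q (S' : Set (FinPlus Ur))) (hT : ∀ t ∈ T, IsFace q t ∧ p ∈ t.1)
    (hP : T.Pairwise fun a b => ¬ b.1 ⊆ a.1)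
    (hST : ∀ s ∈ S', ∀ t ∈ T, IsFace q (s.union t) → s.union t ∈ T) (hp : p ∈ vr q) :
    IsPureWeldDivision g := by
  obtain ⟨E', S'', F, G⟩ := exists_good hS hT hP hST hp
  have hmE : ∀ x, x ∈ E ↔ IsFace (T ++ q) x ∧ x.image (wf p T) ∈ S := H.mem_dom
  have hEE : ∀ x, x ∈ E' ↔ x ∈ E := fun x => by
    rw [hmE, G.mem_dom, hmS]
    rfl
  have hSS : ∀ s, s ∈ S'' ↔ s ∈ S := fun s => (G.mem_cod s).trans (hmS s).symm
  have h1 : CombEquiv (E' ++ (T ++ q)) (E ++ (T ++ q)) := by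
    refine CombEquiv.of_mem_iff hEE (fun a ha => ((G.mem_dom a).mp ha).1) (fun a ha b hb hab => ?_)
      G.dom_pairwise H.pairwise
    refine (G.mem_dom _).mpr ⟨hab, ?_⟩
    -- Additivity of the total fiber: the weld map sends the union of two members, if it is a face,
    -- to a face that is the union of their images, and `S` is additive.
    have hF := (pw_weldFamily hp hT hP).isFace hab
    rw [image_union_val] at hF ⊢
    exact hS.2 _ ((G.mem_dom a).mp ha).2 _ ((G.mem_dom b).mp hb).2 hF
  have h2 : CombEquiv (S'' ++ q) (S ++ q) :=
    CombEquiv.of_mem_iff hSS (fun a ha => hS.1 a ((G.mem_cod a).mp ha)) (fun a ha b hb hab =>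
      (G.mem_cod _).mpr (hS.2 a ((G.mem_cod a).mp ha) b ((G.mem_cod b).mp hb) hab))
      G.cod_pairwise hSP
  have h3 : PW (E ++ (T ++ q)) (S ++ q) g.toFun := by
    refine G.pw.congr h1 h2 fun x hx => ?_
    rcases mem_vr_of_append hx with hx' | ⟨e, he, rfl⟩
    · rw [G.eq_of_vr x hx hx']
      exact (H.eq_of_vr x hx').symm
    · rw [G.eq_of_mem e he]
      exact (H.eq_of_mem e ((hEE e).mp he)).symm
  have hdom : g.dom = E ++ (T ++ q) := H.dom
  have hcod : g.cod = S ++ q := H.cod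
  rw [← hdom, ← hcod] at h3
  exact h3

end

end WeldCalculus

theorem mainTheorem6 {Ur : Type u} (q : SetSeq Ur) (S T : Finset (FinPlus Ur))
    (hS : IsAdditive q (S : Set (FinPlus Ur))) (hT : IsAdditive q (T : Set (FinPlus Ur)))
    (hST : ∀ s ∈ S, ∀ t ∈ T, IsFace q (FinPlus.union s t) → FinPlus.union s t ∈ T)
    (p : Elem Ur) (hp : p ∈ vr q) (hpT : ∀ t ∈ T, p ∈ t.1)
    (Sl Tl : SetSeq Ur) (hSl : IsNonDecEnum Sl (S : Set (FinPlus Ur)))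
    (hTl : IsNonDecEnum Tl (T : Set (FinPlus Ur))) :
    (∃ g : SeqMap Ur, SeqMap.IsIterDivision (weldFamily q p Tl) Sl g) ∧
      ∀ g : SeqMap Ur, SeqMap.IsIterDivision (weldFamily q p Tl) Sl g →
        IsPureWeldDivision g := by
  have hTP := hTl.pairwise
  have hSP := hSl.pairwise
  have hTm : ∀ t ∈ Tl, IsFace q t ∧ p ∈ t.1 := fun t ht =>
    have ht' := (hTl.2.1 t).mp ht
    ⟨hT.1 t ht', hpT t ht'⟩
  have hST' : ∀ s ∈ S, ∀ t ∈ Tl, IsFace q (FinPlus.union s t) → FinPlus.union s t ∈ Tl :=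
    fun s hs t ht h => (hTl.2.1 _).mpr (hST s hs t ((hTl.2.1 t).mp ht) h)
  have hSF : ∀ s ∈ Sl, IsFace (weldFamily q p Tl).cod s := fun s hs => hS.1 s ((hSl.2.1 s).mp hs)
  refine ⟨exists_isIterDivision hSF hSP fun s _ => finite_wf_fiber p Tl _ s, fun g hg => ?_⟩
  obtain ⟨E, H⟩ := hg.exists_isFullDivision hSF hSP
  exact isPureWeldDivision_of_isFullDivision H hSl.2.1 hSP hS hTm hTP hST' hp
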